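/- **Setting.** Let $(\Omega,\mathfrak F,P)$ be a probability space and let $X_\Delta=(X_\Delta(t),\,t\in\mathbb R)$, $\Delta>0$, be measurable stationary centred real Gaussian processes with non-negative continuous spectral densities $f_\Delta$, so that $K_\Delta(t)=E X_\Delta(s+t)X_\Delta(s)=\int_{\mathbb R}e^{i\lambda t}f_\Delta(\lambda)\,d\lambda$. Assume that $f_\Delta(\lambda)=f_\Delta(-\lambda)$, $\sup_{\Delta>0}\|f_\Delta\|_\infty<\infty$, $f_\Delta\in L_1(\mathbb R)$, $K_\Delta\in L_1(\mathbb R)$ for all $\Delta>0$, and that for some $c\in(0,\infty)$ and every $r>0$ $$\lim_{\Delta\to\infty}\ \sup_{|\lambda|\le r}\Bigl|f_\Delta(\lambda)-\frac{c}{2\pi}\Bigr|=0 .$$ Let $H\in L_2(\mathbb R)$ be real-valued with Fourier–Plancherel transform $H^*(\lambda)=\int_{\mathbb R}e^{-i\lambda x}H(x)\,dx$ (in the sense of $L_2$). Put $$Y_\Delta(t)=\int_{-\infty}^{\infty}H(s)X_\Delta(t-s)\,ds,\qquad H_{T,\Delta}(\tau)=\frac1{cT}\int_0^T Y_\Delta(t+\tau)X_\Delta(t)\,dt,\qquad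 T>0,\ \tau\in\mathbb R,$$ where the first integral is the mean-square limit of $\int_A^B H(s)X_\Delta(t-s)\,ds$ as $A\to-\infty$, $B\to\infty$, and the second is a mean-square Riemann integral; both exist under these assumptions. Let $$Z_{T,\Delta}(\tau)=\sqrt T\,\bigl[H_{T,\Delta}(\tau)-E H_{T,\Delta}(\tau)\bigr],\qquad \tau\in\mathbb R,$$ and let $Z=(Z(\tau),\,\tau\in\mathbb R)$ be a centred real Gaussian process on $\Omega$ with $$E Z(\tau_1)Z(\tau_2)=\frac1{2\pi}\int_{-\infty}^{\infty}\Bigl[e^{i(\tau_1-\tau_2)\lambda}|H^*(\lambda)|^2+e^{i(\tau_1+\tau_2)\lambda}\bigl(H^*(\lambda)\bigr)^2\Bigr]d\lambda .$$ For each segment $[a,b]$ considered, separable versions of $Z_{T,\Delta}$ and $Z$ on $[a,b]$ are taken. Define the pseudometrics $$\sigma(\tau_1,\tau_2)=\Bigl[\int_{-\infty}^{\infty}\sin^2\frac{|\tau_1-\tau_2|\lambda}{2}\,|H^*(\lambda)|^2\,d\lambda\Bigr]^{1/2},\qquad \sqrt\sigma(\tau_1,\tau_2)=\sqrt{\sigma(\tau_1,\tau_2)},$$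 and let $\mathcal H_{\sqrt\sigma}(\varepsilon)=\log N(\varepsilon)$, where $N(\varepsilon)$ is the least number of closed $\sqrt\sigma$-balls of radius $\varepsilon$ with centres in $[0,1]$ that cover $[0,1]$. **Theorem.** Assume that $\int_0^u\mathcal H_{\sqrt\sigma}(\varepsilon)\,d\varepsilon<\infty$ for some $u>0$. Then for every segment $[a,b]\subset\mathbb R$: (I) $Z$ is almost surely continuous on $[a,b]$; (II) for all $T>0$, $\Delta>0$, the process $Z_{T,\Delta}$ is almost surely continuous on $[a,b]$; (III) $Z_{T,\Delta}$ converges weakly to $Z$ in the Banach space $C[a,b]$ as $T\to\infty$ and $\Delta\to\infty$ simultaneously (in any manner). In particular, for every $x>0$, $$\lim_{T\to\infty,\ \Delta\to\infty}P\Bigl\{\sup_{\tau\in[a,b]}|Z_{T,\Delta}(\tau)|>x\Bigr\}=P\Bigl\{\sup_{\tau\in[a,b]}|Z(\tau)|>x\Bigr\}.$$ -/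

import Mathlib

open MeasureTheory ProbabilityTheory Filter Topology
open scoped ENNReal NNReal FourierTransform

namespace Correlogram

noncomputable section

/-! ### The Fourier–Plancherel transform and the limit covariance -/

/-- The Fourier–Plancherel transform `H*(lam) = ∫ e^{-i lam x} H(x) dx` (the integral in the sense
of `L²`) of a real function `H ∈ L²(ℝ)`. Mathlib's transform on `L²` has the kernel
`e^{-2πi ξ x}`, hence the rescaling of the argument. -/
def plancherel (H : ℝ → ℝ) (hH : MemLp H 2 volume) (lam : ℝ) : ℂ :=
  (𝓕 (MemLp.toLp (fun x => (H x : ℂ)) hH.ofReal) : Lp ℂ 2 (volume : Measure ℝ))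
    (lam / (2 * Real.pi))

/-- `C_∞(τ₁, τ₂) = (1/2π) ∫ [e^{i(τ₁-τ₂)lam} |H*(lam)|² + e^{i(τ₁+τ₂)lam} H*(lam)²] dlam`. -/
def limitCov (H : ℝ → ℝ) (hH : MemLp H 2 volume) (τ₁ τ₂ : ℝ) : ℂ :=
  (1 / (2 * Real.pi) : ℂ) * ∫ lam : ℝ,
    (Complex.exp (Complex.I * ((τ₁ - τ₂) * lam : ℝ)) * ((‖plancherel H hH lam‖ ^ 2 : ℝ) : ℂ)
      + Complex.exp (Complex.I * ((τ₁ + τ₂) * lam : ℝ)) * plancherel H hH lam ^ 2)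

/-! ### The entropy condition -/

/-- `q_H(τ) = [∫ sin²(τ lam / 2) |H*(lam)|² dlam]^{1/2}`. -/
def qFun (H : ℝ → ℝ) (hH : MemLp H 2 volume) (τ : ℝ) : ℝ :=
  Real.sqrt (∫ lam : ℝ, Real.sin (τ * lam / 2) ^ 2 * ‖plancherel H hH lam‖ ^ 2)

/-- The pseudometric `σ(τ₁, τ₂) = q_H(|τ₁ - τ₂|)`. -/
def sigma (H : ℝ → ℝ) (hH : MemLp H 2 volume) (τ₁ τ₂ : ℝ) : ℝ :=
  qFun H hH |τ₁ - τ₂|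

/-- The pseudometric `√σ`. -/
def sqrtSigma (H : ℝ → ℝ) (hH : MemLp H 2 volume) (τ₁ τ₂ : ℝ) : ℝ :=
  Real.sqrt (sigma H hH τ₁ τ₂)

/-- `N_ρ(S, ε)`: the least number of closed `ρ`-balls of radius `ε` with centres in `S` that
cover `S`; it is `⊤` if there is no finite cover. -/
def coveringNumber (ρ : ℝ → ℝ → ℝ) (S : Set ℝ) (ε : ℝ) : ℕ∞ :=
  ⨅ (C : Set ℝ) (_ : C ⊆ S) (_ : ∀ x ∈ S, ∃ y ∈ C, ρ x y ≤ ε), C.encard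

open Classical in
/-- The metric entropy `log N_ρ(S, ε) ∈ [0, ∞]`. -/
def metricEntropy (ρ : ℝ → ℝ → ℝ) (S : Set ℝ) (ε : ℝ) : ℝ≥0∞ :=
  if coveringNumber ρ S ε = ⊤ then ⊤
  else ENNReal.ofReal (Real.log ((coveringNumber ρ S ε).toNat : ℝ))

/-- `∫_{0+} log N_ρ(S, ε) dε < ∞`, that is, the integral over `(0, u]` is finite for some
`u > 0`. -/
def EntropyIntegralFinite (ρ : ℝ → ℝ → ℝ) (S : Set ℝ) : Prop :=
  ∃ u : ℝ, 0 < u ∧ ∫⁻ ε in Set.Ioc 0 u, metricEntropy ρ S ε < ⊤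

/-! ### Mean-square limits and integrals -/

section Processes

variable {Ω : Type*} [MeasurableSpace Ω]

/-- `η` is the limit in mean square of the family `ξ` along the filter `l`. -/
def IsMSLimit {ι : Type*} (P : Measure Ω) (l : Filter ι) (ξ : ι → Ω → ℝ) (η : Ω → ℝ) : Prop :=
  (∀ i, MemLp (ξ i) 2 P) ∧ MemLp η 2 P ∧
    Tendsto (fun i => eLpNorm (fun ω => ξ i ω - η ω) 2 P) l (𝓝 0)

open Classical in
/-- The limit in mean square (unique up to almost sure equality), and `0` if there is none. -/
def msLimit {ι : Type*} (P : Measure Ω) (l : Filter ι) (ξ : ι → Ω → ℝ) : Ω → ℝ :=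
  if h : ∃ η, IsMSLimit P l ξ η then h.choose else 0

/-- `J` is the mean-square Riemann integral `∫_a^b ξ(t) dt`: the Riemann sums over tagged
partitions `a = t₀ ≤ s₀ ≤ t₁ ≤ s₁ ≤ ⋯ ≤ tₙ = b` tend to `J` in mean square as the mesh of the
partition tends to zero. -/
def IsMSRiemannIntegral (P : Measure Ω) (ξ : ℝ → Ω → ℝ) (a b : ℝ) (J : Ω → ℝ) : Prop :=
  (∀ t ∈ Set.Icc a b, MemLp (ξ t) 2 P) ∧ MemLp J 2 P ∧
    ∀ ε : ℝ, 0 < ε → ∃ δ : ℝ, 0 < δ ∧ ∀ (n : ℕ) (t s : ℕ → ℝ), t 0 = a → t n = b →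
      (∀ i < n, t i ≤ s i ∧ s i ≤ t (i + 1) ∧ t (i + 1) - t i < δ) →
      eLpNorm (fun ω => (∑ i ∈ Finset.range n, ξ (s i) ω * (t (i + 1) - t i)) - J ω) 2 P
        ≤ ENNReal.ofReal ε

open Classical in
/-- The mean-square Riemann integral (unique up to almost sure equality), and `0` if it does not
exist. -/
def msRiemannIntegral (P : Measure Ω) (ξ : ℝ → Ω → ℝ) (a b : ℝ) : Ω → ℝ :=
  if h : ∃ J, IsMSRiemannIntegral P ξ a b J then h.choose else 0

/-! ### The input processes, the response and the estimator -/

/-- `K(t) = ∫ e^{i lam t} f(lam) dlam`. -/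
def spectralCov (f : ℝ → ℝ) (t : ℝ) : ℂ :=
  ∫ lam : ℝ, Complex.exp (Complex.I * (lam * t : ℝ)) * (f lam : ℂ)

/-- `(X_Δ)_{Δ > 0}` is a family of measurable, centred, stationary, real Gaussian processes with
spectral densities `f_Δ` that approximates the white noise of intensity `c`. (A centred Gaussian
process is stationary if and only if its covariance depends on the time difference only.) -/
structure IsInputFamily (P : Measure Ω) (X : ℝ → ℝ → Ω → ℝ) (f : ℝ → ℝ → ℝ) (c : ℝ) :
    Prop where
  measurable : ∀ Δ > 0, Measurable (fun p : ℝ × Ω => X Δ p.1 p.2)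
  gaussian : ∀ Δ > 0, IsGaussianProcess (X Δ) P
  centred : ∀ Δ > 0, ∀ t, ∫ ω, X Δ t ω ∂P = 0
  covariance : ∀ Δ > 0, ∀ s t,
    ((∫ ω, X Δ (s + t) ω * X Δ s ω ∂P : ℝ) : ℂ) = spectralCov (f Δ) t
  density_nonneg : ∀ Δ > 0, ∀ lam, 0 ≤ f Δ lam
  density_continuous : ∀ Δ > 0, Continuous (f Δ)
  density_even : ∀ Δ > 0, ∀ lam, f Δ lam = f Δ (-lam)
  density_bounded : ∃ M : ℝ, ∀ Δ > 0, ∀ lam, f Δ lam ≤ M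
  density_integrable : ∀ Δ > 0, Integrable (f Δ) volume
  c_pos : 0 < c
  density_tendsto : ∀ r > 0,
    TendstoUniformlyOn f (fun _ => c / (2 * Real.pi)) atTop (Set.Icc (-r) r)
  cov_integrable : ∀ Δ > 0, Integrable (spectralCov (f Δ)) volume

/-- The truncated response `∫_A^B H(s) X(t - s) ds`, where `p = (A, B)`. -/
def truncatedResponse (H : ℝ → ℝ) (X : ℝ → Ω → ℝ) (t : ℝ) (p : ℝ × ℝ) (ω : Ω) : ℝ :=
  ∫ s in p.1..p.2, H s * X (t - s) ω

/-- The response `Y(t) = ∫ H(s) X(t - s) ds` of the linear system with impulse response function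
`H` to the input `X`: the limit in mean square of `∫_A^B H(s) X(t - s) ds` as `A → -∞`,
`B → ∞`. -/
def response (P : Measure Ω) (H : ℝ → ℝ) (X : ℝ → Ω → ℝ) (t : ℝ) : Ω → ℝ :=
  msLimit P (atBot ×ˢ atTop) (truncatedResponse H X t)

/-- The correlogram estimator `(1/(cT)) ∫_0^T Y(t + τ) X(t) dt`. -/
def estimator (P : Measure Ω) (H : ℝ → ℝ) (X : ℝ → Ω → ℝ) (c T τ : ℝ) (ω : Ω) : ℝ :=
  1 / (c * T) *
    msRiemannIntegral P (fun t ω' => response P H X (t + τ) ω' * X t ω') 0 T ω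

/-- The normalized, centred estimator `√T [H_T(τ) - E H_T(τ)]`. -/
def centredEstimator (P : Measure Ω) (H : ℝ → ℝ) (X : ℝ → Ω → ℝ) (c T τ : ℝ) (ω : Ω) : ℝ :=
  Real.sqrt T * (estimator P H X c T τ ω - ∫ ω', estimator P H X c T τ ω' ∂P)

/-! ### Separability and sample paths -/

/-- The process `(Z(t), t ∈ S)` is separable: for some countable `D ⊆ S`, almost surely every
point of the graph of the path over `S` is a limit of points of the graph over `D`. -/
def IsSeparableOn (P : Measure Ω) (Z : ℝ → Ω → ℝ) (S : Set ℝ) : Prop :=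
  ∃ D : Set ℝ, D ⊆ S ∧ D.Countable ∧
    ∀ᵐ ω ∂P, ∀ t ∈ S, (t, Z t ω) ∈ closure ((fun s => (s, Z s ω)) '' D)

open Classical in
/-- The path of `Z` on `[a, b]` as an element of `C[a, b]` if it is continuous there; the value
is `0` otherwise. -/
def path (a b : ℝ) (Z : ℝ → Ω → ℝ) (ω : Ω) : C(Set.Icc a b, ℝ) :=
  if h : ContinuousOn (fun τ => Z τ ω) (Set.Icc a b) then
    ⟨(Set.Icc a b).domRestrict (fun τ => Z τ ω), h.domRestrict⟩
  else 0

/-- `sup_{τ ∈ [a, b]} |Z(τ)|`, with values in `[0, ∞]`. -/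
def supAbs (a b : ℝ) (Z : ℝ → Ω → ℝ) (ω : Ω) : ℝ≥0∞ :=
  ⨆ τ ∈ Set.Icc a b, ‖Z τ ω‖ₑ

end Processes

/-- The Borel σ-algebra of the Banach space `C[a, b]`. -/
instance instMeasurableSpaceC (a b : ℝ) : MeasurableSpace C(Set.Icc a b, ℝ) :=
  borel _

instance instBorelSpaceC (a b : ℝ) : BorelSpace C(Set.Icc a b, ℝ) :=
  ⟨rfl⟩

end

end Correlogram

set_option linter.unusedSectionVars false

namespace Correlogram

open scoped SchwartzMap ComplexConjugate

/-! ### The Fourier transform on `L²(ℝ)` -/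

section Fourier

theorem integral_smul_fourier_Lp (G : Lp ℂ 2 (volume : Measure ℝ)) (φ : 𝓢(ℝ, ℂ)) :
    ∫ x, φ x • (𝓕 G : Lp ℂ 2 (volume : Measure ℝ)) x = ∫ x, (𝓕 φ) x • G x := by
  have h := Lp.fourier_toTemperedDistribution_eq G
  have h2 := congrArg (fun T => T φ) h
  simp only [TemperedDistribution.fourier_apply, Lp.toTemperedDistribution_apply] at h2
  exact h2.symm

theorem ae_eq_fourier_Lp_of_integral_eq {G : Lp ℂ 2 (volume : Measure ℝ)} {F : ℝ → ℂ}
    (hF : LocallyIntegrable F volume)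
    (h : ∀ φ : 𝓢(ℝ, ℂ), HasCompactSupport φ → ∫ x, φ x • F x = ∫ x, (𝓕 φ) x • G x) :
    F =ᵐ[volume] (𝓕 G : Lp ℂ 2 (volume : Measure ℝ)) := by
  refine ae_eq_of_integral_contDiff_smul_eq hF
    ((Lp.memLp (𝓕 G : Lp ℂ 2 (volume : Measure ℝ))).locallyIntegrable (by norm_num)) ?_
  intro g hg hgc
  have hg' : ContDiff ℝ ((⊤ : ℕ∞) : WithTop ℕ∞) (fun x => (g x : ℂ)) :=
    Complex.ofRealCLM.contDiff.comp hg
  have hgc' : HasCompactSupport (fun x => (g x : ℂ)) := hgc.comp_left (g := fun y : ℝ => (y : ℂ)) (by simp)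
  have h1 := h (hgc'.toSchwartzMap hg') hgc'
  rw [← integral_smul_fourier_Lp] at h1
  simpa using h1

theorem fourier_toLp_ae_eq {g : ℝ → ℂ} (h1 : Integrable g) (h2 : MemLp g 2 volume) :
    𝓕 g =ᵐ[volume] (𝓕 (h2.toLp g) : Lp ℂ 2 (volume : Measure ℝ)) := by
  have hc : Continuous (𝓕 g) := by
    exact VectorFourier.fourierIntegral_continuous Real.continuous_fourierChar
      (L := innerₗ ℝ) continuous_inner h1
  refine ae_eq_fourier_Lp_of_integral_eq hc.locallyIntegrable ?_
  intro φ hφ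
  have := VectorFourier.integral_fourierIntegral_smul_eq_flip (μ := volume) (ν := volume)
    (L := innerₗ ℝ) (f := φ) (g := g) Real.continuous_fourierChar
    continuous_inner φ.integrable h1
  have hflip : (innerₗ ℝ : ℝ →ₗ[ℝ] ℝ →ₗ[ℝ] ℝ).flip = innerₗ ℝ := flip_innerₗ ℝ
  rw [hflip] at this
  refine Eq.trans this.symm (integral_congr_ae ?_)
  filter_upwards [h2.coeFn_toLp] with x hx
  rw [hx]
  rfl

theorem toLp_ofReal_coeFn {H : ℝ → ℝ} (hH : MemLp H 2 volume) :
    (MemLp.toLp (fun x => (H x : ℂ)) hH.ofReal : Lp ℂ 2 (volume : Measure ℝ))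
      =ᵐ[volume] fun x => (H x : ℂ) := hH.ofReal.coeFn_toLp

theorem memLp_comp_add {H : ℝ → ℝ} (hH : MemLp H 2 volume) (τ : ℝ) :
    MemLp (fun x => H (x + τ)) 2 volume :=
  hH.comp_measurePreserving (measurePreserving_add_right volume τ)

theorem memLp_comp_neg {H : ℝ → ℝ} (hH : MemLp H 2 volume) :
    MemLp (fun x => H (-x)) 2 volume :=
  hH.comp_measurePreserving (Measure.measurePreserving_neg volume)

theorem fourier_translate_ae_eq {H : ℝ → ℝ} (hH : MemLp H 2 volume) (τ : ℝ) :
    (fun ξ : ℝ => Complex.exp (Complex.I * (2 * Real.pi * τ * ξ : ℝ)) *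
      (𝓕 (MemLp.toLp (fun x => (H x : ℂ)) hH.ofReal) : Lp ℂ 2 (volume : Measure ℝ)) ξ)
      =ᵐ[volume] (𝓕 (MemLp.toLp (fun x => (H (x + τ) : ℂ)) (memLp_comp_add hH τ).ofReal) :
        Lp ℂ 2 (volume : Measure ℝ)) := by
  set G := MemLp.toLp (fun x => (H x : ℂ)) hH.ofReal with hG
  have hcont : Continuous fun ξ : ℝ => Complex.exp (Complex.I * (2 * Real.pi * τ * ξ : ℝ)) := by
    fun_prop
  have hli : LocallyIntegrable (fun ξ : ℝ => Complex.exp (Complex.I * (2 * Real.pi * τ * ξ : ℝ)) *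
      (𝓕 G : Lp ℂ 2 (volume : Measure ℝ)) ξ) volume := by
    refine ((Lp.memLp (𝓕 G : Lp ℂ 2 (volume : Measure ℝ))).mono ?_ ?_).locallyIntegrable
      (by norm_num)
    · exact hcont.aestronglyMeasurable.mul (Lp.aestronglyMeasurable _)
    · refine Eventually.of_forall fun ξ => ?_
      rw [norm_mul, mul_comm Complex.I, Complex.norm_exp_ofReal_mul_I, one_mul]
  refine ae_eq_fourier_Lp_of_integral_eq hli ?_
  intro φ hφ
  have hψ : ContDiff ℝ ((⊤ : ℕ∞) : WithTop ℕ∞)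
      (fun ξ : ℝ => Complex.exp (Complex.I * (2 * Real.pi * τ * ξ : ℝ)) * φ ξ) := by
    refine ContDiff.mul ?_ (φ.smooth _)
    refine ContDiff.cexp (contDiff_const.mul (Complex.ofRealCLM.contDiff.comp ?_))
    exact contDiff_const.mul contDiff_id
  have hψc : HasCompactSupport
      (fun ξ : ℝ => Complex.exp (Complex.I * (2 * Real.pi * τ * ξ : ℝ)) * φ ξ) := hφ.mul_left
  have h1 := integral_smul_fourier_Lp G (hψc.toSchwartzMap hψ)
  have e1 : ∫ x, φ x • (Complex.exp (Complex.I * (2 * Real.pi * τ * x : ℝ)) *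
      (𝓕 G : Lp ℂ 2 (volume : Measure ℝ)) x) =
      ∫ x, (hψc.toSchwartzMap hψ) x • (𝓕 G : Lp ℂ 2 (volume : Measure ℝ)) x := by
    refine integral_congr_ae (Eventually.of_forall fun x => ?_)
    simp [smul_eq_mul]; ring
  rw [e1, h1]
  have hF : ∀ x : ℝ, (𝓕 (hψc.toSchwartzMap hψ)) x = (𝓕 φ) (x - τ) := by
    intro x
    rw [SchwartzMap.fourier_coe, SchwartzMap.fourier_coe,
      Real.fourier_real_eq_integral_exp_smul, Real.fourier_real_eq_integral_exp_smul]
    refine integral_congr_ae (Eventually.of_forall fun v => ?_)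
    change Complex.exp _ * (Complex.exp _ * φ v) = Complex.exp _ * φ v
    rw [← mul_assoc, ← Complex.exp_add]
    congr 2
    push_cast
    ring
  have e2 : ∫ x, (𝓕 (hψc.toSchwartzMap hψ)) x • G x = ∫ x, (𝓕 φ) (x - τ) • (H x : ℂ) := by
    refine integral_congr_ae ?_
    filter_upwards [toLp_ofReal_coeFn hH] with x hx
    rw [hF, hx]
  have e3 : ∫ x, (𝓕 φ) x • (MemLp.toLp (fun x => (H (x + τ) : ℂ))
      (memLp_comp_add hH τ).ofReal) x = ∫ x, (𝓕 φ) x • (H (x + τ) : ℂ) := by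
    refine integral_congr_ae ?_
    filter_upwards [toLp_ofReal_coeFn (memLp_comp_add hH τ)] with x hx
    rw [hx]
  rw [e2, e3, ← integral_add_right_eq_self _ τ]
  simp

theorem fourier_reflect_ae_eq {H : ℝ → ℝ} (hH : MemLp H 2 volume) :
    (fun ξ : ℝ => conj
      ((𝓕 (MemLp.toLp (fun x => (H x : ℂ)) hH.ofReal) : Lp ℂ 2 (volume : Measure ℝ)) ξ))
      =ᵐ[volume] (𝓕 (MemLp.toLp (fun x => (H (-x) : ℂ)) (memLp_comp_neg hH).ofReal) :
        Lp ℂ 2 (volume : Measure ℝ)) := by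
  set G := MemLp.toLp (fun x => (H x : ℂ)) hH.ofReal with hG
  have hli : LocallyIntegrable (fun ξ : ℝ => conj
      ((𝓕 G : Lp ℂ 2 (volume : Measure ℝ)) ξ)) volume := by
    refine ((Lp.memLp (𝓕 G : Lp ℂ 2 (volume : Measure ℝ))).mono ?_ ?_).locallyIntegrable
      (by norm_num)
    · exact (Complex.continuous_conj.comp_aestronglyMeasurable (Lp.aestronglyMeasurable _))
    · exact Eventually.of_forall fun ξ => by simp
  refine ae_eq_fourier_Lp_of_integral_eq hli ?_
  intro φ hφ
  have hψ : ContDiff ℝ ((⊤ : ℕ∞) : WithTop ℕ∞) (fun ξ : ℝ => conj (φ ξ)) :=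
    Complex.conjCLE.contDiff.comp (φ.smooth _)
  have hψc : HasCompactSupport (fun ξ : ℝ => conj (φ ξ)) :=
    hφ.comp_left (g := fun z : ℂ => conj z) (by simp)
  have h1 := integral_smul_fourier_Lp G (hψc.toSchwartzMap hψ)
  have e1 : ∫ x, φ x • conj ((𝓕 G : Lp ℂ 2 (volume : Measure ℝ)) x) =
      conj (∫ x, (hψc.toSchwartzMap hψ) x • (𝓕 G : Lp ℂ 2 (volume : Measure ℝ)) x) := by
    rw [← integral_conj]
    refine integral_congr_ae (Eventually.of_forall fun x => ?_)
    simp [smul_eq_mul]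
  have hF : ∀ x : ℝ, conj ((𝓕 (hψc.toSchwartzMap hψ)) x) = (𝓕 φ) (-x) := by
    intro x
    rw [SchwartzMap.fourier_coe, SchwartzMap.fourier_coe,
      Real.fourier_real_eq_integral_exp_smul, Real.fourier_real_eq_integral_exp_smul,
      ← integral_conj]
    refine integral_congr_ae (Eventually.of_forall fun v => ?_)
    change conj (Complex.exp _ * conj (φ v)) = Complex.exp _ * φ v
    simp only [map_mul, ← Complex.exp_conj,
      Complex.conj_ofReal, Complex.conj_I, Complex.conj_conj]
    congr 2
    push_cast
    ring
  have e2 : conj (∫ x, (𝓕 (hψc.toSchwartzMap hψ)) x • G x) = ∫ x, (𝓕 φ) (-x) • (H x : ℂ) := by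
    rw [← integral_conj]
    refine integral_congr_ae ?_
    filter_upwards [toLp_ofReal_coeFn hH] with x hx
    rw [smul_eq_mul, map_mul, hF, hx, Complex.conj_ofReal, smul_eq_mul]
  have e3 : ∫ x, (𝓕 φ) x • (MemLp.toLp (fun x => (H (-x) : ℂ))
      (memLp_comp_neg hH).ofReal) x = ∫ x, (𝓕 φ) x • (H (-x) : ℂ) := by
    refine integral_congr_ae ?_
    filter_upwards [toLp_ofReal_coeFn (memLp_comp_neg hH)] with x hx
    rw [hx]
  rw [e1, h1, e2, e3, ← integral_neg_eq_self]
  simp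

theorem integral_conj_mul_fourier {H₁ H₂ : ℝ → ℝ} (h₁ : MemLp H₁ 2 volume)
    (h₂ : MemLp H₂ 2 volume) :
    ∫ ξ : ℝ, (𝓕 (MemLp.toLp (fun x => (H₁ x : ℂ)) h₁.ofReal) : Lp ℂ 2 (volume : Measure ℝ)) ξ *
      conj ((𝓕 (MemLp.toLp (fun x => (H₂ x : ℂ)) h₂.ofReal) : Lp ℂ 2 (volume : Measure ℝ)) ξ)
      = ((∫ x, H₁ x * H₂ x : ℝ) : ℂ) := by
  have h := Lp.inner_fourier_eq (MemLp.toLp (fun x => (H₂ x : ℂ)) h₂.ofReal)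
    (MemLp.toLp (fun x => (H₁ x : ℂ)) h₁.ofReal)
  rw [L2.inner_def, L2.inner_def] at h
  simp only [RCLike.inner_apply] at h
  rw [h, ← integral_complex_ofReal]
  refine integral_congr_ae ?_
  filter_upwards [toLp_ofReal_coeFn h₁, toLp_ofReal_coeFn h₂] with x hx hx'
  rw [hx, hx']
  simp

theorem integrable_fourier_mul_conj (a b : Lp ℂ 2 (volume : Measure ℝ)) :
    Integrable (fun ξ => a ξ * conj (b ξ)) volume := by
  have := L2.integrable_inner (𝕜 := ℂ) b a
  simpa only [RCLike.inner_apply] using this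

/-- The limit covariance in the time domain. -/
theorem limitCov_eq {H : ℝ → ℝ} (hH : MemLp H 2 volume) (τ₁ τ₂ : ℝ) :
    limitCov H hH τ₁ τ₂ =
      ((∫ x, H (x + τ₁) * H (x + τ₂)) + ∫ x, H (x + τ₁) * H (-x + τ₂) : ℝ) := by
  have hpi : (2 * Real.pi) ≠ 0 := by positivity
  set g := (𝓕 (MemLp.toLp (fun x => (H x : ℂ)) hH.ofReal) : Lp ℂ 2 (volume : Measure ℝ)) with hg
  set F : ℝ → ℂ := fun ξ =>
    Complex.exp (Complex.I * ((τ₁ - τ₂) * (2 * Real.pi * ξ) : ℝ)) * ((‖g ξ‖ ^ 2 : ℝ) : ℂ)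
      + Complex.exp (Complex.I * ((τ₁ + τ₂) * (2 * Real.pi * ξ) : ℝ)) * g ξ ^ 2 with hF
  have h0 : limitCov H hH τ₁ τ₂ = ∫ ξ, F ξ := by
    have h1 := Measure.integral_comp_div F (2 * Real.pi)
    rw [limitCov]
    have h2 : ∀ lam : ℝ, Complex.exp (Complex.I * ((τ₁ - τ₂) * lam : ℝ)) *
        ((‖plancherel H hH lam‖ ^ 2 : ℝ) : ℂ)
        + Complex.exp (Complex.I * ((τ₁ + τ₂) * lam : ℝ)) * plancherel H hH lam ^ 2
        = F (lam / (2 * Real.pi)) := by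
      intro lam
      simp only [hF, plancherel, ← hg]
      rw [mul_div_cancel₀ lam hpi]
    simp_rw [h2, h1]
    rw [abs_of_pos (by positivity), Complex.real_smul]
    push_cast
    field_simp
  have hr2 := memLp_comp_neg (memLp_comp_add hH τ₂)
  set g1 := (𝓕 (MemLp.toLp (fun x => (H (x + τ₁) : ℂ)) (memLp_comp_add hH τ₁).ofReal) :
    Lp ℂ 2 (volume : Measure ℝ)) with hg1
  set g2 := (𝓕 (MemLp.toLp (fun x => (H (x + τ₂) : ℂ)) (memLp_comp_add hH τ₂).ofReal) :
    Lp ℂ 2 (volume : Measure ℝ)) with hg2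
  set g3 := (𝓕 (MemLp.toLp (fun x => (H (-x + τ₂) : ℂ)) hr2.ofReal) :
    Lp ℂ 2 (volume : Measure ℝ)) with hg3
  have h3 : F =ᵐ[volume] fun ξ => g1 ξ * conj (g2 ξ) + g1 ξ * conj (g3 ξ) := by
    filter_upwards [fourier_translate_ae_eq hH τ₁, fourier_translate_ae_eq hH τ₂,
      fourier_reflect_ae_eq (memLp_comp_add hH τ₂)] with ξ a1 a2 a3
    rw [hg3, ← a3, Complex.conj_conj, hg2, hg1, ← a1, ← a2, ← hg, hF]
    simp only
    congr 1
    · rw [map_mul, ← Complex.exp_conj, mul_mul_mul_comm, ← Complex.exp_add, Complex.mul_conj,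
        Complex.normSq_eq_norm_sq]
      congr 2
      simp only [map_mul, Complex.conj_I, Complex.conj_ofReal]
      push_cast
      ring
    · rw [mul_mul_mul_comm, ← Complex.exp_add, pow_two]
      congr 2
      push_cast
      ring
  rw [h0, integral_congr_ae h3, integral_add (integrable_fourier_mul_conj g1 g2)
    (integrable_fourier_mul_conj g1 g3)]
  rw [integral_conj_mul_fourier (memLp_comp_add hH τ₁) (memLp_comp_add hH τ₂),
    integral_conj_mul_fourier (memLp_comp_add hH τ₁) hr2]
  push_cast
  rfl

theorem sigma_sq_eq {H : ℝ → ℝ} (hH : MemLp H 2 volume) (τ₁ τ₂ : ℝ) :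
    sigma H hH τ₁ τ₂ ^ 2 = Real.pi / 2 * ∫ x, (H (x + τ₁) - H (x + τ₂)) ^ 2 := by
  have hpi : (2 * Real.pi) ≠ 0 := by positivity
  have hnn : 0 ≤ ∫ lam : ℝ, Real.sin (|τ₁ - τ₂| * lam / 2) ^ 2 * ‖plancherel H hH lam‖ ^ 2 :=
    integral_nonneg fun _ => by positivity
  rw [sigma, qFun, Real.sq_sqrt hnn]
  set g := (𝓕 (MemLp.toLp (fun x => (H x : ℂ)) hH.ofReal) : Lp ℂ 2 (volume : Measure ℝ)) with hg
  have h1 := Measure.integral_comp_div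
    (fun ξ : ℝ => Real.sin ((τ₁ - τ₂) * (2 * Real.pi * ξ) / 2) ^ 2 * ‖g ξ‖ ^ 2) (2 * Real.pi)
  have h2 : ∀ lam : ℝ, Real.sin (|τ₁ - τ₂| * lam / 2) ^ 2 * ‖plancherel H hH lam‖ ^ 2 =
      Real.sin ((τ₁ - τ₂) * (2 * Real.pi * (lam / (2 * Real.pi))) / 2) ^ 2 *
        ‖g (lam / (2 * Real.pi))‖ ^ 2 := by
    intro lam
    rw [mul_div_cancel₀ lam hpi, plancherel, ← hg]
    congr 1
    rcases abs_cases (τ₁ - τ₂) with h | h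
    · rw [h.1]
    · rw [h.1, neg_mul, neg_div, Real.sin_neg, neg_sq]
  simp_rw [h2]
  rw [h1, abs_of_pos (by positivity), smul_eq_mul]
  have hd : MemLp (fun x => H (x + τ₁) - H (x + τ₂)) 2 volume :=
    (memLp_comp_add hH τ₁).sub (memLp_comp_add hH τ₂)
  set g1 := MemLp.toLp (fun x => (H (x + τ₁) : ℂ)) (memLp_comp_add hH τ₁).ofReal with hg1
  set g2 := MemLp.toLp (fun x => (H (x + τ₂) : ℂ)) (memLp_comp_add hH τ₂).ofReal with hg2
  have hdiff : MemLp.toLp (fun x => ((H (x + τ₁) - H (x + τ₂) : ℝ) : ℂ)) hd.ofReal = g1 - g2 := by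
    rw [hg1, hg2, ← MemLp.toLp_sub]
    congr 1
    ext x
    simp
  have h3 := integral_conj_mul_fourier hd hd
  rw [hdiff] at h3
  have h4 : (fun ξ : ℝ => (𝓕 (g1 - g2) : Lp ℂ 2 (volume : Measure ℝ)) ξ *
      conj ((𝓕 (g1 - g2) : Lp ℂ 2 (volume : Measure ℝ)) ξ)) =ᵐ[volume]
      fun ξ => ((4 * (Real.sin ((τ₁ - τ₂) * (2 * Real.pi * ξ) / 2) ^ 2 * ‖g ξ‖ ^ 2) : ℝ) : ℂ) := by
    have hs : (𝓕 (g1 - g2) : Lp ℂ 2 (volume : Measure ℝ)) =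
        (𝓕 g1 : Lp ℂ 2 (volume : Measure ℝ)) - (𝓕 g2 : Lp ℂ 2 (volume : Measure ℝ)) :=
      (Lp.fourierTransformₗᵢ ℝ ℂ).map_sub g1 g2
    rw [hs]
    filter_upwards [fourier_translate_ae_eq hH τ₁, fourier_translate_ae_eq hH τ₂,
      Lp.coeFn_sub (𝓕 g1 : Lp ℂ 2 (volume : Measure ℝ)) (𝓕 g2 : Lp ℂ 2 (volume : Measure ℝ))]
      with ξ a1 a2 a3
    rw [a3, Pi.sub_apply, hg1, hg2, ← a1, ← a2, ← hg, ← sub_mul, Complex.mul_conj,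
      Complex.normSq_eq_norm_sq, norm_mul, mul_pow, ← mul_assoc]
    congr 2
    rw [← Complex.normSq_eq_norm_sq, mul_comm Complex.I, mul_comm Complex.I,
      Complex.exp_mul_I, Complex.exp_mul_I, ← Complex.ofReal_cos, ← Complex.ofReal_sin,
      ← Complex.ofReal_cos, ← Complex.ofReal_sin, Complex.normSq_apply]
    simp only [Complex.sub_re, Complex.add_re, Complex.ofReal_re, Complex.mul_re, Complex.I_re,
      Complex.ofReal_im, Complex.I_im, Complex.sub_im, Complex.add_im, Complex.mul_im]
    set A := 2 * Real.pi * τ₁ * ξ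
    set B := 2 * Real.pi * τ₂ * ξ
    have hAB : (τ₁ - τ₂) * (2 * Real.pi * ξ) / 2 = (A - B) / 2 := by simp only [A, B]; ring
    have hc : Real.sin ((A - B) / 2) ^ 2 = 1 / 2 - Real.cos (A - B) / 2 := by
      rw [Real.sin_sq_eq_half_sub]; congr 3; ring
    rw [hAB, hc, Real.cos_sub]
    have s1 := Real.sin_sq_add_cos_sq A
    have s2 := Real.sin_sq_add_cos_sq B
    nlinarith
  rw [integral_congr_ae h4, integral_complex_ofReal] at h3
  have h5 := Complex.ofReal_injective h3
  rw [integral_const_mul] at h5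
  have h6 : ∫ x, (H (x + τ₁) - H (x + τ₂)) ^ 2 =
      ∫ x, (H (x + τ₁) - H (x + τ₂)) * (H (x + τ₁) - H (x + τ₂)) := by
    simp_rw [pow_two]
  rw [h6, ← h5]
  ring

end Fourier

end Correlogram

namespace Correlogram

open scoped SchwartzMap ComplexConjugate

/-! ### The Fourier integral in angular frequency -/

section FourierIntegral

/-- The Fourier integral `∫ e^{-iλx} g(x) dx` of a real function. -/
noncomputable def ft (g : ℝ → ℝ) (lam : ℝ) : ℂ :=
  ∫ x : ℝ, Complex.exp (-(Complex.I * (lam * x : ℝ))) * (g x : ℂ)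

theorem ft_eq_fourier (g : ℝ → ℝ) (lam : ℝ) :
    ft g lam = 𝓕 (fun x => (g x : ℂ)) (lam / (2 * Real.pi)) := by
  rw [Real.fourier_real_eq_integral_exp_smul, ft]
  refine integral_congr_ae (Eventually.of_forall fun x => ?_)
  simp only [smul_eq_mul]
  congr 2
  have : (-2 * Real.pi * x * (lam / (2 * Real.pi))) = -(lam * x) := by
    field_simp
  rw [this]
  push_cast
  ring

theorem norm_exp_I_mul (r : ℝ) : ‖Complex.exp (Complex.I * (r : ℂ))‖ = 1 := by
  rw [mul_comm, Complex.norm_exp_ofReal_mul_I]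

theorem norm_exp_neg_I_mul (r : ℝ) : ‖Complex.exp (-(Complex.I * (r : ℂ)))‖ = 1 := by
  have := norm_exp_I_mul (-r)
  rwa [Complex.ofReal_neg, mul_neg] at this

theorem norm_ft_le (g : ℝ → ℝ) (lam : ℝ) : ‖ft g lam‖ ≤ ∫ x, ‖g x‖ := by
  refine (norm_integral_le_integral_norm _).trans (le_of_eq ?_)
  refine integral_congr_ae (Eventually.of_forall fun x => ?_)
  simp only [norm_mul, norm_exp_neg_I_mul, one_mul, Complex.norm_real]

theorem continuous_ft {g : ℝ → ℝ} (hg : Integrable g) : Continuous (ft g) := by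
  have hc : Continuous (𝓕 (fun x => (g x : ℂ))) :=
    VectorFourier.fourierIntegral_continuous Real.continuous_fourierChar
      (L := innerₗ ℝ) continuous_inner hg.ofReal
  have : ft g = fun lam => 𝓕 (fun x => (g x : ℂ)) (lam / (2 * Real.pi)) :=
    funext (ft_eq_fourier g)
  rw [this]
  exact hc.comp (by fun_prop)

theorem ft_neg (g : ℝ → ℝ) (lam : ℝ) : ft g (-lam) = conj (ft g lam) := by
  rw [ft, ft, ← integral_conj]
  refine integral_congr_ae (Eventually.of_forall fun x => ?_)
  simp only [map_mul, ← Complex.exp_conj, Complex.conj_ofReal, map_neg, Complex.conj_I]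
  congr 2
  push_cast
  ring

theorem integrable_comp_div_two_pi {F : Type*} [NormedAddCommGroup F] {u : ℝ → F}
    (hu : Integrable u) : Integrable (fun lam : ℝ => u (lam / (2 * Real.pi))) :=
  hu.comp_div (by positivity)

theorem fourier_ofReal_ae_eq {g : ℝ → ℝ} (hg : Integrable g) (hg2 : MemLp g 2 volume) :
    𝓕 (fun x => (g x : ℂ)) =ᵐ[volume]
      (𝓕 (MemLp.toLp (fun x => (g x : ℂ)) hg2.ofReal) : Lp ℂ 2 (volume : Measure ℝ)) :=
  fourier_toLp_ae_eq hg.ofReal hg2.ofReal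

theorem integrable_ft_mul_conj {g k : ℝ → ℝ} (hg : Integrable g) (hg2 : MemLp g 2 volume)
    (hk : Integrable k) (hk2 : MemLp k 2 volume) :
    Integrable (fun lam => ft g lam * conj (ft k lam)) := by
  have h := integrable_fourier_mul_conj
    (𝓕 (MemLp.toLp (fun x => (g x : ℂ)) hg2.ofReal) : Lp ℂ 2 (volume : Measure ℝ))
    (𝓕 (MemLp.toLp (fun x => (k x : ℂ)) hk2.ofReal) : Lp ℂ 2 (volume : Measure ℝ))
  have h' : Integrable (fun ξ => 𝓕 (fun x => (g x : ℂ)) ξ * conj (𝓕 (fun x => (k x : ℂ)) ξ)) := by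
    refine h.congr ?_
    filter_upwards [fourier_ofReal_ae_eq hg hg2,
      fourier_ofReal_ae_eq hk hk2] with ξ a b
    rw [← a, ← b]
  simp_rw [ft_eq_fourier]
  exact integrable_comp_div_two_pi h'

/-- Plancherel's theorem for functions in `L¹ ∩ L²`. -/
theorem integral_ft_mul_conj {g k : ℝ → ℝ} (hg : Integrable g) (hg2 : MemLp g 2 volume)
    (hk : Integrable k) (hk2 : MemLp k 2 volume) :
    ∫ lam, ft g lam * conj (ft k lam) = ((2 * Real.pi * ∫ x, g x * k x : ℝ) : ℂ) := by
  simp_rw [ft_eq_fourier]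
  rw [Measure.integral_comp_div
    (fun ξ => 𝓕 (fun x => (g x : ℂ)) ξ * conj (𝓕 (fun x => (k x : ℂ)) ξ)) (2 * Real.pi)]
  have : ∫ ξ, 𝓕 (fun x => (g x : ℂ)) ξ * conj (𝓕 (fun x => (k x : ℂ)) ξ) =
      ((∫ x, g x * k x : ℝ) : ℂ) := by
    rw [← integral_conj_mul_fourier hg2 hk2]
    refine integral_congr_ae ?_
    filter_upwards [fourier_ofReal_ae_eq hg hg2,
      fourier_ofReal_ae_eq hk hk2] with ξ a b
    rw [← a, ← b]
  rw [this, abs_of_pos (by positivity), Complex.real_smul]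
  push_cast
  rfl

theorem integrable_norm_ft_sq {g : ℝ → ℝ} (hg : Integrable g) (hg2 : MemLp g 2 volume) :
    Integrable (fun lam => ‖ft g lam‖ ^ 2) := by
  have := (integrable_ft_mul_conj hg hg2 hg hg2).norm
  refine this.congr (Eventually.of_forall fun x => ?_)
  simp [pow_two]

theorem integral_norm_ft_sq {g : ℝ → ℝ} (hg : Integrable g) (hg2 : MemLp g 2 volume) :
    ∫ lam, ‖ft g lam‖ ^ 2 = 2 * Real.pi * ∫ x, g x ^ 2 := by
  have h := integral_ft_mul_conj hg hg2 hg hg2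
  simp_rw [Complex.mul_conj, Complex.normSq_eq_norm_sq] at h
  rw [integral_complex_ofReal] at h
  have h2 := Complex.ofReal_injective h
  rw [h2]
  simp_rw [pow_two]

theorem ft_comp_neg (g : ℝ → ℝ) (lam : ℝ) : ft (fun x => g (-x)) lam = conj (ft g lam) := by
  rw [← ft_neg, ft, ft, ← integral_neg_eq_self]
  simp

theorem integral_ft_sq {g : ℝ → ℝ} (hg : Integrable g) (hg2 : MemLp g 2 volume) :
    ∫ lam, ft g lam * ft g lam = ((2 * Real.pi * ∫ x, g x * g (-x) : ℝ) : ℂ) := by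
  rw [← integral_ft_mul_conj hg hg2 hg.comp_neg (memLp_comp_neg hg2)]
  simp_rw [ft_comp_neg, Complex.conj_conj]

/-- Integrable square-integrable functions with integrable Fourier integral are dense in `L²`. -/
theorem exists_integrable_ft_approx {H : ℝ → ℝ} (hH : MemLp H 2 volume) {ε : ℝ} (hε : 0 < ε) :
    ∃ g : ℝ → ℝ, Integrable g ∧ MemLp g 2 volume ∧ Integrable (ft g) ∧
      eLpNorm (fun x => H x - g x) 2 volume ≤ ENNReal.ofReal ε := by
  obtain ⟨g, hgc, hgs, hg⟩ := MemLp.exist_eLpNorm_sub_le (p := 2) (by norm_num) (by norm_num) hH hε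
  have hgi : Integrable g := hgs.continuous.integrable_of_hasCompactSupport hgc
  have hg2 : MemLp g 2 volume := hgs.continuous.memLp_of_hasCompactSupport hgc
  refine ⟨g, hgi, hg2, ?_, hg⟩
  have hg' : ContDiff ℝ ((⊤ : ℕ∞) : WithTop ℕ∞) (fun x => (g x : ℂ)) :=
    Complex.ofRealCLM.contDiff.comp hgs
  have hgc' : HasCompactSupport (fun x => (g x : ℂ)) :=
    hgc.comp_left (g := fun y : ℝ => (y : ℂ)) (by simp)
  have h := (𝓕 (hgc'.toSchwartzMap hg')).integrable (μ := volume)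
  rw [SchwartzMap.fourier_coe] at h
  have h2 := integrable_comp_div_two_pi h
  refine h2.congr (Eventually.of_forall fun x => ?_)
  rw [ft_eq_fourier]
  rfl

end FourierIntegral

end Correlogram

namespace Correlogram

open scoped ComplexConjugate

/-! ### Trigonometric integrals -/

section TrigIntegral

/-- The trigonometric integral `∫ e^{iλu} a(λ) dλ`. -/
noncomputable def ift (a : ℝ → ℂ) (u : ℝ) : ℂ :=
  ∫ lam : ℝ, Complex.exp (Complex.I * (lam * u : ℝ)) * a lam

theorem spectralCov_eq_ift (f : ℝ → ℝ) (u : ℝ) : spectralCov f u = ift (fun l => (f l : ℂ)) u := rfl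

theorem integrable_exp_mul {a : ℝ → ℂ} (ha : Integrable a) (u : ℝ) :
    Integrable (fun lam : ℝ => Complex.exp (Complex.I * (lam * u : ℝ)) * a lam) := by
  refine ha.mono ?_ (Eventually.of_forall fun l => ?_)
  · exact (Continuous.aestronglyMeasurable (by fun_prop)).mul ha.aestronglyMeasurable
  · rw [norm_mul, norm_exp_I_mul, one_mul]

theorem continuous_ift {a : ℝ → ℂ} (ha : Integrable a) : Continuous (ift a) := by
  refine continuous_of_dominated (bound := fun l => ‖a l‖) (fun u => ?_) (fun u => ?_) ha.norm ?_
  · exact (integrable_exp_mul ha u).aestronglyMeasurable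
  · exact Eventually.of_forall fun l => by rw [norm_mul, norm_exp_I_mul, one_mul]
  · exact Eventually.of_forall fun l => by fun_prop

theorem norm_ift_le (a : ℝ → ℂ) (u : ℝ) : ‖ift a u‖ ≤ ∫ l, ‖a l‖ := by
  refine (norm_integral_le_integral_norm _).trans (le_of_eq ?_)
  refine integral_congr_ae (Eventually.of_forall fun x => ?_)
  simp only [norm_mul, norm_exp_I_mul, one_mul]

theorem integral_mul_ift {k : ℝ → ℝ} (hk : Integrable k) {a : ℝ → ℂ} (ha : Integrable a) :
    ∫ t, (k t : ℂ) * ift a t = ∫ l, a l * ft k (-l) := by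
  have hint : Integrable (fun p : ℝ × ℝ =>
      (k p.1 : ℂ) * (Complex.exp (Complex.I * (p.2 * p.1 : ℝ)) * a p.2))
      ((volume : Measure ℝ).prod volume) := by
    have h := (hk.ofReal (𝕜 := ℂ)).mul_prod ha
    refine h.mono ?_ (Eventually.of_forall fun p => ?_)
    · have h1 : AEStronglyMeasurable (fun p : ℝ × ℝ => Complex.exp (Complex.I * (p.2 * p.1 : ℝ)))
        ((volume : Measure ℝ).prod volume) := Continuous.aestronglyMeasurable (by fun_prop)
      refine (h1.mul h.aestronglyMeasurable).congr (Eventually.of_forall fun p => ?_)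
      simp only [Pi.mul_apply]
      change _ * ((k p.1 : ℂ) * _) = _
      ring
    · rw [norm_mul, norm_mul, norm_exp_I_mul, one_mul, norm_mul]
      rfl
  calc ∫ t, (k t : ℂ) * ift a t
      = ∫ t, ∫ l, (k t : ℂ) * (Complex.exp (Complex.I * (l * t : ℝ)) * a l) := by
        refine integral_congr_ae (Eventually.of_forall fun t => ?_)
        simp only [ift]
        rw [integral_const_mul]
    _ = ∫ l, ∫ t, (k t : ℂ) * (Complex.exp (Complex.I * (l * t : ℝ)) * a l) :=
        integral_integral_swap hint
    _ = ∫ l, a l * ft k (-l) := by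
        refine integral_congr_ae (Eventually.of_forall fun l => ?_)
        simp only [ft]
        rw [← integral_const_mul]
        refine integral_congr_ae (Eventually.of_forall fun t => ?_)
        simp only
        have : -(Complex.I * ((-l * t : ℝ) : ℂ)) = Complex.I * ((l * t : ℝ) : ℂ) := by
          push_cast; ring
        rw [this]
        ring

/-- The kernel `|∫_0^1 e^{iνt} dt|²`. -/
noncomputable def fejer (ν : ℝ) : ℝ := ‖ft (Set.indicator (Set.Ioc 0 1) fun _ => (1 : ℝ)) ν‖ ^ 2

theorem integrable_indicator_one : Integrable (Set.indicator (Set.Ioc (0 : ℝ) 1) fun _ => (1 : ℝ)) :=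
  (integrable_indicator_iff measurableSet_Ioc).2 (by simp [IntegrableOn])

theorem memLp_indicator_one :
    MemLp (Set.indicator (Set.Ioc (0 : ℝ) 1) fun _ => (1 : ℝ)) 2 volume :=
  memLp_indicator_const 2 measurableSet_Ioc 1 (Or.inr (by simp))

theorem integrable_fejer : Integrable fejer :=
  integrable_norm_ft_sq integrable_indicator_one memLp_indicator_one

theorem integral_fejer : ∫ ν, fejer ν = 2 * Real.pi := by
  have h := integral_norm_ft_sq integrable_indicator_one memLp_indicator_one
  have h2 : ∫ x, (Set.indicator (Set.Ioc (0 : ℝ) 1) (fun _ => (1 : ℝ)) x) ^ 2 = 1 := by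
    have : ∀ x : ℝ, (Set.indicator (Set.Ioc (0 : ℝ) 1) (fun _ => (1 : ℝ)) x) ^ 2 =
        Set.indicator (Set.Ioc (0 : ℝ) 1) (fun _ => (1 : ℝ)) x := by
      intro x
      by_cases hx : x ∈ Set.Ioc (0 : ℝ) 1 <;> simp [hx]
    simp_rw [this]
    rw [integral_indicator measurableSet_Ioc]
    simp
  rw [h2, mul_one] at h
  exact h

theorem fejer_nonneg (ν : ℝ) : 0 ≤ fejer ν := by unfold fejer; positivity

theorem norm_integral_exp_sq {T : ℝ} (hT : 0 < T) (α : ℝ) :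
    ‖∫ t in Set.Ioc 0 T, Complex.exp (Complex.I * (α * t : ℝ))‖ ^ 2 = T ^ 2 * fejer (α * T) := by
  have h1 : ∫ t in Set.Ioc 0 T, Complex.exp (Complex.I * (α * t : ℝ)) =
      T * ft (Set.indicator (Set.Ioc 0 1) fun _ => (1 : ℝ)) (-(α * T)) := by
    rw [← intervalIntegral.integral_of_le hT.le]
    have := intervalIntegral.smul_integral_comp_mul_left (a := 0) (b := 1)
      (fun t : ℝ => Complex.exp (Complex.I * (α * t : ℝ))) T
    rw [mul_zero, mul_one] at this
    rw [← this, intervalIntegral.integral_of_le zero_le_one, Complex.real_smul, ft,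
      ← integral_indicator measurableSet_Ioc]
    congr 1
    refine integral_congr_ae (Eventually.of_forall fun t => ?_)
    by_cases ht : t ∈ Set.Ioc (0 : ℝ) 1
    · simp only [Set.indicator_of_mem ht]
      rw [Complex.ofReal_one, mul_one]
      congr 1
      push_cast
      ring
    · simp [Set.indicator_of_notMem ht]
  rw [h1, ft_neg, norm_mul, RCLike.norm_conj, mul_pow, fejer]
  simp

theorem integral_ift_mul_ift {a b : ℝ → ℂ} (ha : Integrable a) (hb : Integrable b) {T : ℝ}
    (hT : 0 < T) :
    ∫ t in Set.Ioc 0 T, ∫ s in Set.Ioc 0 T, ift a (t - s) * ift b (s - t) =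
      T * ∫ l : ℝ, ∫ ν : ℝ, a l * b (l + ν / T) * (fejer ν : ℂ) := by
  set μ := (volume : Measure ℝ).restrict (Set.Ioc 0 T) with hμ
  have hab := ha.mul_prod hb
  have hcont : Continuous (fun p : ℝ × ℝ => ift a (p.1 - p.2) * ift b (p.2 - p.1)) :=
    ((continuous_ift ha).comp (by fun_prop)).mul ((continuous_ift hb).comp (by fun_prop))
  have hint1 : Integrable (fun p : ℝ × ℝ => ift a (p.1 - p.2) * ift b (p.2 - p.1)) (μ.prod μ) := by
    refine Integrable.of_bound hcont.aestronglyMeasurable ((∫ l, ‖a l‖) * ∫ l, ‖b l‖)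
      (Eventually.of_forall fun p => ?_)
    rw [norm_mul]
    exact mul_le_mul (norm_ift_le a _) (norm_ift_le b _) (norm_nonneg _)
      (integral_nonneg fun _ => norm_nonneg _)
  rw [← integral_prod (f := fun p : ℝ × ℝ => ift a (p.1 - p.2) * ift b (p.2 - p.1)) hint1]
  have hker : ∀ p : ℝ × ℝ, ift a (p.1 - p.2) * ift b (p.2 - p.1) =
      ∫ q : ℝ × ℝ, (Complex.exp (Complex.I * ((q.1 - q.2) * (p.1 - p.2) : ℝ))) *
        (a q.1 * b q.2) := by
    intro p
    rw [ift, ift, ← integral_prod_mul]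
    refine integral_congr_ae (Eventually.of_forall fun q => ?_)
    simp only
    rw [mul_mul_mul_comm, ← Complex.exp_add]
    congr 2
    push_cast
    ring
  simp_rw [hker]
  have hint2 : Integrable (fun r : (ℝ × ℝ) × (ℝ × ℝ) =>
      (Complex.exp (Complex.I * ((r.2.1 - r.2.2) * (r.1.1 - r.1.2) : ℝ))) *
        (a r.2.1 * b r.2.2)) ((μ.prod μ).prod ((volume : Measure ℝ).prod volume)) := by
    have h1 : Integrable (fun r : (ℝ × ℝ) × (ℝ × ℝ) => (1 : ℂ) * (a r.2.1 * b r.2.2))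
        ((μ.prod μ).prod ((volume : Measure ℝ).prod volume)) :=
      (integrable_const (1 : ℂ)).mul_prod hab
    refine h1.mono ?_ (Eventually.of_forall fun p => ?_)
    · refine AEStronglyMeasurable.mul (Continuous.aestronglyMeasurable (by fun_prop)) ?_
      simpa using h1.aestronglyMeasurable
    · rw [norm_mul, norm_exp_I_mul, one_mul, one_mul]
  rw [Measure.volume_eq_prod, integral_integral_swap hint2]
  have hin : ∀ q : ℝ × ℝ, ∫ p : ℝ × ℝ,
      (Complex.exp (Complex.I * ((q.1 - q.2) * (p.1 - p.2) : ℝ))) * (a q.1 * b q.2) ∂(μ.prod μ) =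
      a q.1 * b q.2 * ((T ^ 2 * fejer ((q.2 - q.1) * T) : ℝ) : ℂ) := by
    intro q
    rw [integral_mul_const, mul_comm]
    congr 1
    have h2 : ∀ p : ℝ × ℝ, Complex.exp (Complex.I * ((q.1 - q.2) * (p.1 - p.2) : ℝ)) =
        conj (Complex.exp (Complex.I * ((q.2 - q.1) * p.1 : ℝ))) *
          Complex.exp (Complex.I * ((q.2 - q.1) * p.2 : ℝ)) := by
      intro p
      rw [← Complex.exp_conj, ← Complex.exp_add]
      congr 1
      simp only [map_mul, Complex.conj_I, Complex.conj_ofReal]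
      push_cast
      ring
    simp_rw [h2]
    rw [integral_prod_mul (fun t : ℝ => conj (Complex.exp (Complex.I * ((q.2 - q.1) * t : ℝ))))
      (fun s : ℝ => Complex.exp (Complex.I * ((q.2 - q.1) * s : ℝ))), integral_conj,
      mul_comm, Complex.mul_conj, Complex.normSq_eq_norm_sq, norm_integral_exp_sq hT]
  simp_rw [hin]
  have hmeas : Continuous fejer := by
    unfold fejer
    exact ((continuous_ft integrable_indicator_one).norm).pow 2
  have hbd : ∃ C : ℝ, ∀ ν, fejer ν ≤ C := by
    refine ⟨(∫ x, ‖Set.indicator (Set.Ioc (0 : ℝ) 1) (fun _ => (1 : ℝ)) x‖) ^ 2, fun ν => ?_⟩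
    exact pow_le_pow_left₀ (norm_nonneg _) (norm_ft_le _ _) 2
  obtain ⟨C, hC⟩ := hbd
  have hint3 : Integrable (fun q : ℝ × ℝ =>
      a q.1 * b q.2 * ((T ^ 2 * fejer ((q.2 - q.1) * T) : ℝ) : ℂ))
      ((volume : Measure ℝ).prod volume) := by
    refine hab.mul_bdd (c := T ^ 2 * C) ?_ (Eventually.of_forall fun q => ?_)
    · refine Continuous.aestronglyMeasurable ?_
      refine Complex.continuous_ofReal.comp (continuous_const.mul (hmeas.comp ?_))
      fun_prop
    · rw [Complex.norm_real, Real.norm_of_nonneg (mul_nonneg (sq_nonneg _) (fejer_nonneg _))]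
      exact mul_le_mul_of_nonneg_left (hC _) (sq_nonneg _)
  rw [integral_prod _ hint3]
  have hsub : ∀ l : ℝ, ∫ m : ℝ, a l * b m * ((T ^ 2 * fejer ((m - l) * T) : ℝ) : ℂ) =
      T * ∫ ν : ℝ, a l * b (l + ν / T) * (fejer ν : ℂ) := by
    intro l
    have e1 := integral_add_left_eq_self (μ := volume)
      (fun m : ℝ => a l * b m * ((T ^ 2 * fejer ((m - l) * T) : ℝ) : ℂ)) l
    rw [← e1]
    have e2 := Measure.integral_comp_div
      (fun m : ℝ => a l * b (l + m) * ((T ^ 2 * fejer ((l + m - l) * T) : ℝ) : ℂ)) T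
    rw [abs_of_pos hT, Complex.real_smul] at e2
    have hT' : (T : ℂ) ≠ 0 := by exact_mod_cast hT.ne'
    refine mul_left_cancel₀ hT' ?_
    rw [← e2, ← mul_assoc, ← integral_const_mul]
    refine integral_congr_ae (Eventually.of_forall fun ν => ?_)
    simp only
    have : (l + ν / T - l) * T = ν := by field_simp; ring
    rw [this]
    push_cast
    ring
  simp_rw [hsub]
  rw [integral_const_mul]

theorem integrable_fejer_kernel {p q : ℝ → ℂ} {f : ℝ → ℝ} {M B T : ℝ} (hp : Integrable p)
    (hqB : ∀ l, ‖q l‖ ≤ B) (hf : Measurable f)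
    (hf0 : ∀ l, 0 ≤ f l) (hfM : ∀ l, f l ≤ M) (hqc : Continuous q) :
    Integrable (fun z : ℝ × ℝ =>
      (f z.1 : ℂ) * p z.1 * ((f (z.1 + z.2 / T) : ℂ) * q (z.1 + z.2 / T)) * (fejer z.2 : ℂ))
      ((volume : Measure ℝ).prod volume) ∧
    ∀ z : ℝ × ℝ, ‖(f z.1 : ℂ) * p z.1 * ((f (z.1 + z.2 / T) : ℂ) * q (z.1 + z.2 / T)) *
      (fejer z.2 : ℂ)‖ ≤ M ^ 2 * B * (‖p z.1‖ * fejer z.2) := by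
  have hM : 0 ≤ M := (hf0 0).trans (hfM 0)
  have hB : 0 ≤ B := (norm_nonneg _).trans (hqB 0)
  have hbound : ∀ z : ℝ × ℝ, ‖(f z.1 : ℂ) * p z.1 * ((f (z.1 + z.2 / T) : ℂ) *
      q (z.1 + z.2 / T)) * (fejer z.2 : ℂ)‖ ≤ M ^ 2 * B * (‖p z.1‖ * fejer z.2) := by
    intro z
    simp only [norm_mul, Complex.norm_real, Real.norm_of_nonneg (hf0 _),
      Real.norm_of_nonneg (fejer_nonneg _)]
    calc f z.1 * ‖p z.1‖ * (f (z.1 + z.2 / T) * ‖q (z.1 + z.2 / T)‖) * fejer z.2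
        ≤ M * ‖p z.1‖ * (M * B) * fejer z.2 := by
          gcongr
          · exact fejer_nonneg _
          · exact mul_nonneg (hf0 _) (norm_nonneg _)
          · exact hfM _
          · exact hfM _
          · exact hqB _
      _ = _ := by ring
  refine ⟨?_, hbound⟩
  have hdom : Integrable (fun z : ℝ × ℝ => M ^ 2 * B * (‖p z.1‖ * fejer z.2))
      ((volume : Measure ℝ).prod volume) := (hp.norm.mul_prod integrable_fejer).const_mul _
  refine hdom.mono' ?_ (Eventually.of_forall hbound)
  have hpp : AEStronglyMeasurable (fun z : ℝ × ℝ => p z.1 * (fejer z.2 : ℂ))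
      ((volume : Measure ℝ).prod volume) :=
    (hp.mul_prod (integrable_fejer.ofReal (𝕜 := ℂ))).aestronglyMeasurable
  have hm1 : AEStronglyMeasurable (fun z : ℝ × ℝ => (f z.1 : ℂ))
      ((volume : Measure ℝ).prod volume) :=
    (Complex.measurable_ofReal.comp (hf.comp measurable_fst)).aestronglyMeasurable
  have hm2 : AEStronglyMeasurable (fun z : ℝ × ℝ => (f (z.1 + z.2 / T) : ℂ))
      ((volume : Measure ℝ).prod volume) :=
    (Complex.measurable_ofReal.comp (hf.comp (by fun_prop))).aestronglyMeasurable
  have hm3 : AEStronglyMeasurable (fun z : ℝ × ℝ => q (z.1 + z.2 / T))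
      ((volume : Measure ℝ).prod volume) := (hqc.comp (by fun_prop)).aestronglyMeasurable
  refine (((hm1.mul hm2).mul hm3).mul hpp).congr (Eventually.of_forall fun z => ?_)
  simp only [Pi.mul_apply]
  ring

/-- The limit of the smoothed spectral integrals as the time horizon grows and the spectral
density flattens. -/
theorem tendsto_integral_fejer_kernel {f : ℝ → ℝ → ℝ} {c M B : ℝ} {p q : ℝ → ℂ}
    (hp : Integrable p) (hqc : Continuous q) (hqB : ∀ l, ‖q l‖ ≤ B)
    (hf : ∀ Δ > 0, Measurable (f Δ)) (hf0 : ∀ Δ > 0, ∀ l, 0 ≤ f Δ l)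
    (hfM : ∀ Δ > 0, ∀ l, f Δ l ≤ M)
    (hlim : ∀ r > 0, TendstoUniformlyOn f (fun _ => c / (2 * Real.pi)) atTop (Set.Icc (-r) r)) :
    Tendsto (fun z : ℝ × ℝ => ∫ l : ℝ, ∫ ν : ℝ, (f z.2 l : ℂ) * p l *
        ((f z.2 (l + ν / z.1) : ℂ) * q (l + ν / z.1)) * (fejer ν : ℂ)) (atTop ×ˢ atTop)
      (𝓝 ((c / (2 * Real.pi) : ℝ) ^ 2 * (2 * Real.pi : ℝ) * ∫ l, p l * q l)) := by
  have hval : ((c / (2 * Real.pi) : ℝ) ^ 2 * (2 * Real.pi : ℝ) * ∫ l, p l * q l : ℂ) =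
      ∫ w : ℝ × ℝ, ((c / (2 * Real.pi) : ℝ) : ℂ) * p w.1 * (((c / (2 * Real.pi) : ℝ) : ℂ) *
        q w.1) * (fejer w.2 : ℂ) ∂((volume : Measure ℝ).prod volume) := by
    have h1 : ∀ w : ℝ × ℝ, ((c / (2 * Real.pi) : ℝ) : ℂ) * p w.1 * (((c / (2 * Real.pi) : ℝ) : ℂ) *
        q w.1) * (fejer w.2 : ℂ) =
        (((c / (2 * Real.pi) : ℝ) : ℂ) ^ 2 * (p w.1 * q w.1)) * (fejer w.2 : ℂ) := by
      intro w; ring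
    simp_rw [h1]
    rw [integral_prod_mul (fun l => ((c / (2 * Real.pi) : ℝ) : ℂ) ^ 2 * (p l * q l))
      (fun ν => (fejer ν : ℂ)), integral_const_mul, integral_complex_ofReal, integral_fejer]
    ring
  rw [hval]
  have hev : ∀ᶠ z : ℝ × ℝ in atTop ×ˢ atTop, 0 < z.2 :=
    (eventually_gt_atTop (0 : ℝ)).prod_inr _
  have hmain : Tendsto (fun z : ℝ × ℝ => ∫ w : ℝ × ℝ, (f z.2 w.1 : ℂ) * p w.1 *
        ((f z.2 (w.1 + w.2 / z.1) : ℂ) * q (w.1 + w.2 / z.1)) * (fejer w.2 : ℂ)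
        ∂((volume : Measure ℝ).prod volume)) (atTop ×ˢ atTop)
      (𝓝 (∫ w : ℝ × ℝ, ((c / (2 * Real.pi) : ℝ) : ℂ) * p w.1 * (((c / (2 * Real.pi) : ℝ) : ℂ) *
        q w.1) * (fejer w.2 : ℂ) ∂((volume : Measure ℝ).prod volume))) := by
    refine tendsto_integral_filter_of_dominated_convergence
      (fun w : ℝ × ℝ => M ^ 2 * B * (‖p w.1‖ * fejer w.2)) ?_ ?_
      ((hp.norm.mul_prod integrable_fejer).const_mul _) ?_
    · filter_upwards [hev] with z hz
      exact (integrable_fejer_kernel hp hqB (hf _ hz) (hf0 _ hz) (hfM _ hz) hqc).1.1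
    · filter_upwards [hev] with z hz
      exact Eventually.of_forall
        (integrable_fejer_kernel hp hqB (hf _ hz) (hf0 _ hz) (hfM _ hz) hqc).2
    · refine Eventually.of_forall fun w => ?_
      have hr : 0 < |w.1| + |w.2| + 1 := by positivity
      have hu := hlim _ hr
      have hdiv : Tendsto (fun z : ℝ × ℝ => w.1 + w.2 / z.1) (atTop ×ˢ atTop) (𝓝 w.1) := by
        have : Tendsto (fun z : ℝ × ℝ => w.2 / z.1) (atTop ×ˢ atTop) (𝓝 0) :=
          tendsto_const_nhds.div_atTop tendsto_fst
        simpa using tendsto_const_nhds.add this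
      have t1 : Tendsto (fun z : ℝ × ℝ => f z.2 w.1) (atTop ×ˢ atTop) (𝓝 (c / (2 * Real.pi))) := by
        refine (hu.tendsto_at ?_).comp tendsto_snd
        constructor <;> cases abs_cases w.1 <;> cases abs_cases w.2 <;> linarith
      have t2 : Tendsto (fun z : ℝ × ℝ => f z.2 (w.1 + w.2 / z.1)) (atTop ×ˢ atTop)
          (𝓝 (c / (2 * Real.pi))) := by
        rw [Metric.tendsto_nhds]
        intro ε hε
        have h1 := (Metric.tendstoUniformlyOn_iff.1 hu ε hε).prod_inr (atTop : Filter ℝ)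
        have h2 : ∀ᶠ z : ℝ × ℝ in atTop ×ˢ atTop, 1 ≤ z.1 :=
          (eventually_ge_atTop (1 : ℝ)).prod_inl _
        filter_upwards [h1, h2] with z hz1 hz2
        rw [dist_comm]
        refine hz1 _ ?_
        have h3 : |w.2 / z.1| ≤ |w.2| := by
          rw [abs_div, abs_of_pos (by linarith : (0 : ℝ) < z.1)]
          exact div_le_self (abs_nonneg _) hz2
        have h4 := abs_le.1 (abs_add_le w.1 (w.2 / z.1) |>.trans (add_le_add le_rfl h3))
        constructor <;> linarith [h4.1, h4.2]
      have t3 : Tendsto (fun z : ℝ × ℝ => q (w.1 + w.2 / z.1)) (atTop ×ˢ atTop) (𝓝 (q w.1)) :=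
        (hqc.tendsto _).comp hdiv
      have t1' := (Complex.continuous_ofReal.tendsto _).comp t1
      have t2' := (Complex.continuous_ofReal.tendsto _).comp t2
      exact ((t1'.mul tendsto_const_nhds).mul (t2'.mul t3)).mul tendsto_const_nhds
  refine hmain.congr' ?_
  filter_upwards [hev] with z hz
  exact integral_prod _ (integrable_fejer_kernel hp hqB (hf _ hz) (hf0 _ hz) (hfM _ hz) hqc).1

/-- A bound for the smoothed spectral integrals by the `L²` norms of the factors. -/
theorem norm_integral_fejer_kernel_le {f : ℝ → ℝ} {M B T : ℝ} {p q : ℝ → ℂ} {A : ℝ}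
    (hp : Integrable p) (hqc : Continuous q) (hqB : ∀ l, ‖q l‖ ≤ B) (hf : Measurable f)
    (hf0 : ∀ l, 0 ≤ f l) (hfM : ∀ l, f l ≤ M)
    (hA : ∀ δ : ℝ, ∫ l, ‖p l‖ * ‖q (l + δ)‖ ≤ A) :
    ‖∫ l : ℝ, ∫ ν : ℝ, (f l : ℂ) * p l *
        ((f (l + ν / T) : ℂ) * q (l + ν / T)) * (fejer ν : ℂ)‖ ≤ M ^ 2 * (2 * Real.pi) * A := by
  have hM : 0 ≤ M := (hf0 0).trans (hfM 0)
  have hK := integrable_fejer_kernel (T := T) hp hqB hf hf0 hfM hqc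
  rw [integral_integral_swap hK.1]
  have hqp : ∀ ν : ℝ, Integrable (fun l => ‖p l‖ * ‖q (l + ν / T)‖) := by
    intro ν
    refine hp.norm.mul_bdd (c := B) ?_ (Eventually.of_forall fun l => ?_)
    · exact (Continuous.aestronglyMeasurable (by fun_prop))
    · rw [norm_norm]; exact hqB _
  calc ‖∫ ν : ℝ, ∫ l : ℝ, (f l : ℂ) * p l *
        ((f (l + ν / T) : ℂ) * q (l + ν / T)) * (fejer ν : ℂ)‖
      ≤ ∫ ν : ℝ, M ^ 2 * A * fejer ν := by
        refine norm_integral_le_of_norm_le (integrable_fejer.const_mul _)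
          (Eventually.of_forall fun ν => ?_)
        calc ‖∫ l : ℝ, (f l : ℂ) * p l * ((f (l + ν / T) : ℂ) * q (l + ν / T)) * (fejer ν : ℂ)‖
            ≤ ∫ l : ℝ, M ^ 2 * fejer ν * (‖p l‖ * ‖q (l + ν / T)‖) := by
              refine norm_integral_le_of_norm_le ((hqp ν).const_mul _)
                (Eventually.of_forall fun l => ?_)
              simp only [norm_mul, Complex.norm_real, Real.norm_of_nonneg (hf0 _),
                Real.norm_of_nonneg (fejer_nonneg _)]
              calc f l * ‖p l‖ * (f (l + ν / T) * ‖q (l + ν / T)‖) * fejer ν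
                  ≤ M * ‖p l‖ * (M * ‖q (l + ν / T)‖) * fejer ν := by
                    gcongr
                    · exact fejer_nonneg _
                    · exact mul_nonneg (hf0 _) (norm_nonneg _)
                    · exact hfM _
                    · exact hfM _
                _ = _ := by ring
          _ = M ^ 2 * fejer ν * ∫ l : ℝ, ‖p l‖ * ‖q (l + ν / T)‖ := integral_const_mul _ _
          _ ≤ M ^ 2 * fejer ν * A :=
              mul_le_mul_of_nonneg_left (hA _) (mul_nonneg (sq_nonneg _) (fejer_nonneg _))
          _ = _ := by ring
    _ = M ^ 2 * (2 * Real.pi) * A := by rw [integral_const_mul, integral_fejer]; ring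

end TrigIntegral

end Correlogram

namespace Correlogram

open scoped ComplexConjugate

/-! ### Stationary curves in a Hilbert space -/

section SpectralCurve

variable {E : Type*} [NormedAddCommGroup E] [InnerProductSpace ℝ E]

/-- A curve in a Hilbert space whose Gram function is stationary with spectral density `f ≤ M`. -/
structure IsSpectralCurve (x : ℝ → E) (f : ℝ → ℝ) (M : ℝ) : Prop where
  inner_eq : ∀ s t, ((inner ℝ (x s) (x t) : ℝ) : ℂ) = spectralCov f (s - t)
  nonneg : ∀ l, 0 ≤ f l
  le : ∀ l, f l ≤ M
  even : ∀ l, f l = f (-l)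
  integrable : Integrable f
  meas : Measurable f

namespace IsSpectralCurve

variable {x : ℝ → E} {f : ℝ → ℝ} {M : ℝ}

theorem M_nonneg (hx : IsSpectralCurve x f M) : 0 ≤ M := (hx.nonneg 0).trans (hx.le 0)

theorem integrable_coe (hx : IsSpectralCurve x f M) : Integrable (fun l => (f l : ℂ)) :=
  hx.integrable.ofReal

theorem norm_sq (hx : IsSpectralCurve x f M) (t : ℝ) : ‖x t‖ ^ 2 = (spectralCov f 0).re := by
  have := congrArg Complex.re (hx.inner_eq t t)
  rw [sub_self, Complex.ofReal_re, real_inner_self_eq_norm_sq] at this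
  exact this

theorem norm_eq (hx : IsSpectralCurve x f M) (t : ℝ) : ‖x t‖ = ‖x 0‖ := by
  have : ‖x t‖ ^ 2 = ‖x 0‖ ^ 2 := by rw [hx.norm_sq, hx.norm_sq]
  exact (pow_left_inj₀ (norm_nonneg _) (norm_nonneg _) two_ne_zero).1 this

theorem continuous_spectralCov (hx : IsSpectralCurve x f M) : Continuous (spectralCov f) :=
  continuous_ift hx.integrable.ofReal

theorem continuous (hx : IsSpectralCurve x f M) : Continuous x := by
  rw [continuous_iff_continuousAt]
  intro t
  rw [ContinuousAt, tendsto_iff_norm_sub_tendsto_zero]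
  have h1 : ∀ s, ‖x s - x t‖ ^ 2 = 2 * (spectralCov f 0).re - 2 * (spectralCov f (s - t)).re := by
    intro s
    have := congrArg Complex.re (hx.inner_eq s t)
    rw [Complex.ofReal_re] at this
    rw [norm_sub_sq_real, hx.norm_sq, hx.norm_sq, this]
    ring
  have h2 : Tendsto (fun s => ‖x s - x t‖ ^ 2) (𝓝 t) (𝓝 0) := by
    simp_rw [h1]
    have hc : Continuous fun s => 2 * (spectralCov f 0).re - 2 * (spectralCov f (s - t)).re :=
      continuous_const.sub (continuous_const.mul
        (Complex.continuous_re.comp (hx.continuous_spectralCov.comp (by fun_prop))))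
    have := hc.tendsto t
    simpa using this
  have h3 := (Real.continuous_sqrt.tendsto 0).comp h2
  simp only [Real.sqrt_zero] at h3
  refine h3.congr fun s => ?_
  simp [Real.sqrt_sq (norm_nonneg _)]

theorem integrable_smul (hx : IsSpectralCurve x f M) {g : ℝ → ℝ} (hg : Integrable g) :
    Integrable (fun s => g s • x s) := by
  refine hg.smul_of_top_left ?_
  refine memLp_top_of_bound ?_ ‖x 0‖ (Eventually.of_forall fun s => (hx.norm_eq s).le)
  exact hx.continuous.aestronglyMeasurable

theorem inner_integral [CompleteSpace E] (hx : IsSpectralCurve x f M) {g : ℝ → ℝ}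
    (hg : Integrable g) (φ : E) :
    inner ℝ (∫ s, g s • x s) φ = ∫ s, g s * inner ℝ (x s) φ := by
  have := (innerSL ℝ φ).integral_comp_comm (hx.integrable_smul hg)
  simp only [innerSL_apply_apply, inner_smul_right] at this
  rw [real_inner_comm, ← this]
  simp_rw [real_inner_comm φ]

theorem integrable_mul_ft (hx : IsSpectralCurve x f M) {g : ℝ → ℝ} (hg : Integrable g) :
    Integrable (fun l => (f l : ℂ) * ft g l) :=
  (hx.integrable.ofReal (𝕜 := ℂ)).mul_bdd (c := ∫ t, ‖g t‖)
    (continuous_ft hg).aestronglyMeasurable (Eventually.of_forall fun l => norm_ft_le g l)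

theorem inner_integral_self [CompleteSpace E] (hx : IsSpectralCurve x f M) {g : ℝ → ℝ}
    (hg : Integrable g) (t : ℝ) :
    ((inner ℝ (∫ s, g s • x s) (x t) : ℝ) : ℂ) = ift (fun l => (f l : ℂ) * ft g l) t := by
  rw [hx.inner_integral hg, ← integral_complex_ofReal]
  have h1 : ∀ s, ((g s * inner ℝ (x s) (x t) : ℝ) : ℂ) =
      (g s : ℂ) * ift (fun l => Complex.exp (Complex.I * (l * (-t) : ℝ)) * (f l : ℂ)) s := by
    intro s
    rw [Complex.ofReal_mul, hx.inner_eq, spectralCov, ift]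
    congr 1
    refine integral_congr_ae (Eventually.of_forall fun l => ?_)
    simp only
    rw [← mul_assoc, ← Complex.exp_add]
    congr 2
    push_cast
    ring
  simp_rw [h1]
  rw [integral_mul_ift hg (integrable_exp_mul hx.integrable_coe (-t)), ift,
    ← integral_neg_eq_self]
  refine integral_congr_ae (Eventually.of_forall fun l => ?_)
  simp only
  rw [neg_neg, ← hx.even l, neg_mul_neg]
  ring

theorem inner_integral_integral [CompleteSpace E] (hx : IsSpectralCurve x f M) {g k : ℝ → ℝ}
    (hg : Integrable g) (hk : Integrable k) :
    ((inner ℝ (∫ s, g s • x s) (∫ s, k s • x s) : ℝ) : ℂ) =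
      ∫ l, (f l : ℂ) * (ft g l * conj (ft k l)) := by
  rw [real_inner_comm, hx.inner_integral hk, ← integral_complex_ofReal]
  have h1 : ∀ s, ((k s * inner ℝ (x s) (∫ s, g s • x s) : ℝ) : ℂ) =
      (k s : ℂ) * ift (fun l => (f l : ℂ) * ft g l) s := by
    intro s
    rw [Complex.ofReal_mul, real_inner_comm, hx.inner_integral_self hg]
  simp_rw [h1]
  rw [integral_mul_ift hk (hx.integrable_mul_ft hg)]
  simp_rw [ft_neg, mul_assoc]

theorem norm_integral_sq_le [CompleteSpace E] (hx : IsSpectralCurve x f M) {g : ℝ → ℝ}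
    (hg : Integrable g) (hg2 : MemLp g 2 volume) :
    ‖∫ s, g s • x s‖ ^ 2 ≤ 2 * Real.pi * M * ∫ s, g s ^ 2 := by
  have h := hx.inner_integral_integral hg hg
  have h2 : ∀ l, (f l : ℂ) * (ft g l * conj (ft g l)) = ((f l * ‖ft g l‖ ^ 2 : ℝ) : ℂ) := by
    intro l
    rw [Complex.mul_conj, Complex.normSq_eq_norm_sq]
    push_cast
    rfl
  simp_rw [h2] at h
  rw [integral_complex_ofReal, real_inner_self_eq_norm_sq] at h
  rw [Complex.ofReal_injective h]
  calc ∫ l, f l * ‖ft g l‖ ^ 2 ≤ ∫ l, M * ‖ft g l‖ ^ 2 := by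
        refine integral_mono_of_nonneg (Eventually.of_forall fun l => ?_)
          ((integrable_norm_ft_sq hg hg2).const_mul M) (Eventually.of_forall fun l => ?_)
        · exact mul_nonneg (hx.nonneg l) (sq_nonneg _)
        · exact mul_le_mul_of_nonneg_right (hx.le l) (sq_nonneg _)
    _ = _ := by rw [integral_const_mul, integral_norm_ft_sq hg hg2]; ring

theorem setIntegral_inner_sq_le [CompleteSpace E] (hx : IsSpectralCurve x f M) (A B : ℝ) (φ : E) :
    ∫ t in Set.Ioc A B, inner ℝ (x t) φ ^ 2 ≤ 2 * Real.pi * M * ‖φ‖ ^ 2 := by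
  have hc : Continuous fun t => inner ℝ (x t) φ := hx.continuous.inner continuous_const
  set g : ℝ → ℝ := Set.indicator (Set.Ioc A B) fun t => inner ℝ (x t) φ with hgdef
  have hbd : ∀ t, ‖inner ℝ (x t) φ‖ ≤ ‖x 0‖ * ‖φ‖ := fun t => by
    rw [← hx.norm_eq t]; exact norm_inner_le_norm _ _
  have hfin : IsFiniteMeasure ((volume : Measure ℝ).restrict (Set.Ioc A B)) := inferInstance
  have hg2 : MemLp g 2 volume := by
    rw [hgdef, memLp_indicator_iff_restrict measurableSet_Ioc]
    exact MemLp.of_bound hc.aestronglyMeasurable _ (Eventually.of_forall hbd)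
  have hg : Integrable g := by
    rw [hgdef, integrable_indicator_iff measurableSet_Ioc]
    exact Integrable.of_bound hc.aestronglyMeasurable _ (Eventually.of_forall hbd)
  set S := ∫ t in Set.Ioc A B, inner ℝ (x t) φ ^ 2 with hS
  have hgS : ∫ t, g t ^ 2 = S := by
    rw [hS, ← integral_indicator measurableSet_Ioc]
    refine integral_congr_ae (Eventually.of_forall fun t => ?_)
    by_cases ht : t ∈ Set.Ioc A B <;> simp [hgdef, ht]
  have h1 : inner ℝ (∫ s, g s • x s) φ = S := by
    rw [hx.inner_integral hg, ← hgS]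
    refine integral_congr_ae (Eventually.of_forall fun t => ?_)
    by_cases ht : t ∈ Set.Ioc A B <;> simp [hgdef, ht, pow_two]
  have h2 := hx.norm_integral_sq_le hg hg2
  rw [hgS] at h2
  have hS0 : 0 ≤ S := integral_nonneg fun _ => sq_nonneg _
  have h3 : S ≤ ‖∫ s, g s • x s‖ * ‖φ‖ := h1 ▸ real_inner_le_norm _ _
  have hK : 0 ≤ 2 * Real.pi * M := by have := hx.M_nonneg; positivity
  rcases hS0.eq_or_lt with h0 | h0
  · rw [← h0]; positivity
  · have h4 : S ^ 2 ≤ 2 * Real.pi * M * S * ‖φ‖ ^ 2 := by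
      calc S ^ 2 ≤ (‖∫ s, g s • x s‖ * ‖φ‖) ^ 2 := pow_le_pow_left₀ hS0 h3 2
        _ = ‖∫ s, g s • x s‖ ^ 2 * ‖φ‖ ^ 2 := by ring
        _ ≤ _ := by gcongr
    nlinarith

theorem integrable_inner_sq [CompleteSpace E] (hx : IsSpectralCurve x f M) (φ : E) :
    Integrable (fun t => inner ℝ (x t) φ ^ 2) := by
  have hc : Continuous fun t => inner ℝ (x t) φ ^ 2 :=
    (hx.continuous.inner continuous_const).pow 2
  refine integrable_of_intervalIntegral_norm_bounded (l := atTop) (a := fun n : ℝ => -n)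
    (b := fun n : ℝ => n) (2 * Real.pi * M * ‖φ‖ ^ 2) (fun n => ?_)
    tendsto_neg_atTop_atBot tendsto_id ?_
  · exact (hc.integrableOn_Icc (a := -n) (b := n)).mono_set Set.Ioc_subset_Icc_self
  · filter_upwards [eventually_ge_atTop (0 : ℝ)] with n hn
    rw [intervalIntegral.integral_of_le (by linarith)]
    simp_rw [norm_pow, Real.norm_eq_abs, sq_abs]
    exact hx.setIntegral_inner_sq_le _ _ φ

theorem integral_inner_sq_le [CompleteSpace E] (hx : IsSpectralCurve x f M) (φ : E) :
    ∫ t, inner ℝ (x t) φ ^ 2 ≤ 2 * Real.pi * M * ‖φ‖ ^ 2 := by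
  have h := intervalIntegral_tendsto_integral (hx.integrable_inner_sq φ)
    (tendsto_neg_atTop_atBot (G := ℝ)) tendsto_id
  refine le_of_tendsto h ?_
  filter_upwards [eventually_ge_atTop (0 : ℝ)] with n hn
  rw [intervalIntegral.integral_of_le (by simp only [id]; linarith)]
  exact hx.setIntegral_inner_sq_le _ _ φ

theorem memLp_inner [CompleteSpace E] (hx : IsSpectralCurve x f M) (φ : E) :
    MemLp (fun t => inner ℝ (x t) φ) 2 volume :=
  (memLp_two_iff_integrable_sq (hx.continuous.inner continuous_const).aestronglyMeasurable).2
    (hx.integrable_inner_sq φ)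

/-- The map `φ ↦ (t ↦ ⟪x t, φ⟫)` into `L²(ℝ)`. -/
noncomputable def analysis [CompleteSpace E] (hx : IsSpectralCurve x f M) :
    E →L[ℝ] Lp ℝ 2 (volume : Measure ℝ) :=
  LinearMap.mkContinuous
    { toFun := fun φ => (hx.memLp_inner φ).toLp _
      map_add' := fun φ ψ => by
        rw [← MemLp.toLp_add]
        congr 1
        ext t
        simp [inner_add_right]
      map_smul' := fun c φ => by
        rw [RingHom.id_apply, ← MemLp.toLp_const_smul]
        congr 1
        ext t
        simp [inner_smul_right] }
    (Real.sqrt (2 * Real.pi * M)) (by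
      intro φ
      have hK : 0 ≤ 2 * Real.pi * M := by have := hx.M_nonneg; positivity
      refine le_of_sq_le_sq ?_ (by positivity)
      simp only [LinearMap.coe_mk, AddHom.coe_mk]
      rw [mul_pow, Real.sq_sqrt hK, ← real_inner_self_eq_norm_sq, L2.inner_def]
      refine le_trans (le_of_eq ?_) (hx.integral_inner_sq_le φ)
      refine integral_congr_ae ?_
      filter_upwards [(hx.memLp_inner φ).coeFn_toLp] with t ht
      rw [ht]
      simp [pow_two])

/-- The weak integral `G ↦ ∫ G(t) x(t) dt` on `L²(ℝ)`. -/
noncomputable def synth [CompleteSpace E] (hx : IsSpectralCurve x f M) :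
    Lp ℝ 2 (volume : Measure ℝ) →L[ℝ] E :=
  ContinuousLinearMap.adjoint hx.analysis

theorem inner_synth [CompleteSpace E] (hx : IsSpectralCurve x f M)
    (G : Lp ℝ 2 (volume : Measure ℝ)) (φ : E) :
    inner ℝ (hx.synth G) φ = ∫ t, G t * inner ℝ (x t) φ := by
  rw [synth, ContinuousLinearMap.adjoint_inner_left, L2.inner_def]
  refine integral_congr_ae ?_
  filter_upwards [(hx.memLp_inner φ).coeFn_toLp] with t ht
  have : (hx.analysis φ) t = inner ℝ (x t) φ := ht
  rw [this]
  simp [mul_comm]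

theorem norm_synth_le [CompleteSpace E] (hx : IsSpectralCurve x f M)
    (G : Lp ℝ 2 (volume : Measure ℝ)) : ‖hx.synth G‖ ≤ Real.sqrt (2 * Real.pi * M) * ‖G‖ := by
  refine (ContinuousLinearMap.le_opNorm _ _).trans ?_
  refine mul_le_mul_of_nonneg_right ?_ (norm_nonneg _)
  rw [synth, LinearIsometryEquiv.norm_map]
  exact LinearMap.mkContinuous_norm_le _ (Real.sqrt_nonneg _) _

theorem synth_toLp [CompleteSpace E] (hx : IsSpectralCurve x f M) {g : ℝ → ℝ} (hg : Integrable g)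
    (hg2 : MemLp g 2 volume) : hx.synth (hg2.toLp g) = ∫ s, g s • x s := by
  refine ext_inner_right ℝ fun φ => ?_
  rw [hx.inner_synth, hx.inner_integral hg]
  refine integral_congr_ae ?_
  filter_upwards [hg2.coeFn_toLp] with t ht
  rw [ht]

/-- The response `t ↦ ∫ G(t - s) x(s) ds`. -/
noncomputable def resp [CompleteSpace E] (hx : IsSpectralCurve x f M)
    (G : Lp ℝ 2 (volume : Measure ℝ)) (t : ℝ) : E :=
  hx.synth (Lp.compMeasurePreserving (fun s => t - s)
    (Measure.measurePreserving_sub_left volume t) G)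

theorem continuous_resp [CompleteSpace E] (hx : IsSpectralCurve x f M)
    (G : Lp ℝ 2 (volume : Measure ℝ)) : Continuous (hx.resp G) := by
  refine hx.synth.continuous.comp ?_
  let F : ℝ → C(ℝ, ℝ) := fun t => ⟨fun s => t - s, by fun_prop⟩
  have hF : Continuous F := ContinuousMap.continuous_of_continuous_uncurry _ (by
    simp only [Function.uncurry_def, F, ContinuousMap.coe_mk]; fun_prop)
  have hm : ∀ t, MeasurePreserving (F t) volume volume :=
    fun t => Measure.measurePreserving_sub_left volume t
  exact Continuous.compMeasurePreservingLp (g := F) (f := fun _ : ℝ => G) (p := 2)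
    continuous_const hF hm (by norm_num)

theorem norm_resp_le [CompleteSpace E] (hx : IsSpectralCurve x f M)
    (G : Lp ℝ 2 (volume : Measure ℝ)) (t : ℝ) :
    ‖hx.resp G t‖ ≤ Real.sqrt (2 * Real.pi * M) * ‖G‖ := by
  refine (hx.norm_synth_le _).trans ?_
  rw [Lp.norm_compMeasurePreserving]

theorem resp_add [CompleteSpace E] (hx : IsSpectralCurve x f M)
    (G G' : Lp ℝ 2 (volume : Measure ℝ)) (t : ℝ) :
    hx.resp (G + G') t = hx.resp G t + hx.resp G' t := by
  simp [resp]

theorem resp_smul [CompleteSpace E] (hx : IsSpectralCurve x f M) (c : ℝ)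
    (G : Lp ℝ 2 (volume : Measure ℝ)) (t : ℝ) :
    hx.resp (c • G) t = c • hx.resp G t := by
  have := (Lp.compMeasurePreservingₗ (E := ℝ) (p := 2) ℝ (fun s => t - s)
    (Measure.measurePreserving_sub_left volume t)).map_smul c G
  have h2 : Lp.compMeasurePreserving (fun s => t - s)
    (Measure.measurePreserving_sub_left volume t) (c • G) = c • Lp.compMeasurePreserving (fun s => t - s)
    (Measure.measurePreserving_sub_left volume t) G := this
  rw [resp, h2, map_smul, resp]

theorem memLp_comp_sub_left {g : ℝ → ℝ} (hg : MemLp g 2 volume) (t : ℝ) :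
    MemLp (fun s => g (t - s)) 2 volume :=
  hg.comp_measurePreserving (Measure.measurePreserving_sub_left volume t)

theorem resp_toLp [CompleteSpace E] (hx : IsSpectralCurve x f M) {g : ℝ → ℝ}
    (hg2 : MemLp g 2 volume) (t : ℝ) :
    hx.resp (hg2.toLp g) t = hx.synth ((memLp_comp_sub_left hg2 t).toLp _) := by
  rw [resp, Lp.toLp_compMeasurePreserving]
  rfl

theorem resp_eq_integral [CompleteSpace E] (hx : IsSpectralCurve x f M) {g : ℝ → ℝ}
    (hg : Integrable g) (hg2 : MemLp g 2 volume) (t : ℝ) :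
    hx.resp (hg2.toLp g) t = ∫ s, g (t - s) • x s := by
  rw [hx.resp_toLp, hx.synth_toLp (hg.comp_sub_left t)]

theorem ft_comp_sub_left (g : ℝ → ℝ) (t l : ℝ) :
    ft (fun s => g (t - s)) l = Complex.exp (-(Complex.I * (l * t : ℝ))) * conj (ft g l) := by
  rw [← ft_neg, ft, ft, ← integral_const_mul]
  rw [← integral_sub_left_eq_self _ _ t]
  refine integral_congr_ae (Eventually.of_forall fun s => ?_)
  simp only [sub_sub_cancel]
  rw [← mul_assoc, ← Complex.exp_add]
  congr 2
  push_cast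
  ring

theorem inner_resp_self [CompleteSpace E] (hx : IsSpectralCurve x f M) {g : ℝ → ℝ}
    (hg : Integrable g) (hg2 : MemLp g 2 volume) (t s : ℝ) :
    ((inner ℝ (hx.resp (hg2.toLp g) t) (x s) : ℝ) : ℂ) =
      ift (fun l => (f l : ℂ) * ft g l) (t - s) := by
  rw [hx.resp_eq_integral hg, hx.inner_integral_self (hg.comp_sub_left t), ift, ift,
    ← integral_neg_eq_self]
  refine integral_congr_ae (Eventually.of_forall fun l => ?_)
  simp only
  rw [ft_comp_sub_left, ft_neg, Complex.conj_conj, ← hx.even]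
  have he : Complex.exp (Complex.I * (l * (t - s) : ℝ)) =
      Complex.exp (Complex.I * (-l * s : ℝ)) * Complex.exp (-(Complex.I * (-l * t : ℝ))) := by
    rw [← Complex.exp_add]
    congr 1
    push_cast
    ring
  rw [he]
  ring

theorem inner_resp_resp [CompleteSpace E] (hx : IsSpectralCurve x f M) {g : ℝ → ℝ}
    (hg : Integrable g) (hg2 : MemLp g 2 volume) (t s : ℝ) :
    ((inner ℝ (hx.resp (hg2.toLp g) t) (hx.resp (hg2.toLp g) s) : ℝ) : ℂ) =
      ift (fun l => (f l : ℂ) * ((‖ft g l‖ ^ 2 : ℝ) : ℂ)) (t - s) := by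
  rw [hx.resp_eq_integral hg, hx.resp_eq_integral hg,
    hx.inner_integral_integral (hg.comp_sub_left t) (hg.comp_sub_left s), ift,
    ← integral_neg_eq_self]
  refine integral_congr_ae (Eventually.of_forall fun l => ?_)
  simp only
  rw [ft_comp_sub_left, ft_comp_sub_left, ft_neg, ← hx.even, map_mul, Complex.conj_conj,
    mul_mul_mul_comm, Complex.mul_conj, Complex.normSq_eq_norm_sq,
    ← Complex.exp_conj, ← Complex.exp_add, mul_left_comm]
  congr 2
  simp only [map_neg, map_mul, Complex.conj_I, Complex.conj_ofReal]
  push_cast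
  ring

/-- The second moment of the centred quadratic functional `∫_0^T y(t) x(t) dt`. -/
noncomputable def quadMoment [CompleteSpace E] (hx : IsSpectralCurve x f M)
    (G : Lp ℝ 2 (volume : Measure ℝ)) (T : ℝ) : ℝ :=
  ∫ t in Set.Ioc 0 T, ∫ s in Set.Ioc 0 T,
    (inner ℝ (hx.resp G t) (hx.resp G s) * inner ℝ (x t) (x s) +
      inner ℝ (hx.resp G t) (x s) * inner ℝ (x t) (hx.resp G s))

theorem quadMoment_eq [CompleteSpace E] (hx : IsSpectralCurve x f M) {g : ℝ → ℝ}
    (hg : Integrable g) (hg2 : MemLp g 2 volume) {T : ℝ} (hT : 0 < T) :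
    (hx.quadMoment (hg2.toLp g) T : ℂ) =
      T * ((∫ l : ℝ, ∫ ν : ℝ, (f l : ℂ) * ((‖ft g l‖ ^ 2 : ℝ) : ℂ) *
          ((f (l + ν / T) : ℂ) * 1) * (fejer ν : ℂ)) +
        ∫ l : ℝ, ∫ ν : ℝ, (f l : ℂ) * ft g l *
          ((f (l + ν / T) : ℂ) * ft g (l + ν / T)) * (fejer ν : ℂ)) := by
  have ha : Integrable (fun l => (f l : ℂ) * ((‖ft g l‖ ^ 2 : ℝ) : ℂ)) := by
    refine hx.integrable_coe.mul_bdd (c := (∫ t, ‖g t‖) ^ 2) ?_ (Eventually.of_forall fun l => ?_)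
    · exact (Complex.continuous_ofReal.comp ((continuous_ft hg).norm.pow 2)).aestronglyMeasurable
    · rw [Complex.norm_real, norm_pow, norm_norm]
      exact pow_le_pow_left₀ (norm_nonneg _) (norm_ft_le g l) 2
  have hb : Integrable (fun l => (f l : ℂ) * 1) := by simpa using hx.integrable_coe
  have hc := hx.integrable_mul_ft hg
  rw [mul_add, ← integral_ift_mul_ift ha hb hT, ← integral_ift_mul_ift hc hc hT, quadMoment,
    ← integral_complex_ofReal]
  have hfin : IsFiniteMeasure ((volume : Measure ℝ).restrict (Set.Ioc 0 T)) := inferInstance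
  have hI : ∀ {a b : ℝ → ℂ}, Integrable a → Integrable b → ∀ t, Integrable
      (fun s => ift a (t - s) * ift b (s - t)) ((volume : Measure ℝ).restrict (Set.Ioc 0 T)) := by
    intro a b ha hb t
    refine Integrable.of_bound (C := (∫ l, ‖a l‖) * ∫ l, ‖b l‖) ?_
      (Eventually.of_forall fun p => ?_)
    · exact (((continuous_ift ha).comp (by fun_prop)).mul
        ((continuous_ift hb).comp (by fun_prop))).aestronglyMeasurable
    · rw [norm_mul]
      exact mul_le_mul (norm_ift_le a _) (norm_ift_le b _) (norm_nonneg _)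
        (integral_nonneg fun _ => norm_nonneg _)
  have hJ : ∀ {a b : ℝ → ℂ}, Integrable a → Integrable b → Integrable
      (fun t => ∫ s in Set.Ioc 0 T, ift a (t - s) * ift b (s - t))
      ((volume : Measure ℝ).restrict (Set.Ioc 0 T)) := by
    intro a b ha hb
    have h2 : Integrable (fun p : ℝ × ℝ => ift a (p.1 - p.2) * ift b (p.2 - p.1))
        (((volume : Measure ℝ).restrict (Set.Ioc 0 T)).prod
          ((volume : Measure ℝ).restrict (Set.Ioc 0 T))) := by
      refine Integrable.of_bound (C := (∫ l, ‖a l‖) * ∫ l, ‖b l‖) ?_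
        (Eventually.of_forall fun p => ?_)
      · exact (((continuous_ift ha).comp (by fun_prop)).mul
          ((continuous_ift hb).comp (by fun_prop))).aestronglyMeasurable
      · rw [norm_mul]
        exact mul_le_mul (norm_ift_le a _) (norm_ift_le b _) (norm_nonneg _)
          (integral_nonneg fun _ => norm_nonneg _)
    exact h2.integral_prod_left
  rw [← integral_add (hJ ha hb) (hJ hc hc)]
  refine integral_congr_ae (Eventually.of_forall fun t => ?_)
  simp only
  rw [← integral_complex_ofReal, ← integral_add (hI ha hb t) (hI hc hc t)]
  refine integral_congr_ae (Eventually.of_forall fun s => ?_)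
  simp only
  push_cast
  rw [real_inner_comm (x s) (x t), real_inner_comm (hx.resp _ s) (x t), hx.inner_eq,
    hx.inner_resp_resp hg, hx.inner_resp_self hg, hx.inner_resp_self hg]
  simp only [mul_one, spectralCov_eq_ift]
  push_cast
  rfl

theorem quadMoment_le [CompleteSpace E] (hx : IsSpectralCurve x f M) {g : ℝ → ℝ}
    (hg : Integrable g) (hg2 : MemLp g 2 volume) (hgf : Integrable (ft g)) {T : ℝ} (hT : 0 < T) :
    hx.quadMoment (hg2.toLp g) T ≤ T * (8 * Real.pi ^ 2 * M ^ 2 * ∫ t, g t ^ 2) := by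
  have h := hx.quadMoment_eq hg hg2 hT
  have hsq := integrable_norm_ft_sq hg hg2
  have b1 := norm_integral_fejer_kernel_le (T := T) (f := f) (M := M) (B := 1)
    (p := fun l => ((‖ft g l‖ ^ 2 : ℝ) : ℂ)) (q := fun _ => 1) (A := 2 * Real.pi * ∫ t, g t ^ 2)
    hsq.ofReal continuous_const (by simp) hx.meas hx.nonneg hx.le (by
      intro δ
      simp only [norm_one, mul_one, Complex.norm_real, norm_pow, norm_norm]
      rw [integral_norm_ft_sq hg hg2])
  have b2 := norm_integral_fejer_kernel_le (T := T) (f := f) (M := M)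
    (p := ft g) (q := ft g) (A := 2 * Real.pi * ∫ t, g t ^ 2)
    hgf (continuous_ft hg) (norm_ft_le g) hx.meas hx.nonneg hx.le (by
      intro δ
      have hsqδ : Integrable (fun l => ‖ft g (l + δ)‖ ^ 2) := hsq.comp_add_right δ
      calc ∫ l, ‖ft g l‖ * ‖ft g (l + δ)‖
          ≤ ∫ l, (1 / 2 * ‖ft g l‖ ^ 2 + 1 / 2 * ‖ft g (l + δ)‖ ^ 2) := by
            refine integral_mono_of_nonneg (Eventually.of_forall fun l => by positivity)
              ((hsq.const_mul _).add (hsqδ.const_mul _)) (Eventually.of_forall fun l => ?_)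
            simp only
            nlinarith [sq_nonneg (‖ft g l‖ - ‖ft g (l + δ)‖)]
        _ = 2 * Real.pi * ∫ t, g t ^ 2 := by
            rw [integral_add (hsq.const_mul _) (hsqδ.const_mul _), integral_const_mul,
              integral_const_mul, integral_add_right_eq_self (fun l => ‖ft g l‖ ^ 2) δ,
              integral_norm_ft_sq hg hg2]
            ring)
  have h2 : ‖(hx.quadMoment (hg2.toLp g) T : ℂ)‖ ≤
      T * (M ^ 2 * (2 * Real.pi) * (2 * Real.pi * ∫ t, g t ^ 2) +
        M ^ 2 * (2 * Real.pi) * (2 * Real.pi * ∫ t, g t ^ 2)) := by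
    rw [h, norm_mul, Complex.norm_real, Real.norm_of_nonneg hT.le]
    exact mul_le_mul_of_nonneg_left ((norm_add_le _ _).trans (add_le_add b1 b2)) hT.le
  rw [Complex.norm_real] at h2
  refine (le_abs_self _).trans (h2.trans (le_of_eq ?_))
  ring

theorem abs_integral_inner_resp_mul_le [CompleteSpace E] (hx : IsSpectralCurve x f M)
    {g : ℝ → ℝ} (hg : Integrable g) (hg2 : MemLp g 2 volume) (T : ℝ) (φ : E) :
    |∫ t in Set.Ioc 0 T, inner ℝ (hx.resp (hg2.toLp g) t) φ * inner ℝ (x t) φ| ≤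
      2 * Real.pi * M * (∫ t, ‖g t‖) * ‖φ‖ ^ 2 := by
  set k : ℝ → ℝ := fun t => inner ℝ (x t) φ with hk
  have hkc : Continuous k := hx.continuous.inner continuous_const
  have hbd : ∀ t, ‖k t‖ ≤ ‖x 0‖ * ‖φ‖ := fun t => by
    rw [← hx.norm_eq t]; exact norm_inner_le_norm _ _
  have hk2 : Integrable (fun t => k t ^ 2) := hx.integrable_inner_sq φ
  have hkle : ∫ t, k t ^ 2 ≤ 2 * Real.pi * M * ‖φ‖ ^ 2 := hx.integral_inner_sq_le φ
  have h1 : ∀ t, inner ℝ (hx.resp (hg2.toLp g) t) φ * k t = ∫ u, g u * (k (t - u) * k t) := by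
    intro t
    rw [hx.resp_eq_integral hg, hx.inner_integral (hg.comp_sub_left t), ← integral_mul_const,
      ← integral_sub_left_eq_self _ _ t]
    refine integral_congr_ae (Eventually.of_forall fun s => ?_)
    simp only [sub_sub_cancel, hk]
    ring
  have hint : Integrable (fun p : ℝ × ℝ => g p.2 * (k (p.1 - p.2) * k p.1))
      (((volume : Measure ℝ).restrict (Set.Ioc 0 T)).prod volume) := by
    have h0 : Integrable (fun p : ℝ × ℝ => (1 : ℝ) * g p.2)
        (((volume : Measure ℝ).restrict (Set.Ioc 0 T)).prod volume) :=
      (integrable_const (1 : ℝ)).mul_prod hg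
    simp only [one_mul] at h0
    refine h0.mul_bdd (c := (‖x 0‖ * ‖φ‖) * (‖x 0‖ * ‖φ‖)) ?_ (Eventually.of_forall fun p => ?_)
    · exact Continuous.aestronglyMeasurable (by fun_prop)
    · rw [norm_mul]
      exact mul_le_mul (hbd _) (hbd _) (norm_nonneg _) (by positivity)
  calc |∫ t in Set.Ioc 0 T, inner ℝ (hx.resp (hg2.toLp g) t) φ * inner ℝ (x t) φ|
      = |∫ t in Set.Ioc 0 T, ∫ u, g u * (k (t - u) * k t)| := by
        congr 1
        exact integral_congr_ae (Eventually.of_forall fun t => h1 t)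
    _ = |∫ u, ∫ t in Set.Ioc 0 T, g u * (k (t - u) * k t)| := by
        rw [integral_integral_swap hint]
    _ ≤ ∫ u, ‖g u‖ * (2 * Real.pi * M * ‖φ‖ ^ 2) := by
        rw [← Real.norm_eq_abs]
        refine norm_integral_le_of_norm_le (hg.norm.mul_const _) (Eventually.of_forall fun u => ?_)
        rw [integral_const_mul, norm_mul]
        refine mul_le_mul_of_nonneg_left ?_ (norm_nonneg _)
        have hk2u : Integrable (fun t => k (t - u) ^ 2) := hk2.comp_sub_right u
        have hdom : Integrable (fun t => 1 / 2 * k (t - u) ^ 2 + 1 / 2 * k t ^ 2) :=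
          (hk2u.const_mul _).add (hk2.const_mul _)
        calc ‖∫ t in Set.Ioc 0 T, k (t - u) * k t‖
            ≤ ∫ t in Set.Ioc 0 T, (1 / 2 * k (t - u) ^ 2 + 1 / 2 * k t ^ 2) := by
              refine norm_integral_le_of_norm_le hdom.integrableOn
                (Eventually.of_forall fun t => ?_)
              rw [Real.norm_eq_abs, abs_le]
              constructor <;> nlinarith [sq_nonneg (k (t - u) - k t), sq_nonneg (k (t - u) + k t)]
          _ ≤ ∫ t, (1 / 2 * k (t - u) ^ 2 + 1 / 2 * k t ^ 2) :=
              setIntegral_le_integral hdom (Eventually.of_forall fun t => by positivity)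
          _ = ∫ t, k t ^ 2 := by
              rw [integral_add (hk2u.const_mul _) (hk2.const_mul _), integral_const_mul,
                integral_const_mul, integral_sub_right_eq_self (fun t => k t ^ 2) u]
              ring
          _ ≤ _ := hkle
    _ = _ := by rw [integral_mul_const]; ring

end IsSpectralCurve

theorem tendsto_quadMoment_div {E : ℝ → Type*} [∀ Δ, NormedAddCommGroup (E Δ)]
    [∀ Δ, InnerProductSpace ℝ (E Δ)] [∀ Δ, CompleteSpace (E Δ)] {x : ∀ Δ, ℝ → E Δ}
    {f : ℝ → ℝ → ℝ} {M c : ℝ} (hx : ∀ Δ : Set.Ioi (0 : ℝ), IsSpectralCurve (x Δ) (f Δ) M)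
    (hlim : ∀ r > 0, TendstoUniformlyOn f (fun _ => c / (2 * Real.pi)) atTop (Set.Icc (-r) r))
    {g : ℝ → ℝ} (hg : Integrable g) (hg2 : MemLp g 2 volume) (hgf : Integrable (ft g)) :
    Tendsto (fun z : Set.Ioi (0 : ℝ) × Set.Ioi (0 : ℝ) =>
        (hx z.2).quadMoment (hg2.toLp g) z.1 / z.1) (atTop ×ˢ atTop)
      (𝓝 (c ^ 2 * ((∫ t, g t * g t) + ∫ t, g t * g (-t)))) := by
  have hsq := integrable_norm_ft_sq hg hg2
  have hm : ∀ Δ > 0, Measurable (f Δ) := fun Δ hΔ => (hx ⟨Δ, hΔ⟩).meas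
  have h0 : ∀ Δ > 0, ∀ l, 0 ≤ f Δ l := fun Δ hΔ => (hx ⟨Δ, hΔ⟩).nonneg
  have hM : ∀ Δ > 0, ∀ l, f Δ l ≤ M := fun Δ hΔ => (hx ⟨Δ, hΔ⟩).le
  have t1 := tendsto_integral_fejer_kernel (p := fun l => ((‖ft g l‖ ^ 2 : ℝ) : ℂ))
    (q := fun _ => 1) (B := 1) hsq.ofReal continuous_const (by simp) hm h0 hM hlim
  have t2 := tendsto_integral_fejer_kernel (p := ft g) (q := ft g) hgf (continuous_ft hg)
    (norm_ft_le g) hm h0 hM hlim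
  have hcoe : Tendsto (fun z : Set.Ioi (0 : ℝ) × Set.Ioi (0 : ℝ) => ((z.1 : ℝ), (z.2 : ℝ)))
      (atTop ×ˢ atTop) (atTop ×ˢ atTop) :=
    (tendsto_comp_val_Ioi_atTop.2 tendsto_id).prodMap (tendsto_comp_val_Ioi_atTop.2 tendsto_id)
  have t3 := (t1.add t2).comp hcoe
  have hval : ((c / (2 * Real.pi) : ℝ) : ℂ) ^ 2 * (2 * Real.pi : ℝ) *
      (∫ l, ((‖ft g l‖ ^ 2 : ℝ) : ℂ) * 1) +
      ((c / (2 * Real.pi) : ℝ) : ℂ) ^ 2 * (2 * Real.pi : ℝ) * (∫ l, ft g l * ft g l) =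
      ((c ^ 2 * ((∫ t, g t * g t) + ∫ t, g t * g (-t)) : ℝ) : ℂ) := by
    simp only [mul_one]
    rw [integral_complex_ofReal, integral_norm_ft_sq hg hg2, integral_ft_sq hg hg2]
    simp_rw [pow_two (g _)]
    rw [← Complex.ofReal_pow, ← Complex.ofReal_mul, ← Complex.ofReal_mul, ← Complex.ofReal_mul,
      ← Complex.ofReal_add]
    congr 1
    field_simp
  rw [hval] at t3
  have t4 := (Complex.continuous_re.tendsto _).comp t3
  rw [Complex.ofReal_re] at t4
  refine t4.congr fun z => ?_
  have hz : (0 : ℝ) < z.1 := z.1.2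
  have h := (hx z.2).quadMoment_eq hg hg2 hz
  have hT' : ((z.1 : ℝ) : ℂ) ≠ 0 := by exact_mod_cast hz.ne'
  simp only [Function.comp_apply]
  rw [← mul_div_cancel_left₀ (_ + _) hT', ← h, ← Complex.ofReal_div, Complex.ofReal_re]

end SpectralCurve

end Correlogram

namespace Correlogram

/-! ### Gaussian Hilbert spaces -/

section GaussianMoments

theorem integral_pow_four_gaussianReal (v : ℝ≥0) :
    ∫ x, x ^ 4 ∂(gaussianReal 0 v) = 3 * (v : ℝ) ^ 2 := by
  have h := iteratedDeriv_mgf_zero (X := id) (μ := gaussianReal 0 v) (by simp) 4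
  have h0 : mgf id (gaussianReal 0 v) = fun t => Real.exp (v * t ^ 2 / 2) := by
    rw [mgf_id_gaussianReal]; simp
  have hd : ∀ t : ℝ, HasDerivAt (fun t : ℝ => Real.exp (v * t ^ 2 / 2))
      (v * t * Real.exp (v * t ^ 2 / 2)) t := by
    intro t
    have := ((((hasDerivAt_id t).pow 2).const_mul (v : ℝ)).div_const 2).exp
    refine this.congr_deriv ?_
    simp
    ring
  have e1 : deriv (fun t : ℝ => Real.exp (v * t ^ 2 / 2)) =
      fun t => v * t * Real.exp (v * t ^ 2 / 2) := funext fun t => (hd t).deriv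
  have e2 : deriv (fun t : ℝ => v * t * Real.exp (v * t ^ 2 / 2)) =
      fun t => (v + v ^ 2 * t ^ 2) * Real.exp (v * t ^ 2 / 2) := by
    funext t
    refine ((((hasDerivAt_id t).const_mul (v : ℝ)).mul (hd t)).congr_deriv ?_).deriv
    simp; ring
  have e3 : deriv (fun t : ℝ => (v + v ^ 2 * t ^ 2) * Real.exp (v * t ^ 2 / 2)) =
      fun t => (3 * v ^ 2 * t + v ^ 3 * t ^ 3) * Real.exp (v * t ^ 2 / 2) := by
    funext t
    refine ((((((hasDerivAt_id t).pow 2).const_mul ((v : ℝ) ^ 2)).const_add (v : ℝ)).mul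
      (hd t)).congr_deriv ?_).deriv
    simp; ring
  have e4 : deriv (fun t : ℝ => (3 * v ^ 2 * t + v ^ 3 * t ^ 3) * Real.exp (v * t ^ 2 / 2)) 0 =
      3 * (v : ℝ) ^ 2 := by
    refine ((((((hasDerivAt_id (0 : ℝ)).const_mul (3 * (v : ℝ) ^ 2))).add
      (((hasDerivAt_id (0 : ℝ)).pow 3).const_mul ((v : ℝ) ^ 3))).mul (hd 0)).congr_deriv ?_).deriv
    simp
  rw [h0, iteratedDeriv_succ, iteratedDeriv_succ, iteratedDeriv_succ, iteratedDeriv_one,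
    e1, e2, e3, e4] at h
  simpa using h.symm

end GaussianMoments

section GaussianSubspace

variable {Ω : Type*} [MeasurableSpace Ω] {P : Measure Ω}

/-- A subspace of `L²(P)` all elements of which are centred Gaussian. -/
def IsGaussianSubspace (S : Submodule ℝ (Lp ℝ 2 P)) : Prop :=
  ∀ u ∈ S, P.map u = gaussianReal 0 (‖u‖₊ ^ 2)

theorem aemeasurable_Lp (u : Lp ℝ 2 P) : AEMeasurable u P := (Lp.aestronglyMeasurable u).aemeasurable

variable [IsProbabilityMeasure P]

/-- The characteristic function is Lipschitz on `L²(P)`. -/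
theorem norm_integral_cexp_sub_integral_cexp_le (θ : ℝ) (u v : Lp ℝ 2 P) :
    ‖∫ ω, Complex.exp (θ * u ω * Complex.I) ∂P - ∫ ω, Complex.exp (θ * v ω * Complex.I) ∂P‖ ≤
      |θ| * ‖u - v‖ := by
  have hint : ∀ u : Lp ℝ 2 P, Integrable (fun ω => Complex.exp (θ * u ω * Complex.I)) P := by
    intro u
    refine Integrable.of_bound ?_ 1 (Eventually.of_forall fun ω => ?_)
    · have := (aemeasurable_Lp u)
      exact (by fun_prop : AEMeasurable (fun ω => Complex.exp (θ * u ω * Complex.I)) P).aestronglyMeasurable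
    · rw [← Complex.ofReal_mul, Complex.norm_exp_ofReal_mul_I]
  rw [← integral_sub (hint u) (hint v)]
  have hb : ∀ a b : ℝ, ‖Complex.exp (θ * a * Complex.I) - Complex.exp (θ * b * Complex.I)‖ ≤
      |θ| * |a - b| := by
    intro a b
    have h1 : Complex.exp (θ * a * Complex.I) - Complex.exp (θ * b * Complex.I) =
        Complex.exp ((θ * b : ℝ) * Complex.I) *
          (Complex.exp (Complex.I * (θ * (a - b) : ℝ)) - 1) := by
      rw [mul_sub, mul_one, ← Complex.exp_add]
      push_cast
      congr 2
      ring
    rw [h1, norm_mul, Complex.norm_exp_ofReal_mul_I, one_mul, ← abs_mul]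
    exact Real.norm_exp_I_mul_ofReal_sub_one_le
  have hsub : Integrable (fun ω => |(u - v : Lp ℝ 2 P) ω|) P :=
    ((Lp.memLp (u - v)).integrable (by norm_num)).abs
  calc ‖∫ ω, (Complex.exp (θ * u ω * Complex.I) - Complex.exp (θ * v ω * Complex.I)) ∂P‖
      ≤ ∫ ω, |θ| * |(u - v : Lp ℝ 2 P) ω| ∂P := by
        refine norm_integral_le_of_norm_le (hsub.const_mul _) ?_
        filter_upwards [Lp.coeFn_sub u v] with ω hω
        rw [hω]
        exact hb _ _
    _ = |θ| * ∫ ω, ‖(u - v : Lp ℝ 2 P) ω‖ ∂P := integral_const_mul _ _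
    _ ≤ |θ| * ‖u - v‖ := by
        refine mul_le_mul_of_nonneg_left ?_ (abs_nonneg _)
        rw [integral_norm_eq_lintegral_enorm (Lp.aestronglyMeasurable _),
          ← eLpNorm_one_eq_lintegral_enorm, Lp.norm_def]
        refine ENNReal.toReal_mono (Lp.eLpNorm_ne_top _) ?_
        exact eLpNorm_le_eLpNorm_of_exponent_le (by norm_num) (Lp.aestronglyMeasurable _)

theorem continuous_integral_cexp (θ : ℝ) :
    Continuous fun u : Lp ℝ 2 P => ∫ ω, Complex.exp (θ * u ω * Complex.I) ∂P := by
  refine LipschitzWith.continuous (K := ⟨|θ|, abs_nonneg _⟩) (LipschitzWith.of_dist_le_mul ?_)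
  intro u v
  rw [dist_eq_norm, dist_eq_norm]
  exact norm_integral_cexp_sub_integral_cexp_le θ u v

theorem integral_cexp_eq_charFun (u : Lp ℝ 2 P) (θ : ℝ) :
    ∫ ω, Complex.exp (θ * u ω * Complex.I) ∂P = charFun (P.map u) θ := by
  rw [charFun_apply_real, integral_map (aemeasurable_Lp u)]
  exact (by fun_prop : Measurable fun x : ℝ => Complex.exp (θ * x * Complex.I)).aestronglyMeasurable

theorem isGaussianSubspace_closure {S : Submodule ℝ (Lp ℝ 2 P)} (hS : IsGaussianSubspace S) :
    IsGaussianSubspace S.topologicalClosure := by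
  intro u hu
  have : IsProbabilityMeasure (P.map u) := Measure.isProbabilityMeasure_map (aemeasurable_Lp u)
  refine Measure.ext_of_charFun (funext fun θ => ?_)
  have hclosed : IsClosed {w : Lp ℝ 2 P | ∫ ω, Complex.exp (θ * w ω * Complex.I) ∂P =
      Complex.exp (-((‖w‖ : ℂ) ^ 2 * θ ^ 2 / 2))} := by
    refine isClosed_eq (continuous_integral_cexp θ) ?_
    fun_prop
  have hsub : (S : Set (Lp ℝ 2 P)) ⊆ {w : Lp ℝ 2 P | ∫ ω, Complex.exp (θ * w ω * Complex.I) ∂P =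
      Complex.exp (-((‖w‖ : ℂ) ^ 2 * θ ^ 2 / 2))} := by
    intro w hw
    rw [Set.mem_ofPred_eq, integral_cexp_eq_charFun, hS w hw, charFun_gaussianReal]
    simp
  have hmem := hclosed.closure_subset_iff.2 hsub hu
  rw [Set.mem_ofPred_eq] at hmem
  rw [← integral_cexp_eq_charFun, hmem, charFun_gaussianReal]
  simp

theorem coeFn_finset_sum_smul {ι : Type*} (s : Finset ι) (c : ι → ℝ) (u : ι → Lp ℝ 2 P) :
    (∑ i ∈ s, c i • u i : Lp ℝ 2 P) =ᵐ[P] fun ω => ∑ i ∈ s, c i * u i ω := by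
  classical
  induction s using Finset.induction_on with
  | empty =>
    filter_upwards [Lp.coeFn_zero ℝ 2 P] with ω hω
    simp
  | insert a s ha ih =>
    rw [Finset.sum_insert ha]
    filter_upwards [Lp.coeFn_add (c a • u a) (∑ i ∈ s, c i • u i), Lp.coeFn_smul (c a) (u a), ih]
      with ω h1 h2 h3
    rw [h1, Pi.add_apply, h2, h3, Finset.sum_insert ha]
    simp

/-- The closed linear span of a centred Gaussian process is a Gaussian subspace. -/
theorem IsGaussianProcess.isGaussianSubspace_span {ι : Type*} {X : ι → Ω → ℝ}
    (hX : IsGaussianProcess X P) (h0 : ∀ t, ∫ ω, X t ω ∂P = 0) {x : ι → Lp ℝ 2 P}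
    (hx : ∀ t, x t =ᵐ[P] X t) :
    IsGaussianSubspace (Submodule.span ℝ (Set.range x)) := by
  intro u hu
  obtain ⟨c, rfl⟩ := Finsupp.mem_span_range_iff_exists_finsupp.1 hu
  set s := c.support
  have hsum : (c.sum fun i a => a • x i) = ∑ i ∈ s, c i • x i := rfl
  rw [hsum]
  have hae : (∑ i ∈ s, c i • x i : Lp ℝ 2 P) =ᵐ[P] fun ω => ∑ i ∈ s, c i * X i ω := by
    refine (coeFn_finset_sum_smul s c x).trans ?_
    have : ∀ᵐ ω ∂P, ∀ i ∈ s, x i ω = X i ω := (Finset.eventually_all s).2 fun i _ => hx i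
    filter_upwards [this] with ω hω
    exact Finset.sum_congr rfl fun i hi => by rw [hω i hi]
  let L : (s → ℝ) →L[ℝ] ℝ := ∑ i : s, c i • ContinuousLinearMap.proj i
  have hL : HasGaussianLaw (fun ω => ∑ i ∈ s, c i * X i ω) P := by
    have h := (hX.hasGaussianLaw s).map_fun L
    refine h.congr (Eventually.of_forall fun ω => ?_)
    simp only [L, FunLike.coe_sum, Finset.sum_apply, FunLike.coe_smul, Pi.smul_apply,
      ContinuousLinearMap.proj_apply, Finset.restrict, smul_eq_mul]
    exact Finset.sum_coe_sort s fun i => c i * X i ω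
  have hU := hL.congr hae.symm
  have hmean : ∫ ω, (∑ i ∈ s, c i • x i : Lp ℝ 2 P) ω ∂P = 0 := by
    rw [integral_congr_ae hae, integral_finsetSum _ fun i _ =>
      ((hX.hasGaussianLaw_eval i).integrable).const_mul _]
    refine Finset.sum_eq_zero fun i _ => ?_
    rw [integral_const_mul, h0, mul_zero]
  rw [hU.map_eq_gaussianReal, hmean]
  congr 1
  rw [variance_of_integral_eq_zero hU.aemeasurable hmean]
  have : ∫ ω, (∑ i ∈ s, c i • x i : Lp ℝ 2 P) ω ^ 2 ∂P = ‖(∑ i ∈ s, c i • x i : Lp ℝ 2 P)‖ ^ 2 := by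
    rw [← real_inner_self_eq_norm_sq, L2.inner_def]
    refine integral_congr_ae (Eventually.of_forall fun ω => ?_)
    simp [pow_two]
  rw [this]
  ext
  simp

namespace IsGaussianSubspace

variable {S : Submodule ℝ (Lp ℝ 2 P)}

theorem memLp (hS : IsGaussianSubspace S) (u : S) {p : ℝ≥0∞} (hp : p ≠ ∞) :
    MemLp (u : Lp ℝ 2 P) p P := by
  have h := memLp_id_gaussianReal' (μ := 0) (v := ‖(u : Lp ℝ 2 P)‖₊ ^ 2) p hp
  rw [← hS u u.2] at h
  exact (memLp_map_measure_iff aestronglyMeasurable_id (aemeasurable_Lp _)).1 h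

theorem integral_eq_zero (hS : IsGaussianSubspace S) (u : S) : ∫ ω, (u : Lp ℝ 2 P) ω ∂P = 0 := by
  have h : ∫ x, x ∂(P.map (u : Lp ℝ 2 P)) = 0 := by
    rw [hS u u.2, integral_id_gaussianReal]
  rwa [integral_map (f := fun x => x) (aemeasurable_Lp _) aestronglyMeasurable_id] at h

theorem integral_pow_four (hS : IsGaussianSubspace S) (u : S) :
    ∫ ω, (u : Lp ℝ 2 P) ω ^ 4 ∂P = 3 * (inner ℝ u u) ^ 2 := by
  have h : ∫ x, x ^ 4 ∂(P.map (u : Lp ℝ 2 P)) = 3 * (inner ℝ u u) ^ 2 := by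
    rw [hS u u.2, integral_pow_four_gaussianReal, real_inner_self_eq_norm_sq]
    simp
  rwa [integral_map (aemeasurable_Lp _) (by fun_prop)] at h

theorem hasGaussianLaw_pi (hS : IsGaussianSubspace S) {ι : Type*} [Fintype ι] (e : ι → S) :
    HasGaussianLaw (fun ω i => (e i : Lp ℝ 2 P) ω) P := by
  refine ⟨isGaussian_of_map_eq_gaussianReal fun L => ?_⟩
  have hm : AEMeasurable (fun ω i => (e i : Lp ℝ 2 P) ω) P :=
    aemeasurable_pi_lambda _ fun i => aemeasurable_Lp _
  rw [AEMeasurable.map_map_of_aemeasurable (by fun_prop) hm]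
  classical
  set c : ι → ℝ := fun i => L (Pi.single i 1)
  refine ⟨0, ‖((∑ i, c i • e i : S) : Lp ℝ 2 P)‖₊ ^ 2, ?_⟩
  rw [← hS _ (∑ i, c i • e i : S).2]
  refine Measure.map_congr ?_
  have h := coeFn_finset_sum_smul Finset.univ c (fun i => (e i : Lp ℝ 2 P))
  have hc : ((∑ i, c i • e i : S) : Lp ℝ 2 P) = ∑ i, c i • (e i : Lp ℝ 2 P) := by simp
  rw [hc]
  filter_upwards [h] with ω hω
  rw [hω, Function.comp_apply]
  conv_lhs => rw [← Finset.univ_sum_single (fun i => (e i : Lp ℝ 2 P) ω)]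
  rw [map_sum]
  refine Finset.sum_congr rfl fun i _ => ?_
  have : Pi.single i ((e i : Lp ℝ 2 P) ω) = ((e i : Lp ℝ 2 P) ω) • (Pi.single i (1 : ℝ) : ι → ℝ) := by
    rw [← Pi.single_smul]; simp
  rw [this, map_smul, smul_eq_mul, mul_comm]

theorem isGaussianProcess (hS : IsGaussianSubspace S) {ι : Type*} (e : ι → S) :
    IsGaussianProcess (fun i ω => (e i : Lp ℝ 2 P) ω) P :=
  ⟨fun I => hS.hasGaussianLaw_pi fun i : I => e i⟩

theorem inner_eq_integral (u v : S) :
    inner ℝ u v = ∫ ω, (u : Lp ℝ 2 P) ω * (v : Lp ℝ 2 P) ω ∂P := by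
  rw [Submodule.coe_inner, L2.inner_def]
  refine integral_congr_ae (Eventually.of_forall fun ω => ?_)
  simp [mul_comm]

theorem covariance_eq_inner (hS : IsGaussianSubspace S) (u v : S) :
    cov[(u : Lp ℝ 2 P), (v : Lp ℝ 2 P); P] = inner ℝ u v := by
  rw [covariance_eq_sub (Lp.memLp _) (Lp.memLp _), hS.integral_eq_zero, zero_mul, sub_zero,
    inner_eq_integral]
  rfl

theorem memLp_mul (hS : IsGaussianSubspace S) (u v : S) :
    MemLp (fun ω => (u : Lp ℝ 2 P) ω * (v : Lp ℝ 2 P) ω) 2 P := by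
  have : ENNReal.HolderTriple 4 4 2 := ⟨by
    rw [← ENNReal.toReal_eq_toReal_iff' (by simp) (by simp), ENNReal.toReal_add (by simp) (by simp)]
    norm_num⟩
  exact (hS.memLp v (p := 4) (by norm_num)).mul (hS.memLp u (p := 4) (by norm_num))

theorem integrable_mul_mul (hS : IsGaussianSubspace S) (u v w z : S) :
    Integrable (fun ω => (u : Lp ℝ 2 P) ω * (v : Lp ℝ 2 P) ω *
      ((w : Lp ℝ 2 P) ω * (z : Lp ℝ 2 P) ω)) P :=
  (hS.memLp_mul u v).integrable_mul (hS.memLp_mul w z)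

theorem inner_self_add_four {E : Type*} [NormedAddCommGroup E] [InnerProductSpace ℝ E]
    (u v w z : E) (a b c : ℝ) :
    inner ℝ (u + a • v + b • w + c • z) (u + a • v + b • w + c • z) =
      inner ℝ u u + a ^ 2 * inner ℝ v v + b ^ 2 * inner ℝ w w + c ^ 2 * inner ℝ z z +
      2 * a * inner ℝ u v + 2 * b * inner ℝ u w + 2 * c * inner ℝ u z + 2 * a * b * inner ℝ v w +
      2 * a * c * inner ℝ v z + 2 * b * c * inner ℝ w z := by
  simp only [inner_add_left, inner_add_right, real_inner_smul_left, real_inner_smul_right]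
  rw [real_inner_comm u v, real_inner_comm u w, real_inner_comm u z, real_inner_comm v w,
    real_inner_comm v z, real_inner_comm w z]
  ring

/-- The moment formula for products of four jointly Gaussian centred variables. -/
theorem integral_mul_four (hS : IsGaussianSubspace S) (u v w z : S) :
    ∫ ω, (u : Lp ℝ 2 P) ω * (v : Lp ℝ 2 P) ω * ((w : Lp ℝ 2 P) ω * (z : Lp ℝ 2 P) ω) ∂P =
      inner ℝ u v * inner ℝ w z + inner ℝ u w * inner ℝ v z + inner ℝ u z * inner ℝ v w := by
  have hq : ∀ a b c : ℝ, ∫ ω, ((u : Lp ℝ 2 P) ω + a * (v : Lp ℝ 2 P) ω + b * (w : Lp ℝ 2 P) ω +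
      c * (z : Lp ℝ 2 P) ω) ^ 4 ∂P =
      3 * (inner ℝ u u + a ^ 2 * inner ℝ v v + b ^ 2 * inner ℝ w w + c ^ 2 * inner ℝ z z +
      2 * a * inner ℝ u v + 2 * b * inner ℝ u w + 2 * c * inner ℝ u z + 2 * a * b * inner ℝ v w +
      2 * a * c * inner ℝ v z + 2 * b * c * inner ℝ w z) ^ 2 := by
    intro a b c
    refine Eq.trans ?_ ((hS.integral_pow_four (u + a • v + b • w + c • z)).trans
      (congrArg (fun r => 3 * r ^ 2) (inner_self_add_four u v w z a b c)))
    refine integral_congr_ae ?_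
    filter_upwards [Lp.coeFn_add ((u + a • v + b • w : S) : Lp ℝ 2 P) ((c • z : S) : Lp ℝ 2 P),
      Lp.coeFn_add ((u + a • v : S) : Lp ℝ 2 P) ((b • w : S) : Lp ℝ 2 P),
      Lp.coeFn_add (u : Lp ℝ 2 P) ((a • v : S) : Lp ℝ 2 P),
      Lp.coeFn_smul a (v : Lp ℝ 2 P), Lp.coeFn_smul b (w : Lp ℝ 2 P),
      Lp.coeFn_smul c (z : Lp ℝ 2 P)] with ω h1 h2 h3 h4 h5 h6
    simp only [Submodule.coe_add, Submodule.coe_smul] at h1 h2 h3 ⊢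
    rw [h1, Pi.add_apply, h2, Pi.add_apply, h3, Pi.add_apply, h4, h5, h6]
    simp
  have hint : ∀ a b c : ℝ, Integrable (fun ω => ((u : Lp ℝ 2 P) ω + a * (v : Lp ℝ 2 P) ω +
      b * (w : Lp ℝ 2 P) ω + c * (z : Lp ℝ 2 P) ω) ^ 4) P := by
    intro a b c
    have hm : MemLp (fun ω => (u : Lp ℝ 2 P) ω + a * (v : Lp ℝ 2 P) ω +
      b * (w : Lp ℝ 2 P) ω + c * (z : Lp ℝ 2 P) ω) 4 P :=
      (((hS.memLp u (by norm_num)).add ((hS.memLp v (by norm_num)).const_mul a)).add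
        ((hS.memLp w (by norm_num)).const_mul b)).add ((hS.memLp z (by norm_num)).const_mul c)
    have := hm.integrable_norm_pow (p := 4) (by norm_num)
    refine this.congr (Eventually.of_forall fun ω => ?_)
    simp only [Real.norm_eq_abs]
    exact (by decide : Even 4).pow_abs _
  have hpol : ∀ ω, (u : Lp ℝ 2 P) ω * (v : Lp ℝ 2 P) ω *
      ((w : Lp ℝ 2 P) ω * (z : Lp ℝ 2 P) ω) = (1 / 192 : ℝ) * (
      (((u : Lp ℝ 2 P) ω + 1 * (v : Lp ℝ 2 P) ω + 1 * (w : Lp ℝ 2 P) ω + 1 * (z : Lp ℝ 2 P) ω) ^ 4 -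
      ((u : Lp ℝ 2 P) ω + 1 * (v : Lp ℝ 2 P) ω + 1 * (w : Lp ℝ 2 P) ω + (-1) * (z : Lp ℝ 2 P) ω) ^ 4 -
      ((u : Lp ℝ 2 P) ω + 1 * (v : Lp ℝ 2 P) ω + (-1) * (w : Lp ℝ 2 P) ω + 1 * (z : Lp ℝ 2 P) ω) ^ 4 +
      ((u : Lp ℝ 2 P) ω + 1 * (v : Lp ℝ 2 P) ω + (-1) * (w : Lp ℝ 2 P) ω + (-1) * (z : Lp ℝ 2 P) ω) ^ 4)
      - (((u : Lp ℝ 2 P) ω + (-1) * (v : Lp ℝ 2 P) ω + 1 * (w : Lp ℝ 2 P) ω + 1 * (z : Lp ℝ 2 P) ω) ^ 4 -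
      ((u : Lp ℝ 2 P) ω + (-1) * (v : Lp ℝ 2 P) ω + 1 * (w : Lp ℝ 2 P) ω + (-1) * (z : Lp ℝ 2 P) ω) ^ 4 -
      ((u : Lp ℝ 2 P) ω + (-1) * (v : Lp ℝ 2 P) ω + (-1) * (w : Lp ℝ 2 P) ω + 1 * (z : Lp ℝ 2 P) ω) ^ 4 +
      ((u : Lp ℝ 2 P) ω + (-1) * (v : Lp ℝ 2 P) ω + (-1) * (w : Lp ℝ 2 P) ω + (-1) * (z : Lp ℝ 2 P) ω) ^ 4)) := by
    intro ω
    ring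
  simp_rw [hpol]
  rw [integral_const_mul, integral_sub, integral_add, integral_sub, integral_sub, integral_add,
    integral_sub, integral_sub]
  · simp only [hq]
    ring
  all_goals repeat first | exact hint _ _ _ | exact (hint _ _ _).fun_neg | apply Integrable.fun_add

end IsGaussianSubspace

end GaussianSubspace

end Correlogram

namespace Correlogram

/-! ### The second Wiener chaos -/

section Diagonalization

variable {E F : Type*} [NormedAddCommGroup E] [InnerProductSpace ℝ E] [AddCommGroup F] [Module ℝ F]

/-- A quadratic form `∑ cᵢ B(uᵢ, uᵢ)` can be brought to principal axes. -/
theorem exists_orthonormal_sum_eq (B : E →ₗ[ℝ] E →ₗ[ℝ] F) (hB : ∀ u v, B u v = B v u) {q : F}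
    (hq : q ∈ Submodule.span ℝ (Set.range fun p : E × E => B p.1 p.2)) :
    ∃ (n : ℕ) (e : Fin n → E) (l : Fin n → ℝ), Orthonormal ℝ e ∧ q = ∑ k, l k • B (e k) (e k) := by
  have hle : Submodule.span ℝ (Set.range fun p : E × E => B p.1 p.2) ≤
      Submodule.span ℝ (Set.range fun u : E => B u u) := by
    refine Submodule.span_le.2 ?_
    rintro _ ⟨⟨u, v⟩, rfl⟩
    have h : B u v = (1 / 4 : ℝ) • (B (u + v) (u + v) - B (u - v) (u - v)) := by
      simp only [map_add, map_sub, LinearMap.add_apply, LinearMap.sub_apply]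
      rw [hB v u]
      module
    change B u v ∈ _
    rw [h]
    exact Submodule.smul_mem _ _ (Submodule.sub_mem _ (Submodule.subset_span ⟨_, rfl⟩)
      (Submodule.subset_span ⟨_, rfl⟩))
  obtain ⟨c, rfl⟩ := Finsupp.mem_span_range_iff_exists_finsupp.1 (hle hq)
  set s := c.support with hs
  let V : Submodule ℝ E := Submodule.span ℝ (s : Set E)
  have : FiniteDimensional ℝ V := FiniteDimensional.span_finset ℝ s
  let w : s → V := fun i => ⟨i, Submodule.subset_span i.2⟩
  let A : V →ₗ[ℝ] V := ∑ i : s, c i • ((innerₛₗ ℝ (w i)).smulRight (w i))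
  have hA : ∀ φ, A φ = ∑ i : s, (c i * inner ℝ (w i) φ) • w i := by
    intro φ
    simp [A, LinearMap.sum_apply, smul_smul]
  have hsym : A.IsSymmetric := by
    intro φ ψ
    rw [hA, hA, sum_inner, inner_sum]
    refine Finset.sum_congr rfl fun i _ => ?_
    rw [real_inner_smul_left, real_inner_smul_right, real_inner_comm φ (w i)]
    ring
  let b := hsym.eigenvectorBasis rfl
  let l := hsym.eigenvalues rfl
  refine ⟨_, fun k => (b k : E), l, ?_, ?_⟩
  · exact b.orthonormal.comp_linearIsometry V.subtypeₗᵢ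
  · have hexp : ∀ i : s, B i i = ∑ k, ∑ j, (inner ℝ (b k) (w i) * inner ℝ (b j) (w i)) •
        B (b k : E) (b j : E) := by
      intro i
      have h1 : (i : E) = ∑ k, inner ℝ (b k) (w i) • (b k : E) := by
        have := congrArg (Subtype.val) (b.sum_repr' (w i))
        simpa using this.symm
      conv_lhs => rw [h1]
      simp only [map_sum, LinearMap.sum_apply, map_smul, LinearMap.smul_apply, Finset.smul_sum,
        smul_smul]
      rw [Finset.sum_comm]
      refine Finset.sum_congr rfl fun k _ => Finset.sum_congr rfl fun j _ => ?_
      rw [mul_comm]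
    have h2 : (c.sum fun i a => a • B i i) = ∑ i : s, c i • B i i := by
      rw [Finsupp.sum, ← Finset.sum_coe_sort]
    rw [h2]
    simp_rw [hexp, Finset.smul_sum, smul_smul]
    rw [Finset.sum_comm]
    refine Finset.sum_congr rfl fun k _ => ?_
    rw [Finset.sum_comm]
    have h3 : ∀ j, ∑ i : s, (c i * (inner ℝ (b k) (w i) * inner ℝ (b j) (w i))) •
        B (b k : E) (b j : E) = inner ℝ (b k) (A (b j)) • B (b k : E) (b j : E) := by
      intro j
      rw [← Finset.sum_smul, hA, inner_sum]
      congr 1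
      refine Finset.sum_congr rfl fun i _ => ?_
      rw [real_inner_smul_right, real_inner_comm (w i) (b j)]
      ring
    simp_rw [h3]
    rw [Finset.sum_eq_single k]
    · rw [hsym.apply_eigenvectorBasis]
      have : inner ℝ (b k) (b k) = 1 := by rw [real_inner_self_eq_norm_sq, b.norm_eq_one, one_pow]
      rw [RCLike.ofReal_real_eq_id, id, real_inner_smul_right, this, mul_one]
    · intro j _ hj
      rw [hsym.apply_eigenvectorBasis]
      have : inner ℝ (b k) (b j) = 0 := b.orthonormal.2 hj.symm
      rw [RCLike.ofReal_real_eq_id, id, real_inner_smul_right, this]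
      simp
    · simp

end Diagonalization

section OneDimensional

theorem integrable_fun_sub {α G : Type*} [MeasurableSpace α] [NormedAddCommGroup G] {μ : Measure α}
    {f g : α → G} (hf : Integrable f μ) (hg : Integrable g μ) :
    Integrable (fun x => f x - g x) μ := hf.sub hg

theorem norm_exp_taylor_two_le (x : ℝ) :
    ‖Complex.exp (x * Complex.I) - 1 - x * Complex.I + x ^ 2 / 2‖ ≤ 4 * |x| ^ 3 := by
  rcases le_or_gt |x| 1 with h | h
  · have := Complex.exp_bound (x := x * Complex.I) (by simpa using h) (n := 3) (by norm_num)
    simp only [Finset.sum_range_succ, Finset.sum_range_zero, Nat.factorial] at this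
    have e : Complex.exp (x * Complex.I) - 1 - x * Complex.I + x ^ 2 / 2 =
        Complex.exp (x * Complex.I) - (0 + (x * Complex.I) ^ 0 / ((1 : ℕ) : ℂ) +
        (x * Complex.I) ^ 1 / (((0 + 1) * 1 : ℕ) : ℂ) +
        (x * Complex.I) ^ 2 / (((1 + 1) * ((0 + 1) * 1) : ℕ) : ℂ)) := by
      rw [mul_pow (x : ℂ) Complex.I 2, Complex.I_sq]
      push_cast
      ring
    rw [e]
    refine this.trans ?_
    rw [norm_mul, Complex.norm_I, mul_one, Complex.norm_real, Real.norm_eq_abs, mul_comm]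
    have h0 : 0 ≤ |x| ^ 3 := by positivity
    refine mul_le_mul_of_nonneg_right ?_ h0
    norm_num
  · have h1 : ‖Complex.exp (x * Complex.I)‖ = 1 := Complex.norm_exp_ofReal_mul_I x
    have h2 : ‖Complex.exp (x * Complex.I) - 1 - x * Complex.I + x ^ 2 / 2‖ ≤
        1 + 1 + |x| + |x| ^ 2 / 2 := by
      refine (norm_add_le _ _).trans (add_le_add ((norm_sub_le _ _).trans
        (add_le_add ((norm_sub_le _ _).trans ?_) ?_)) ?_)
      · rw [h1]; simp
      · simp
      · rw [norm_div, norm_pow, Complex.norm_real]; simp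
    refine h2.trans ?_
    have h3 : |x| ≤ |x| ^ 3 := le_self_pow₀ h.le (by norm_num)
    have h4 : |x| ^ 2 ≤ |x| ^ 3 := pow_le_pow_right₀ h.le (by norm_num)
    linarith

theorem norm_prod_sub_prod_le {ι : Type*} (s : Finset ι) (a b : ι → ℂ) (ha : ∀ i ∈ s, ‖a i‖ ≤ 1)
    (hb : ∀ i ∈ s, ‖b i‖ ≤ 1) : ‖∏ i ∈ s, a i - ∏ i ∈ s, b i‖ ≤ ∑ i ∈ s, ‖a i - b i‖ := by
  classical
  induction s using Finset.induction_on with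
  | empty => simp
  | insert j s hj ih =>
    rw [Finset.prod_insert hj, Finset.prod_insert hj, Finset.sum_insert hj]
    have e : a j * ∏ i ∈ s, a i - b j * ∏ i ∈ s, b i =
        (a j - b j) * ∏ i ∈ s, a i + b j * (∏ i ∈ s, a i - ∏ i ∈ s, b i) := by ring
    have hp : ‖∏ i ∈ s, a i‖ ≤ 1 := by
      rw [norm_prod]
      exact Finset.prod_le_one (fun _ _ => norm_nonneg _)
        fun i hi => ha i (Finset.mem_insert_of_mem hi)
    have ih' := ih (fun i hi => ha i (Finset.mem_insert_of_mem hi))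
      (fun i hi => hb i (Finset.mem_insert_of_mem hi))
    rw [e]
    refine (norm_add_le _ _).trans ?_
    rw [norm_mul, norm_mul]
    refine add_le_add (mul_le_of_le_one_right (norm_nonneg _) hp) ?_
    exact (mul_le_of_le_one_left (norm_nonneg _) (hb j (Finset.mem_insert_self _ _))).trans ih'

theorem integral_exp_mul_sq_sub_one_gaussianReal {s : ℝ} (hs : s ≤ 1 / 4) :
    0 < ∫ x, Real.exp (s * (x ^ 2 - 1)) ∂(gaussianReal 0 1) ∧
    ∫ x, Real.exp (s * (x ^ 2 - 1)) ∂(gaussianReal 0 1) ≤ Real.exp (4 * s ^ 2) := by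
  have h2 : 0 < 1 - 2 * s := by linarith
  have e : ∫ x, Real.exp (s * (x ^ 2 - 1)) ∂(gaussianReal 0 1) =
      Real.exp (-s) * (√(1 - 2 * s))⁻¹ := by
    rw [integral_gaussianReal_eq_integral_smul (by norm_num)]
    have : ∀ x : ℝ, gaussianPDFReal 0 1 x • Real.exp (s * (x ^ 2 - 1)) =
        (Real.exp (-s) * (√(2 * Real.pi))⁻¹) * Real.exp (-(1 / 2 - s) * x ^ 2) := by
      intro x
      simp only [gaussianPDFReal, smul_eq_mul, NNReal.coe_one, mul_one, sub_zero]
      rw [mul_assoc, ← Real.exp_add, mul_comm (Real.exp (-s)), mul_assoc, ← Real.exp_add]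
      congr 2
      ring
    simp_rw [this]
    rw [integral_const_mul, integral_gaussian, mul_assoc]
    congr 1
    rw [← Real.sqrt_inv, ← Real.sqrt_mul (by positivity), ← Real.sqrt_inv]
    congr 1
    have : (1 / 2 - s : ℝ) ≠ 0 := by linarith
    have h3 : (1 - 2 * s) ≠ 0 := h2.ne'
    have := Real.pi_pos.ne'
    field_simp
  rw [e]
  refine ⟨by positivity, ?_⟩
  rw [← div_eq_mul_inv, div_le_iff₀ (by positivity)]
  have key : 1 ≤ (1 - 2 * s) * Real.exp (2 * s + 8 * s ^ 2) := by
    have h3 := Real.add_one_le_exp (2 * s + 8 * s ^ 2)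
    have h4 : (1 - 2 * s) * (2 * s + 8 * s ^ 2 + 1) ≤ (1 - 2 * s) * Real.exp (2 * s + 8 * s ^ 2) :=
      mul_le_mul_of_nonneg_left h3 h2.le
    nlinarith [sq_nonneg s]
  have h5 : Real.exp (-s) = Real.exp (4 * s ^ 2) * Real.exp (-s - 4 * s ^ 2) := by
    rw [← Real.exp_add]; congr 1; ring
  rw [h5]
  refine mul_le_mul_of_nonneg_left ?_ (Real.exp_pos _).le
  refine Real.le_sqrt_of_sq_le ?_
  rw [← Real.exp_nat_mul]
  have h6 : Real.exp (((2 : ℕ) : ℝ) * (-s - 4 * s ^ 2)) * Real.exp (2 * s + 8 * s ^ 2) = 1 := by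
    rw [← Real.exp_add, ← Real.exp_zero]; congr 1; push_cast; ring
  have h7 := Real.exp_pos (2 * s + 8 * s ^ 2)
  nlinarith

/-- The third absolute moment of `g² - 1` for a standard Gaussian `g`. -/
noncomputable def cubicMoment : ℝ := ∫ x, |x ^ 2 - 1| ^ 3 ∂(gaussianReal 0 1)

theorem integrable_pow_gaussianReal (n : ℕ) : Integrable (fun x : ℝ => x ^ n) (gaussianReal 0 1) := by
  have h := (memLp_id_gaussianReal' (μ := 0) (v := 1) (n : ℝ≥0∞) (by simp)).integrable_norm_pow'
  refine (integrable_norm_iff (by fun_prop)).1 (h.congr (Eventually.of_forall fun x => ?_))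
  simp

theorem norm_integral_cexp_sq_sub_one_sub_le (t : ℝ) :
    ‖∫ x, Complex.exp ((t * (x ^ 2 - 1) : ℝ) * Complex.I) ∂(gaussianReal 0 1) -
      (Real.exp (-t ^ 2) : ℂ)‖ ≤ 4 * cubicMoment * |t| ^ 3 + t ^ 4 := by
  have i1 : Integrable (fun x : ℝ => x ^ 2 - 1) (gaussianReal 0 1) :=
    (integrable_pow_gaussianReal 2).sub (integrable_const _)
  have i2 : Integrable (fun x : ℝ => (x ^ 2 - 1) ^ 2) (gaussianReal 0 1) := by
    refine (((integrable_pow_gaussianReal 4).sub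
      ((integrable_pow_gaussianReal 2).const_mul 2)).add (integrable_const 1)).congr
      (Eventually.of_forall fun x => ?_)
    simp; ring
  have i3 : Integrable (fun x : ℝ => |x ^ 2 - 1| ^ 3) (gaussianReal 0 1) := by
    have : Integrable (fun x : ℝ => (x ^ 2 - 1) ^ 3) (gaussianReal 0 1) := by
      refine ((((integrable_pow_gaussianReal 6).sub
        ((integrable_pow_gaussianReal 4).const_mul 3)).add
        ((integrable_pow_gaussianReal 2).const_mul 3)).sub (integrable_const 1)).congr
        (Eventually.of_forall fun x => ?_)
      simp; ring
    refine this.norm.congr (Eventually.of_forall fun x => ?_)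
    simp
  have m1 : ∫ x : ℝ, x ^ 2 ∂(gaussianReal 0 1) = 1 := by
    have h := variance_id_gaussianReal (μ := 0) (v := 1)
    rw [variance_of_integral_eq_zero aemeasurable_id (by simp)] at h
    simpa using h
  have m2 : ∫ x : ℝ, x ^ 4 ∂(gaussianReal 0 1) = 3 := by
    rw [integral_pow_four_gaussianReal]; simp
  have e1 : ∫ x : ℝ, (x ^ 2 - 1) ∂(gaussianReal 0 1) = 0 := by
    rw [integral_sub (integrable_pow_gaussianReal 2) (integrable_const _), m1]; simp
  have e2 : ∫ x : ℝ, (x ^ 2 - 1) ^ 2 ∂(gaussianReal 0 1) = 2 := by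
    have : ∀ x : ℝ, (x ^ 2 - 1) ^ 2 = x ^ 4 - 2 * x ^ 2 + 1 := fun x => by ring
    simp_rw [this]
    rw [integral_add (integrable_fun_sub (integrable_pow_gaussianReal 4)
      ((integrable_pow_gaussianReal 2).const_mul 2)) (integrable_const _),
      integral_sub (integrable_pow_gaussianReal 4) ((integrable_pow_gaussianReal 2).const_mul 2),
      integral_const_mul, m1, m2]
    norm_num
  have iexp : Integrable (fun x : ℝ => Complex.exp ((t * (x ^ 2 - 1) : ℝ) * Complex.I))
      (gaussianReal 0 1) := by
    refine Integrable.of_bound (by fun_prop) 1 (Eventually.of_forall fun x => ?_)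
    rw [Complex.norm_exp_ofReal_mul_I]
  have j1 : Integrable (fun x : ℝ => ((t * (x ^ 2 - 1) : ℝ) : ℂ) * Complex.I) (gaussianReal 0 1) :=
    (i1.const_mul t).ofReal.mul_const _
  have j2 : Integrable (fun x : ℝ => ((t * (x ^ 2 - 1) : ℝ) : ℂ) ^ 2 / 2) (gaussianReal 0 1) := by
    refine ((i2.const_mul (t ^ 2 / 2)).ofReal (𝕜 := ℂ)).congr (Eventually.of_forall fun x => ?_)
    simp
    ring
  have v1 : ∫ x : ℝ, ((t * (x ^ 2 - 1) : ℝ) : ℂ) * Complex.I ∂(gaussianReal 0 1) = 0 := by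
    rw [integral_mul_const, integral_complex_ofReal, integral_const_mul, e1]; simp
  have v2 : ∫ x : ℝ, ((t * (x ^ 2 - 1) : ℝ) : ℂ) ^ 2 / 2 ∂(gaussianReal 0 1) = (t : ℂ) ^ 2 := by
    have : ∀ x : ℝ, ((t * (x ^ 2 - 1) : ℝ) : ℂ) ^ 2 / 2 = ((t ^ 2 / 2 * (x ^ 2 - 1) ^ 2 : ℝ) : ℂ) := by
      intro x; push_cast; ring
    simp_rw [this]
    rw [integral_complex_ofReal, integral_const_mul, e2]; push_cast; ring
  have key : ∫ x : ℝ, (Complex.exp ((t * (x ^ 2 - 1) : ℝ) * Complex.I) - 1 -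
      ((t * (x ^ 2 - 1) : ℝ) : ℂ) * Complex.I + ((t * (x ^ 2 - 1) : ℝ) : ℂ) ^ 2 / 2)
      ∂(gaussianReal 0 1) = ∫ x, Complex.exp ((t * (x ^ 2 - 1) : ℝ) * Complex.I) ∂(gaussianReal 0 1)
      - 1 + t ^ 2 := by
    rw [integral_add (integrable_fun_sub (integrable_fun_sub iexp (integrable_const _)) j1) j2,
      integral_sub (integrable_fun_sub iexp (integrable_const _)) j1, integral_sub iexp (integrable_const _), v1, v2]
    simp
  have b1 : ‖∫ x, Complex.exp ((t * (x ^ 2 - 1) : ℝ) * Complex.I) ∂(gaussianReal 0 1)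
      - 1 + t ^ 2‖ ≤ 4 * cubicMoment * |t| ^ 3 := by
    rw [← key]
    refine (norm_integral_le_of_norm_le (i3.const_mul (4 * |t| ^ 3))
      (Eventually.of_forall fun x => ?_)).trans_eq ?_
    · refine (norm_exp_taylor_two_le _).trans_eq ?_
      rw [abs_mul, mul_pow, mul_assoc]
    · rw [integral_const_mul, cubicMoment]; ring
  have b2 : |Real.exp (-t ^ 2) - 1 + t ^ 2| ≤ t ^ 4 := by
    have h1 := Real.add_one_le_exp (-t ^ 2)
    rw [abs_of_nonneg (by linarith)]
    rcases le_or_gt (t ^ 2) 1 with h | h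
    · have := Real.abs_exp_sub_one_sub_id_le (x := -t ^ 2) (by rw [abs_neg, abs_of_nonneg (sq_nonneg t)]; exact h)
      have h3 := (le_abs_self _).trans this
      nlinarith
    · have : Real.exp (-t ^ 2) ≤ 1 := Real.exp_le_one_iff.2 (by nlinarith)
      nlinarith
  have e : ∫ x, Complex.exp ((t * (x ^ 2 - 1) : ℝ) * Complex.I) ∂(gaussianReal 0 1) -
      (Real.exp (-t ^ 2) : ℂ) = (∫ x, Complex.exp ((t * (x ^ 2 - 1) : ℝ) * Complex.I)
      ∂(gaussianReal 0 1) - 1 + t ^ 2) - ((Real.exp (-t ^ 2) - 1 + t ^ 2 : ℝ) : ℂ) := by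
    push_cast; ring
  rw [e]
  refine (norm_sub_le _ _).trans (add_le_add b1 ?_)
  rw [Complex.norm_real]
  exact b2

end OneDimensional

end Correlogram

namespace Correlogram

section SecondChaos

variable {Ω : Type*} [MeasurableSpace Ω] {P : Measure Ω} [IsProbabilityMeasure P]

namespace IsGaussianSubspace

variable {S : Submodule ℝ (Lp ℝ 2 P)}

/-- The Wick product `:uv: = uv - E[uv]` of two elements of a Gaussian subspace. -/
noncomputable def wickFun (hS : IsGaussianSubspace S) (u v : S) : Lp ℝ 2 P :=
  ((hS.memLp_mul u v).sub (memLp_const (inner ℝ u v))).toLp _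

theorem coeFn_wickFun (hS : IsGaussianSubspace S) (u v : S) :
    hS.wickFun u v =ᵐ[P] fun ω => (u : Lp ℝ 2 P) ω * (v : Lp ℝ 2 P) ω - inner ℝ u v :=
  MemLp.coeFn_toLp _

theorem inner_wickFun (hS : IsGaussianSubspace S) (u v w z : S) :
    inner ℝ (hS.wickFun u v) (hS.wickFun w z) =
      inner ℝ u w * inner ℝ v z + inner ℝ u z * inner ℝ v w := by
  have i1 : Integrable (fun ω => (u : Lp ℝ 2 P) ω * (v : Lp ℝ 2 P) ω) P :=
    (hS.memLp_mul u v).integrable (by norm_num)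
  have i2 : Integrable (fun ω => (w : Lp ℝ 2 P) ω * (z : Lp ℝ 2 P) ω) P :=
    (hS.memLp_mul w z).integrable (by norm_num)
  have h1 : inner ℝ (hS.wickFun u v) (hS.wickFun w z) =
      ∫ ω, (((u : Lp ℝ 2 P) ω * (v : Lp ℝ 2 P) ω * ((w : Lp ℝ 2 P) ω * (z : Lp ℝ 2 P) ω) -
        inner ℝ w z * ((u : Lp ℝ 2 P) ω * (v : Lp ℝ 2 P) ω)) -
        inner ℝ u v * ((w : Lp ℝ 2 P) ω * (z : Lp ℝ 2 P) ω)) + inner ℝ u v * inner ℝ w z ∂P := by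
    rw [L2.inner_def]
    refine integral_congr_ae ?_
    filter_upwards [hS.coeFn_wickFun u v, hS.coeFn_wickFun w z] with ω h1 h2
    rw [h1, h2]
    simp only [RCLike.inner_apply, conj_trivial]
    ring
  rw [h1, integral_add (integrable_fun_sub (integrable_fun_sub (hS.integrable_mul_mul u v w z)
    (i1.const_mul _)) (i2.const_mul _)) (integrable_const _),
    integral_sub (integrable_fun_sub (hS.integrable_mul_mul u v w z)
    (i1.const_mul _)) (i2.const_mul _), integral_sub (hS.integrable_mul_mul u v w z)
    (i1.const_mul _), integral_const_mul, integral_const_mul, hS.integral_mul_four,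
    ← inner_eq_integral, ← inner_eq_integral]
  simp
  ring

theorem norm_wickFun_le (hS : IsGaussianSubspace S) (u v : S) :
    ‖hS.wickFun u v‖ ≤ 2 * ‖u‖ * ‖v‖ := by
  refine abs_le_of_sq_le_sq' ?_ (by positivity) |>.2
  rw [← real_inner_self_eq_norm_sq, inner_wickFun]
  have h := real_inner_mul_inner_self_le u v
  have h2 : inner ℝ u v * inner ℝ v u ≤ inner ℝ u u * inner ℝ v v := by
    rw [real_inner_comm u v]; exact h
  have h3 : (inner ℝ u u : ℝ) * inner ℝ v v = (‖u‖ * ‖v‖) ^ 2 := by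
    rw [real_inner_self_eq_norm_sq, real_inner_self_eq_norm_sq, mul_pow]
  nlinarith [sq_nonneg (‖u‖ * ‖v‖)]

theorem wickFun_comm (hS : IsGaussianSubspace S) (u v : S) : hS.wickFun u v = hS.wickFun v u := by
  refine Lp.ext ?_
  filter_upwards [hS.coeFn_wickFun u v, hS.coeFn_wickFun v u] with ω h1 h2
  rw [h1, h2, mul_comm, real_inner_comm]

theorem inner_add_left_aux {E : Type*} [NormedAddCommGroup E] [InnerProductSpace ℝ E] (u u' v : E) :
    inner ℝ (u + u') v = inner ℝ u v + inner ℝ u' v := inner_add_left _ _ _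

theorem inner_smul_left_aux {E : Type*} [NormedAddCommGroup E] [InnerProductSpace ℝ E] (r : ℝ)
    (u v : E) : inner ℝ (r • u) v = r * inner ℝ u v := real_inner_smul_left _ _ _

theorem wickFun_add_left (hS : IsGaussianSubspace S) (u u' v : S) :
    hS.wickFun (u + u') v = hS.wickFun u v + hS.wickFun u' v := by
  refine Lp.ext ?_
  have hi := inner_add_left_aux u u' v
  filter_upwards [hS.coeFn_wickFun (u + u') v, hS.coeFn_wickFun u v, hS.coeFn_wickFun u' v,
    Lp.coeFn_add (u : Lp ℝ 2 P) (u' : Lp ℝ 2 P), Lp.coeFn_add (hS.wickFun u v) (hS.wickFun u' v)]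
    with ω h1 h2 h3 h4 h5
  rw [h1, h5, Pi.add_apply, h2, h3, Submodule.coe_add, h4, Pi.add_apply]
  rw [show (inner ℝ (u + u') v : ℝ) = _ from hi]
  ring

theorem wickFun_smul_left (hS : IsGaussianSubspace S) (r : ℝ) (u v : S) :
    hS.wickFun (r • u) v = r • hS.wickFun u v := by
  refine Lp.ext ?_
  have hi := inner_smul_left_aux r u v
  filter_upwards [hS.coeFn_wickFun (r • u) v, hS.coeFn_wickFun u v,
    Lp.coeFn_smul r (u : Lp ℝ 2 P), Lp.coeFn_smul r (hS.wickFun u v)] with ω h1 h2 h4 h5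
  rw [h1, h5, Pi.smul_apply, h2, Submodule.coe_smul, h4, Pi.smul_apply]
  rw [show (inner ℝ (r • u) v : ℝ) = _ from hi]
  simp only [smul_eq_mul]
  ring

/-- The Wick product as a bilinear map. -/
noncomputable def wickₗ (hS : IsGaussianSubspace S) : S →ₗ[ℝ] S →ₗ[ℝ] Lp ℝ 2 P :=
  LinearMap.mk₂ ℝ hS.wickFun hS.wickFun_add_left hS.wickFun_smul_left
    (fun u v v' => by
      rw [hS.wickFun_comm, hS.wickFun_add_left, hS.wickFun_comm v, hS.wickFun_comm v'])
    (fun r u v => by rw [hS.wickFun_comm, hS.wickFun_smul_left, hS.wickFun_comm v])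

/-- The Wick product as a continuous bilinear map. -/
noncomputable def wick (hS : IsGaussianSubspace S) : S →L[ℝ] S →L[ℝ] Lp ℝ 2 P :=
  hS.wickₗ.mkContinuous₂ 2 hS.norm_wickFun_le

theorem coeFn_wick (hS : IsGaussianSubspace S) (u v : S) :
    hS.wick u v =ᵐ[P] fun ω => (u : Lp ℝ 2 P) ω * (v : Lp ℝ 2 P) ω - inner ℝ u v :=
  hS.coeFn_wickFun u v

theorem inner_wick (hS : IsGaussianSubspace S) (u v w z : S) :
    inner ℝ (hS.wick u v) (hS.wick w z) =
      inner ℝ u w * inner ℝ v z + inner ℝ u z * inner ℝ v w :=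
  hS.inner_wickFun u v w z

theorem norm_wick_le (hS : IsGaussianSubspace S) (u v : S) : ‖hS.wick u v‖ ≤ 2 * ‖u‖ * ‖v‖ :=
  hS.norm_wickFun_le u v

/-- The linear span of the Wick products. -/
noncomputable def wickSpan (hS : IsGaussianSubspace S) : Submodule ℝ (Lp ℝ 2 P) :=
  Submodule.span ℝ (Set.range fun p : S × S => hS.wick p.1 p.2)

theorem exists_diagonal (hS : IsGaussianSubspace S) {q : Lp ℝ 2 P} (hq : q ∈ hS.wickSpan) :
    ∃ (n : ℕ) (e : Fin n → S) (l : Fin n → ℝ), Orthonormal ℝ e ∧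
      q = ∑ k, l k • hS.wick (e k) (e k) :=
  exists_orthonormal_sum_eq hS.wickₗ hS.wickFun_comm hq

section Diagonal

variable {n : ℕ} {e : Fin n → S} {l : Fin n → ℝ}

theorem map_orthonormal (hS : IsGaussianSubspace S) (he : Orthonormal ℝ e) (k : Fin n) :
    P.map (e k : Lp ℝ 2 P) = gaussianReal 0 1 := by
  rw [hS _ (e k).2]
  congr
  ext
  have := he.1 k
  have h1 : ‖(e k : Lp ℝ 2 P)‖ = 1 := this
  simp [h1]

theorem iIndepFun_orthonormal (hS : IsGaussianSubspace S) (he : Orthonormal ℝ e) :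
    iIndepFun (fun k ω => (e k : Lp ℝ 2 P) ω) P := by
  refine (hS.hasGaussianLaw_pi e).iIndepFun_of_covariance_eq_zero fun i j hij => ?_
  exact (hS.covariance_eq_inner _ _).trans (he.2 hij)

theorem coeFn_diagonal (hS : IsGaussianSubspace S) (he : Orthonormal ℝ e) :
    (∑ k, l k • hS.wick (e k) (e k) : Lp ℝ 2 P) =ᵐ[P]
      fun ω => ∑ k, l k * ((e k : Lp ℝ 2 P) ω ^ 2 - 1) := by
  refine (coeFn_finset_sum_smul _ l _).trans ?_
  have : ∀ᵐ ω ∂P, ∀ k, hS.wick (e k) (e k) ω = (e k : Lp ℝ 2 P) ω ^ 2 - 1 := by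
    rw [ae_all_iff]
    intro k
    filter_upwards [hS.coeFn_wick (e k) (e k)] with ω h
    have h1 : inner ℝ (e k) (e k) = (1 : ℝ) := by
      rw [real_inner_self_eq_norm_sq, he.1 k, one_pow]
    rw [h, h1, sq]
  filter_upwards [this] with ω h
  simp_rw [h]

theorem inner_diagonal (hS : IsGaussianSubspace S) (he : Orthonormal ℝ e) (k : Fin n) :
    inner ℝ (∑ k, l k • hS.wick (e k) (e k)) (hS.wick (e k) (e k)) = 2 * l k := by
  rw [sum_inner, Finset.sum_eq_single k]
  · have h1 : inner ℝ (e k) (e k) = (1 : ℝ) := by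
      rw [real_inner_self_eq_norm_sq, he.1 k, one_pow]
    rw [real_inner_smul_left, inner_wick, h1]
    ring
  · intro j _ hj
    rw [real_inner_smul_left, inner_wick, show (inner ℝ (e j) (e k) : ℝ) = 0 from he.2 hj]
    ring
  · simp

theorem norm_sq_diagonal (hS : IsGaussianSubspace S) (he : Orthonormal ℝ e) :
    ‖∑ k, l k • hS.wick (e k) (e k)‖ ^ 2 = 2 * ∑ k, l k ^ 2 := by
  rw [← real_inner_self_eq_norm_sq]
  conv_lhs => rw [inner_sum]
  rw [Finset.mul_sum]
  refine Finset.sum_congr rfl fun k _ => ?_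
  rw [real_inner_smul_right, hS.inner_diagonal he]
  ring

end Diagonal

theorem integral_exp_mul_le (hS : IsGaussianSubspace S) {q : Lp ℝ 2 P} (hq : q ∈ hS.wickSpan)
    {s : ℝ} (hs : |s| * ‖q‖ ≤ 1 / 4) :
    Integrable (fun ω => Real.exp (s * q ω)) P ∧
      ∫ ω, Real.exp (s * q ω) ∂P ≤ Real.exp (2 * s ^ 2 * ‖q‖ ^ 2) := by
  obtain ⟨n, e, l, he, rfl⟩ := hS.exists_diagonal hq
  set q := ∑ k, l k • hS.wick (e k) (e k) with hqdef
  have hl : ∀ k, s * l k ≤ 1 / 4 := by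
    intro k
    have h1 : l k ^ 2 ≤ ‖q‖ ^ 2 := by
      rw [hqdef, hS.norm_sq_diagonal he]
      have := Finset.single_le_sum (fun i _ => sq_nonneg (l i)) (Finset.mem_univ k)
      have h0 : 0 ≤ ∑ i, l i ^ 2 := Finset.sum_nonneg fun i _ => sq_nonneg (l i)
      linarith
    have h2 : |l k| ≤ ‖q‖ := abs_le_of_sq_le_sq h1 (norm_nonneg _)
    calc s * l k ≤ |s * l k| := le_abs_self _
      _ = |s| * |l k| := abs_mul _ _
      _ ≤ |s| * ‖q‖ := by gcongr
      _ ≤ _ := hs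
  have hae : (fun ω => Real.exp (s * q ω)) =ᵐ[P]
      fun ω => ∏ k, Real.exp (s * l k * ((e k : Lp ℝ 2 P) ω ^ 2 - 1)) := by
    filter_upwards [hS.coeFn_diagonal (l := l) he] with ω h
    rw [← Real.exp_sum, hqdef, h, Finset.mul_sum]
    simp_rw [mul_assoc]
  have hm : ∀ k, Measurable fun x : ℝ => Real.exp (s * l k * (x ^ 2 - 1)) := fun k => by fun_prop
  have hprod : ∫ ω, Real.exp (s * q ω) ∂P =
      ∏ k, ∫ x, Real.exp (s * l k * (x ^ 2 - 1)) ∂(gaussianReal 0 1) := by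
    rw [integral_congr_ae hae]
    refine ((hS.iIndepFun_orthonormal he).integral_fun_prod_comp (𝕜 := ℝ)
      (f := fun k x => Real.exp (s * l k * (x ^ 2 - 1))) (fun k => aemeasurable_Lp _)
      fun k => (hm k).aestronglyMeasurable).trans ?_
    refine Finset.prod_congr rfl fun k _ => ?_
    rw [← hS.map_orthonormal he k, integral_map (aemeasurable_Lp _) (hm k).aestronglyMeasurable]
  have hpos : 0 < ∫ ω, Real.exp (s * q ω) ∂P := by
    rw [hprod]
    exact Finset.prod_pos fun k _ => (integral_exp_mul_sq_sub_one_gaussianReal (hl k)).1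
  refine ⟨not_imp_comm.1 integral_undef hpos.ne', ?_⟩
  rw [hprod]
  refine (Finset.prod_le_prod (fun k _ => (integral_exp_mul_sq_sub_one_gaussianReal (hl k)).1.le)
    fun k _ => (integral_exp_mul_sq_sub_one_gaussianReal (hl k)).2).trans_eq ?_
  rw [← Real.exp_sum, hqdef, hS.norm_sq_diagonal he, Finset.mul_sum, Finset.mul_sum]
  congr 1
  refine Finset.sum_congr rfl fun k _ => ?_
  ring

theorem lintegral_exp_abs_le_four {q : Lp ℝ 2 P} {r : ℝ}
    (hb : ∀ s : ℝ, |s| = 1 / r → ∫⁻ ω, ENNReal.ofReal (Real.exp (s * q ω)) ∂P ≤ 2) (hr : 0 < r) :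
    ∫⁻ ω, ENNReal.ofReal (Real.exp (|q ω| / r)) ∂P ≤ 4 := by
  have hm : AEMeasurable (fun ω => ENNReal.ofReal (Real.exp (1 / r * q ω))) P := by
    have := aemeasurable_Lp q
    fun_prop
  calc ∫⁻ ω, ENNReal.ofReal (Real.exp (|q ω| / r)) ∂P
      ≤ ∫⁻ ω, (ENNReal.ofReal (Real.exp (1 / r * q ω)) +
          ENNReal.ofReal (Real.exp (-(1 / r) * q ω))) ∂P := by
        refine lintegral_mono fun ω => ?_
        rw [← ENNReal.ofReal_add (Real.exp_pos _).le (Real.exp_pos _).le]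
        refine ENNReal.ofReal_le_ofReal ?_
        have p1 := Real.exp_pos (1 / r * q ω)
        have p2 := Real.exp_pos (-(1 / r) * q ω)
        rcases abs_cases (q ω) with ⟨ha, _⟩ | ⟨ha, _⟩
        · rw [ha, show q ω / r = 1 / r * q ω by ring]; linarith
        · rw [ha, show -q ω / r = -(1 / r) * q ω by ring]; linarith
    _ ≤ 2 + 2 := by
        rw [lintegral_add_left' hm]
        exact add_le_add (hb _ (by rw [abs_of_pos]; positivity))
          (hb _ (by rw [abs_neg, abs_of_pos]; positivity))
    _ = 4 := by norm_num

theorem lintegral_exp_abs_le_of_mem_span (hS : IsGaussianSubspace S) {q : Lp ℝ 2 P}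
    (hq : q ∈ hS.wickSpan) {r : ℝ} (hr : 0 < r) (h : 4 * ‖q‖ ≤ r) :
    ∫⁻ ω, ENNReal.ofReal (Real.exp (|q ω| / r)) ∂P ≤ 4 := by
  have hb : ∀ s : ℝ, |s| = 1 / r → ∫⁻ ω, ENNReal.ofReal (Real.exp (s * q ω)) ∂P ≤ 2 := by
    intro s hs
    have h1 : |s| * ‖q‖ ≤ 1 / 4 := by
      rw [hs, div_mul_eq_mul_div, div_le_div_iff₀ hr (by norm_num)]
      linarith
    obtain ⟨h2, h3⟩ := hS.integral_exp_mul_le hq h1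
    rw [← ofReal_integral_eq_lintegral_ofReal h2 (Eventually.of_forall fun _ => (Real.exp_pos _).le)]
    have h4 : Real.exp (2 * s ^ 2 * ‖q‖ ^ 2) ≤ 2 := by
      have : s ^ 2 * ‖q‖ ^ 2 ≤ (1 / 4) ^ 2 := by
        rw [← sq_abs s, ← mul_pow]
        exact pow_le_pow_left₀ (by positivity) h1 2
      have h5 : Real.exp (2 * s ^ 2 * ‖q‖ ^ 2) ≤ Real.exp (1 / 8) := by
        apply Real.exp_le_exp.2; linarith
      have h6 := Real.exp_bound_div_one_sub_of_interval (x := 1 / 8) (by norm_num) (by norm_num)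
      refine h5.trans (h6.trans (by norm_num))
    exact (ENNReal.ofReal_le_ofReal (h3.trans h4)).trans (by simp)
  exact lintegral_exp_abs_le_four hb hr

/-- Elements of the second chaos have exponential tails. -/
theorem lintegral_exp_abs_le (hS : IsGaussianSubspace S) {q : Lp ℝ 2 P}
    (hq : q ∈ hS.wickSpan.topologicalClosure) {r : ℝ} (hr : 0 < r) (h : 8 * ‖q‖ ≤ r) :
    ∫⁻ ω, ENNReal.ofReal (Real.exp (|q ω| / r)) ∂P ≤ 4 := by
  obtain ⟨w, hw, hlim⟩ := mem_closure_iff_seq_limit.1 hq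
  have hnorm : ∀ᶠ n in atTop, 4 * ‖w n‖ ≤ r := by
    have h1 : Tendsto (fun n => 4 * ‖w n‖) atTop (𝓝 (4 * ‖q‖)) := hlim.norm.const_mul 4
    have h2 : 4 * ‖q‖ < r := by
      rcases eq_or_lt_of_le (norm_nonneg q) with h0 | h0
      · rw [← h0]; simpa using hr
      · linarith
    exact h1.eventually_le_const h2
  have hmeas : TendstoInMeasure P (fun n => (w n : Ω → ℝ)) atTop q := by
    refine tendstoInMeasure_of_tendsto_Lp hlim
  obtain ⟨ns, hns, hae⟩ := hmeas.exists_seq_tendsto_ae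
  have hev : ∀ᶠ n in atTop, ∫⁻ ω, ENNReal.ofReal (Real.exp (|w (ns n) ω| / r)) ∂P ≤ 4 := by
    filter_upwards [hns.tendsto_atTop.eventually hnorm] with n hn
    exact hS.lintegral_exp_abs_le_of_mem_span (hw _) hr hn
  calc ∫⁻ ω, ENNReal.ofReal (Real.exp (|q ω| / r)) ∂P
      = ∫⁻ ω, liminf (fun n => ENNReal.ofReal (Real.exp (|w (ns n) ω| / r))) atTop ∂P := by
        refine lintegral_congr_ae ?_
        filter_upwards [hae] with ω hω
        refine (Tendsto.liminf_eq ?_).symm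
        exact ENNReal.tendsto_ofReal ((Real.continuous_exp.tendsto _).comp (hω.abs.div_const r))
    _ ≤ liminf (fun n => ∫⁻ ω, ENNReal.ofReal (Real.exp (|w (ns n) ω| / r)) ∂P) atTop :=
        lintegral_liminf_le' fun n => by
          have := aemeasurable_Lp (w (ns n))
          fun_prop
    _ ≤ 4 := liminf_le_of_frequently_le' hev.frequently

theorem norm_integral_cexp_sub_le_of_mem_span (hS : IsGaussianSubspace S) {q : Lp ℝ 2 P}
    (hq : q ∈ hS.wickSpan) {κ : ℝ} (hκ : ∀ φ : S, |inner ℝ q (hS.wick φ φ)| ≤ 2 * κ * ‖φ‖ ^ 2)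
    (θ : ℝ) :
    ‖∫ ω, Complex.exp (θ * q ω * Complex.I) ∂P - Complex.exp (-(θ ^ 2 * (‖q‖ : ℂ) ^ 2 / 2))‖ ≤
      (4 * cubicMoment * |θ| ^ 3 * κ + θ ^ 4 * κ ^ 2) * ‖q‖ ^ 2 / 2 := by
  obtain ⟨n, e, l, he, rfl⟩ := hS.exists_diagonal hq
  set q := ∑ k, l k • hS.wick (e k) (e k) with hqdef
  have hl : ∀ k, |l k| ≤ κ := by
    intro k
    have h1 := hκ (e k)
    rw [hqdef, hS.inner_diagonal he, he.1 k, abs_mul] at h1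
    norm_num at h1
    exact h1
  have hcm : 0 ≤ cubicMoment := integral_nonneg fun x => by positivity
  have hm : ∀ k, Measurable fun x : ℝ => Complex.exp ((θ * l k * (x ^ 2 - 1) : ℝ) * Complex.I) :=
    fun k => by fun_prop
  have hprod : ∫ ω, Complex.exp (θ * q ω * Complex.I) ∂P =
      ∏ k, ∫ x, Complex.exp ((θ * l k * (x ^ 2 - 1) : ℝ) * Complex.I) ∂(gaussianReal 0 1) := by
    have hae : (fun ω => Complex.exp (θ * q ω * Complex.I)) =ᵐ[P]
        fun ω => ∏ k, Complex.exp ((θ * l k * ((e k : Lp ℝ 2 P) ω ^ 2 - 1) : ℝ) * Complex.I) := by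
      filter_upwards [hS.coeFn_diagonal (l := l) he] with ω h
      rw [← Complex.exp_sum, hqdef, h, ← Finset.sum_mul]
      congr 2
      push_cast
      rw [Finset.mul_sum]
      simp_rw [mul_assoc]
    rw [integral_congr_ae hae]
    refine ((hS.iIndepFun_orthonormal he).integral_fun_prod_comp (𝕜 := ℂ)
      (f := fun k x => Complex.exp ((θ * l k * (x ^ 2 - 1) : ℝ) * Complex.I))
      (fun k => aemeasurable_Lp _) fun k => (hm k).aestronglyMeasurable).trans ?_
    refine Finset.prod_congr rfl fun k _ => ?_
    rw [← hS.map_orthonormal he k, integral_map (aemeasurable_Lp _) (hm k).aestronglyMeasurable]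
  have hexp : Complex.exp (-(θ ^ 2 * (‖q‖ : ℂ) ^ 2 / 2)) =
      ∏ k, ((Real.exp (-(θ * l k) ^ 2) : ℝ) : ℂ) := by
    have h1 : -(θ ^ 2 * (‖q‖ : ℂ) ^ 2 / 2) = ((∑ k, -(θ * l k) ^ 2 : ℝ) : ℂ) := by
      rw [← Complex.ofReal_pow ‖q‖, hqdef, hS.norm_sq_diagonal he]
      push_cast
      rw [Finset.mul_sum, Finset.mul_sum, Finset.sum_div, ← Finset.sum_neg_distrib]
      refine Finset.sum_congr rfl fun k _ => ?_
      ring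
    rw [h1, ← Complex.ofReal_exp, Real.exp_sum]
    push_cast
    rfl
  rw [hprod, hexp]
  refine (norm_prod_sub_prod_le _ _ _ (fun k _ => ?_) fun k _ => ?_).trans ?_
  · refine (norm_integral_le_integral_norm _).trans ?_
    simp_rw [Complex.norm_exp_ofReal_mul_I]
    simp
  · rw [Complex.norm_real, Real.norm_eq_abs, abs_of_pos (Real.exp_pos _)]
    exact Real.exp_le_one_iff.2 (by nlinarith [sq_nonneg (θ * l k)])
  · have hsum : (4 * cubicMoment * |θ| ^ 3 * κ + θ ^ 4 * κ ^ 2) * ‖q‖ ^ 2 / 2 =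
        ∑ k, (4 * cubicMoment * |θ| ^ 3 * κ + θ ^ 4 * κ ^ 2) * l k ^ 2 := by
      rw [hqdef, hS.norm_sq_diagonal he, ← Finset.mul_sum]
      ring
    rw [hsum]
    refine Finset.sum_le_sum fun k _ => ?_
    refine (norm_integral_cexp_sq_sub_one_sub_le (θ * l k)).trans ?_
    have h2 : |l k| ^ 2 = l k ^ 2 := sq_abs _
    have h3 : l k ^ 2 ≤ κ ^ 2 := by rw [← h2]; exact pow_le_pow_left₀ (abs_nonneg _) (hl k) 2
    have h4 : |θ * l k| ^ 3 ≤ |θ| ^ 3 * (κ * l k ^ 2) := by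
      rw [abs_mul, mul_pow]
      refine mul_le_mul_of_nonneg_left ?_ (by positivity)
      calc |l k| ^ 3 = |l k| * |l k| ^ 2 := by ring
        _ ≤ κ * l k ^ 2 := by rw [h2]; exact mul_le_mul_of_nonneg_right (hl k) (sq_nonneg _)
    have h5 : (θ * l k) ^ 4 ≤ θ ^ 4 * (κ ^ 2 * l k ^ 2) := by
      rw [mul_pow]
      refine mul_le_mul_of_nonneg_left ?_ (by positivity)
      calc l k ^ 4 = l k ^ 2 * l k ^ 2 := by ring
        _ ≤ _ := mul_le_mul_of_nonneg_right h3 (sq_nonneg _)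
    have h6 := mul_le_mul_of_nonneg_left h4 (by positivity : 0 ≤ 4 * cubicMoment)
    calc _ ≤ 4 * cubicMoment * (|θ| ^ 3 * (κ * l k ^ 2)) + θ ^ 4 * (κ ^ 2 * l k ^ 2) :=
          add_le_add h6 h5
      _ = _ := by ring

/-- A quantitative central limit theorem in the second chaos. -/
theorem norm_integral_cexp_sub_le (hS : IsGaussianSubspace S) {q : Lp ℝ 2 P}
    (hq : q ∈ hS.wickSpan.topologicalClosure) {κ : ℝ}
    (hκ : ∀ φ : S, |inner ℝ q (hS.wick φ φ)| ≤ 2 * κ * ‖φ‖ ^ 2) (θ : ℝ) :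
    ‖∫ ω, Complex.exp (θ * q ω * Complex.I) ∂P - Complex.exp (-(θ ^ 2 * (‖q‖ : ℂ) ^ 2 / 2))‖ ≤
      (4 * cubicMoment * |θ| ^ 3 * κ + θ ^ 4 * κ ^ 2) * ‖q‖ ^ 2 / 2 := by
  have hclosed : IsClosed {w : Lp ℝ 2 P | ‖∫ ω, Complex.exp (θ * w ω * Complex.I) ∂P -
      Complex.exp (-(θ ^ 2 * (‖w‖ : ℂ) ^ 2 / 2))‖ ≤ (4 * cubicMoment * |θ| ^ 3 * (κ + ‖w - q‖) +
        θ ^ 4 * (κ + ‖w - q‖) ^ 2) * ‖w‖ ^ 2 / 2} := by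
    refine isClosed_le ((continuous_integral_cexp θ).sub ?_).norm ?_
    · fun_prop
    · fun_prop
  have hsub : (hS.wickSpan : Set (Lp ℝ 2 P)) ⊆ {w : Lp ℝ 2 P |
      ‖∫ ω, Complex.exp (θ * w ω * Complex.I) ∂P -
      Complex.exp (-(θ ^ 2 * (‖w‖ : ℂ) ^ 2 / 2))‖ ≤ (4 * cubicMoment * |θ| ^ 3 * (κ + ‖w - q‖) +
        θ ^ 4 * (κ + ‖w - q‖) ^ 2) * ‖w‖ ^ 2 / 2} := by
    intro w hw
    refine hS.norm_integral_cexp_sub_le_of_mem_span hw (fun φ => ?_) θ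
    have e : inner ℝ w (hS.wick φ φ) = inner ℝ q (hS.wick φ φ) + inner ℝ (w - q) (hS.wick φ φ) := by
      rw [inner_sub_left]; ring
    have h1 : |inner ℝ (w - q) (hS.wick φ φ)| ≤ ‖w - q‖ * (2 * ‖φ‖ * ‖φ‖) :=
      (abs_real_inner_le_norm _ _).trans
        (mul_le_mul_of_nonneg_left (hS.norm_wick_le φ φ) (norm_nonneg _))
    rw [e]
    refine (abs_add_le _ _).trans ((add_le_add (hκ φ) h1).trans_eq ?_)
    ring
  have hmem := hclosed.closure_subset_iff.2 hsub hq
  rw [Set.mem_ofPred_eq] at hmem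
  simpa using hmem

/-- Elements of a Gaussian subspace have exponential tails. -/
theorem lintegral_exp_abs_le_of_mem (hS : IsGaussianSubspace S) {u : Lp ℝ 2 P}
    (hu : u ∈ S) {r : ℝ} (hr : 0 < r) (h : ‖u‖ ≤ r) :
    ∫⁻ ω, ENNReal.ofReal (Real.exp (|u ω| / r)) ∂P ≤ 4 := by
  have hb : ∀ s : ℝ, |s| = 1 / r → ∫⁻ ω, ENNReal.ofReal (Real.exp (s * u ω)) ∂P ≤ 2 := by
    intro s hs
    have h2 : mgf u P s = Real.exp (‖u‖ ^ 2 * s ^ 2 / 2) := by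
      have := mgf_gaussianReal (hS u hu) s
      rw [this]
      simp
    have h0 : 0 < mgf u P s := by rw [h2]; exact Real.exp_pos _
    have hint : Integrable (fun ω => Real.exp (s * u ω)) P := not_imp_comm.1 integral_undef h0.ne'
    rw [← ofReal_integral_eq_lintegral_ofReal hint (Eventually.of_forall fun _ => (Real.exp_pos _).le)]
    change ENNReal.ofReal (mgf u P s) ≤ 2
    have h4 : Real.exp (‖u‖ ^ 2 * s ^ 2 / 2) ≤ 2 := by
      have h1 : |s| * ‖u‖ ≤ 1 := by
        rw [hs, div_mul_eq_mul_div, div_le_one hr]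
        linarith
      have : s ^ 2 * ‖u‖ ^ 2 ≤ 1 ^ 2 := by
        rw [← sq_abs s, ← mul_pow]
        exact pow_le_pow_left₀ (by positivity) h1 2
      have h5 : Real.exp (‖u‖ ^ 2 * s ^ 2 / 2) ≤ Real.exp (1 / 2) := by
        apply Real.exp_le_exp.2; linarith
      have h6 := Real.exp_bound_div_one_sub_of_interval (x := 1 / 2) (by norm_num) (by norm_num)
      refine h5.trans (h6.trans (by norm_num))
    rw [h2]
    exact (ENNReal.ofReal_le_ofReal h4).trans (by simp)
  exact lintegral_exp_abs_le_four hb hr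

end IsGaussianSubspace

end SecondChaos

end Correlogram

namespace Correlogram

/-! ### Chaining -/

section Chaining

variable {Ω : Type*} [MeasurableSpace Ω] {P : Measure Ω}

/-- The increments of `W` have exponential tails on the scale of `d`. -/
structure HasExpIncrements (P : Measure Ω) (W : ℝ → Ω → ℝ) (d : ℝ → ℝ → ℝ) : Prop where
  aemeasurable : ∀ t, AEMeasurable (W t) P
  lintegral_le : ∀ s t r, 0 < r → d s t ≤ r →
    ∫⁻ ω, ENNReal.ofReal (Real.exp (|W s ω - W t ω| / r)) ∂P ≤ 4

theorem HasExpIncrements.measure_lt_le {W : ℝ → Ω → ℝ} {d : ℝ → ℝ → ℝ}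
    (hW : HasExpIncrements P W d) {s t r : ℝ} (hr : 0 < r) (hd : d s t ≤ r) (x : ℝ) :
    P {ω | x < |W s ω - W t ω|} ≤ ENNReal.ofReal (4 * Real.exp (-(x / r))) := by
  have hm : AEMeasurable (fun ω => ENNReal.ofReal (Real.exp (|W s ω - W t ω| / r))) P := by
    have h1 := hW.aemeasurable s
    have h2 := hW.aemeasurable t
    have h3 : AEMeasurable (fun ω => |W s ω - W t ω|) P := by
      simpa using (h1.sub h2).norm
    fun_prop
  have h0 : ENNReal.ofReal (Real.exp (x / r)) ≠ 0 := by simp [Real.exp_pos]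
  have hsub : {ω | x < |W s ω - W t ω|} ⊆ {ω | ENNReal.ofReal (Real.exp (x / r)) ≤
      ENNReal.ofReal (Real.exp (|W s ω - W t ω| / r))} := by
    intro ω hω
    have hω' : x < |W s ω - W t ω| := hω
    refine ENNReal.ofReal_le_ofReal (Real.exp_le_exp.2 ?_)
    gcongr
  refine (measure_mono hsub).trans ((meas_ge_le_lintegral_div hm h0 (by simp)).trans ?_)
  refine (ENNReal.div_le_div_right (hW.lintegral_le s t r hr hd) _).trans ?_
  rw [Real.exp_neg, ← div_eq_mul_inv, ENNReal.ofReal_div_of_pos (Real.exp_pos _)]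
  simp

variable {d : ℝ → ℝ → ℝ} {J : Set ℝ} {N : ℕ → Finset ℝ} {C L : ℝ} {k₀ : ℕ}

/-- The chaining bound at a fixed level. -/
theorem measure_increment_le (dsymm : ∀ s t, d s t = d t s)
    (dself : ∀ t, d t t = 0) (dtri : ∀ s t u, d s u ≤ d s t + d t u)
    (hC : 0 ≤ C) (hL : 0 < L)
    (hcard : ∀ k ≥ k₀, ((N k).card : ℝ) ≤ Real.exp (C * 2 ^ k))
    (hnet : ∀ k ≥ k₀, ∀ t ∈ J, ∃ p ∈ N k, d t p ≤ (1 / 4) ^ k)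
    {W : ℝ → Ω → ℝ} (hW : HasExpIncrements P W (fun s t => L * d s t))
    (u : ℕ → ℝ) (hu : ∀ j, u j ∈ J) {K : ℕ} (hK : k₀ ≤ K) :
    P {ω | ∃ i j, d (u i) (u j) ≤ (1 / 4) ^ K ∧
        5 * (3 * L * (4 * C + 7)) * (1 / 2) ^ K < |W (u i) ω - W (u j) ω|} ≤
      ENNReal.ofReal (8 * (1 / 2) ^ K) := by
  classical
  set A : ℝ := 3 * L * (4 * C + 7) with hA
  have hA0 : 0 ≤ A := by positivity
  let N' : ℕ → Finset ℝ := fun k => N k ∪ (Finset.range k).image u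
  let M : ℕ → Finset ℝ := fun k => N' k ∪ N' (k + 1)
  have hMcard : ∀ k ≥ k₀, ((M k).card : ℝ) ≤ Real.exp ((2 * C + 3) * 2 ^ k) := by
    intro k hk
    have h1 : ∀ k, (N' k).card ≤ (N k).card + k := fun k =>
      (Finset.card_union_le _ _).trans (Nat.add_le_add_left (Finset.card_image_le.trans
        (Finset.card_range k).le) _)
    have h2 : ((M k).card : ℝ) ≤ ((N k).card + k) + ((N (k + 1)).card + (k + 1 : ℕ)) := by
      exact_mod_cast (Finset.card_union_le _ _).trans (Nat.add_le_add (h1 k) (h1 (k + 1)))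
    have h3 : ((N k).card : ℝ) ≤ Real.exp (2 * C * 2 ^ k) :=
      (hcard k hk).trans (Real.exp_le_exp.2 (by
        have : (0 : ℝ) ≤ C * 2 ^ k := by positivity
        linarith))
    have h4 : ((N (k + 1)).card : ℝ) ≤ Real.exp (2 * C * 2 ^ k) :=
      (hcard (k + 1) (by omega)).trans_eq (by congr 1; ring)
    have h5 : (2 * k + 3 : ℝ) ≤ 3 * 2 ^ k := by
      clear * -
      induction k with
      | zero => simp
      | succ n ih =>
        have : (1 : ℝ) ≤ 2 ^ n := one_le_pow₀ (by norm_num)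
        push_cast
        rw [pow_succ]
        linarith
    have h6 : (3 * 2 ^ k : ℝ) ≤ Real.exp (3 * 2 ^ k) := by
      have := Real.add_one_le_exp (3 * 2 ^ k : ℝ); linarith
    have h7 : 1 ≤ Real.exp (2 * C * 2 ^ k) := Real.one_le_exp (by positivity)
    have h8 : (0 : ℝ) ≤ k := Nat.cast_nonneg k
    calc ((M k).card : ℝ) ≤ 2 * Real.exp (2 * C * 2 ^ k) + (2 * k + 1) := by
          push_cast at h2; linarith
      _ ≤ (2 * k + 3) * Real.exp (2 * C * 2 ^ k) := by nlinarith
      _ ≤ Real.exp (3 * 2 ^ k) * Real.exp (2 * C * 2 ^ k) := by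
          gcongr; exact h5.trans h6
      _ = Real.exp ((2 * C + 3) * 2 ^ k) := by rw [← Real.exp_add]; congr 1; ring
  let B : ℕ → Set Ω := fun k => ⋃ p ∈ M k, ⋃ q ∈ M k,
    {ω | d p q ≤ 3 * (1 / 4) ^ k ∧ A * (1 / 2) ^ k < |W p ω - W q ω|}
  have hB : ∀ k ≥ k₀, P (B k) ≤ ENNReal.ofReal (4 * (1 / 2) ^ k) := by
    intro k hk
    have hpair : ∀ p q, P {ω | d p q ≤ 3 * (1 / 4) ^ k ∧ A * (1 / 2) ^ k < |W p ω - W q ω|} ≤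
        ENNReal.ofReal (4 * Real.exp (-((4 * C + 7) * 2 ^ k))) := by
      intro p q
      by_cases hpq : d p q ≤ 3 * (1 / 4) ^ k
      · have hr : 0 < 3 * L * (1 / 4 : ℝ) ^ k := by positivity
        have := hW.measure_lt_le (s := p) (t := q) hr (by nlinarith) (A * (1 / 2) ^ k)
        refine (measure_mono fun ω hω => hω.2).trans (this.trans_eq ?_)
        congr 4
        rw [hA, div_eq_iff hr.ne']
        have : (1 / 2 : ℝ) ^ k = 2 ^ k * (1 / 4) ^ k := by rw [← mul_pow]; norm_num
        rw [this]
        ring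
      · have : {ω | d p q ≤ 3 * (1 / 4) ^ k ∧ A * (1 / 2) ^ k < |W p ω - W q ω|} = ∅ := by
          ext ω
          exact ⟨fun h => absurd h.1 hpq, fun h => h.elim⟩
        rw [this]; simp
    have hsum : P (B k) ≤ ∑ p ∈ M k, ∑ q ∈ M k,
        ENNReal.ofReal (4 * Real.exp (-((4 * C + 7) * 2 ^ k))) := by
      refine (measure_biUnion_finset_le _ _).trans (Finset.sum_le_sum fun p _ => ?_)
      exact (measure_biUnion_finset_le _ _).trans (Finset.sum_le_sum fun q _ => hpair p q)
    refine hsum.trans ?_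
    simp only [Finset.sum_const, nsmul_eq_mul]
    rw [← ENNReal.ofReal_natCast, ← ENNReal.ofReal_mul (by positivity),
      ← ENNReal.ofReal_mul (by positivity)]
    refine ENNReal.ofReal_le_ofReal ?_
    have h1 := hMcard k hk
    have h2 : Real.exp (-((4 * C + 7) * 2 ^ k)) = (Real.exp ((2 * C + 3) * 2 ^ k))⁻¹ *
        (Real.exp ((2 * C + 3) * 2 ^ k))⁻¹ * Real.exp (-2 ^ k) := by
      rw [← Real.exp_neg, ← Real.exp_add, ← Real.exp_add]
      congr 1; ring
    have h3 : Real.exp (-2 ^ k) ≤ (1 / 2) ^ k := by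
      rw [Real.exp_neg, one_div, inv_pow]
      have := Real.add_one_le_exp (2 ^ k : ℝ)
      gcongr
      linarith
    set m : ℝ := ((M k).card : ℝ)
    set E := Real.exp ((2 * C + 3) * 2 ^ k) with hE
    have hEpos : 0 < E := Real.exp_pos _
    have hm1 : m * E⁻¹ ≤ 1 := by rw [← div_eq_mul_inv, div_le_one hEpos]; exact h1
    have hm0 : 0 ≤ m * E⁻¹ := by positivity
    rw [h2]
    calc m * (m * (4 * (E⁻¹ * E⁻¹ * Real.exp (-2 ^ k))))
        = 4 * ((m * E⁻¹) * (m * E⁻¹)) * Real.exp (-2 ^ k) := by ring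
      _ ≤ 4 * (1 * 1) * (1 / 2) ^ k := by gcongr
      _ = 4 * (1 / 2) ^ k := by ring
  have hincl : {ω | ∃ i j, d (u i) (u j) ≤ (1 / 4) ^ K ∧
      5 * A * (1 / 2) ^ K < |W (u i) ω - W (u j) ω|} ⊆ ⋃ n, B (K + n) := by
    intro ω hω
    by_contra hcon
    simp only [Set.mem_iUnion, not_exists] at hcon
    have hgood : ∀ k ≥ K, ∀ p ∈ M k, ∀ q ∈ M k, d p q ≤ 3 * (1 / 4) ^ k →
        |W p ω - W q ω| ≤ A * (1 / 2) ^ k := by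
      intro k hk p hp q hq hpq
      obtain ⟨n, rfl⟩ := Nat.exists_eq_add_of_le hk
      have h := hcon n
      simp only [B, Set.mem_iUnion, not_exists] at h
      by_contra hlt
      exact h p hp q hq ⟨hpq, not_le.1 hlt⟩
    have hproj : ∀ j, ∃ p ∈ N' K, d (u j) p ≤ (1 / 4) ^ K ∧
        |W p ω - W (u j) ω| ≤ 2 * A * (1 / 2) ^ K := by
      intro j
      have hex : ∀ k, ∃ p, k₀ ≤ k → p ∈ N' k ∧ d (u j) p ≤ (1 / 4) ^ k ∧ (j < k → p = u j) := by
        intro k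
        by_cases hk : k₀ ≤ k
        · by_cases hj : j < k
          · refine ⟨u j, fun _ => ⟨Finset.mem_union_right _ (Finset.mem_image_of_mem u
              (Finset.mem_range.2 hj)), ?_, fun _ => rfl⟩⟩
            rw [dself]; positivity
          · obtain ⟨p, hp, hpd⟩ := hnet k hk (u j) (hu j)
            exact ⟨p, fun _ => ⟨Finset.mem_union_left _ hp, hpd, fun h => absurd h hj⟩⟩
        · exact ⟨0, fun h => absurd h hk⟩
      choose π hπ using hex
      have hstep : ∀ n, |W (π K) ω - W (π (K + n)) ω| ≤
          2 * A * ((1 / 2) ^ K - (1 / 2) ^ (K + n)) := by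
        intro n
        induction n with
        | zero => simp
        | succ n ih =>
          obtain ⟨a1, a2, -⟩ := hπ (K + n) (by omega)
          obtain ⟨b1, b2, -⟩ := hπ (K + n + 1) (by omega)
          have h1 : d (π (K + n)) (π (K + n + 1)) ≤ 3 * (1 / 4) ^ (K + n) := by
            refine (dtri _ (u j) _).trans ?_
            rw [dsymm]
            have : (1 / 4 : ℝ) ^ (K + n + 1) ≤ (1 / 4) ^ (K + n) :=
              pow_le_pow_of_le_one (by norm_num) (by norm_num) (by omega)
            have : (0 : ℝ) < (1 / 4) ^ (K + n) := by positivity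
            linarith
          have h2 := hgood (K + n) (by omega) _ (Finset.mem_union_left _ a1) _
            (Finset.mem_union_right _ b1) h1
          have h3 : |W (π K) ω - W (π (K + n + 1)) ω| ≤ |W (π K) ω - W (π (K + n)) ω| +
              |W (π (K + n)) ω - W (π (K + n + 1)) ω| := abs_sub_le _ _ _
          rw [← add_assoc]
          refine h3.trans ((add_le_add ih h2).trans_eq ?_)
          rw [pow_succ (1 / 2 : ℝ) (K + n)]
          ring
      obtain ⟨a1, a2, -⟩ := hπ K hK
      refine ⟨π K, a1, a2, ?_⟩
      have h1 := hstep (j + 1)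
      rw [(hπ (K + (j + 1)) (by omega)).2.2 (by omega)] at h1
      refine h1.trans ?_
      refine mul_le_mul_of_nonneg_left ?_ (by positivity)
      have : (0 : ℝ) < (1 / 2) ^ (K + (j + 1)) := by positivity
      linarith
    obtain ⟨i, j, hij, hlt⟩ := hω
    obtain ⟨p, hp, hpd, hpW⟩ := hproj i
    obtain ⟨q, hq, hqd, hqW⟩ := hproj j
    have h1 : d p q ≤ 3 * (1 / 4) ^ K := by
      have e1 := dtri p (u i) q
      have e2 := dtri (u i) (u j) q
      rw [dsymm p (u i)] at e1
      linarith
    have h2 := hgood K le_rfl p (Finset.mem_union_left _ hp) q (Finset.mem_union_left _ hq) h1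
    have h3 : |W (u i) ω - W (u j) ω| ≤ |W p ω - W (u i) ω| + |W p ω - W q ω| +
        |W q ω - W (u j) ω| := by
      have e1 := abs_sub_le (W (u i) ω) (W p ω) (W (u j) ω)
      have e2 := abs_sub_le (W p ω) (W q ω) (W (u j) ω)
      rw [abs_sub_comm (W (u i) ω) (W p ω)] at e1
      linarith
    linarith
  refine (measure_mono hincl).trans ((measure_iUnion_le _).trans ?_)
  have hs : HasSum (fun n : ℕ => 4 * (1 / 2 : ℝ) ^ (K + n)) (8 * (1 / 2) ^ K) := by
    have := (hasSum_geometric_two).mul_left (4 * (1 / 2 : ℝ) ^ K)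
    rw [show (8 * (1 / 2) ^ K : ℝ) = 4 * (1 / 2) ^ K * 2 by ring]
    rw [show (fun n : ℕ => 4 * (1 / 2 : ℝ) ^ (K + n)) = fun n => 4 * (1 / 2) ^ K * (1 / 2) ^ n from
      funext fun n => by rw [pow_add]; ring]
    exact this
  refine (ENNReal.tsum_le_tsum fun n => hB (K + n) (by omega)).trans ?_
  rw [← ENNReal.ofReal_tsum_of_nonneg (fun n => by positivity) hs.summable, hs.tsum_eq]

/-- Uniform equicontinuity in probability, with respect to `d`. -/
theorem exists_forall_measure_increment_le (dsymm : ∀ s t, d s t = d t s)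
    (dself : ∀ t, d t t = 0) (dtri : ∀ s t u, d s u ≤ d s t + d t u)
    (hC : 0 ≤ C) (hL : 0 < L)
    (hcard : ∀ k ≥ k₀, ((N k).card : ℝ) ≤ Real.exp (C * 2 ^ k))
    (hnet : ∀ k ≥ k₀, ∀ t ∈ J, ∃ p ∈ N k, d t p ≤ (1 / 4) ^ k) {η : ℝ} (hη : 0 < η) :
    ∃ ρ > 0, ∀ W : ℝ → Ω → ℝ, HasExpIncrements P W (fun s t => L * d s t) →
      ∀ u : ℕ → ℝ, (∀ j, u j ∈ J) →
        P {ω | ∃ i j, d (u i) (u j) ≤ ρ ∧ η < |W (u i) ω - W (u j) ω|} ≤ ENNReal.ofReal η := by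
  have hlim : ∀ c : ℝ, ∀ᶠ K : ℕ in atTop, c * (1 / 2) ^ K ≤ η := by
    intro c
    have : Tendsto (fun K : ℕ => c * (1 / 2 : ℝ) ^ K) atTop (𝓝 (c * 0)) :=
      (tendsto_pow_atTop_nhds_zero_of_lt_one (by norm_num) (by norm_num)).const_mul c
    rw [mul_zero] at this
    exact this.eventually_le_const hη
  obtain ⟨K, h1, h2, h3⟩ := ((hlim (5 * (3 * L * (4 * C + 7)))).and
    ((hlim 8).and (eventually_ge_atTop k₀))).exists
  refine ⟨(1 / 4) ^ K, by positivity, fun W hW u hu => ?_⟩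
  refine (measure_mono ?_).trans ((measure_increment_le dsymm dself dtri hC hL hcard hnet hW u hu
    h3).trans (ENNReal.ofReal_le_ofReal h2))
  rintro ω ⟨i, j, hij, hlt⟩
  exact ⟨i, j, hij, h1.trans_lt hlt⟩

end Chaining

section Separable

variable {Ω : Type*} [MeasurableSpace Ω] {P : Measure Ω} {a b : ℝ}

/-- The event that `W` varies by more than `η` between points of `[a, b]` closer than `δ`. -/
def oscEvent (a b : ℝ) (W : ℝ → Ω → ℝ) (δ η : ℝ) : Set Ω :=
  {ω | ∃ s ∈ Set.Icc a b, ∃ t ∈ Set.Icc a b, |s - t| < δ ∧ η < |W s ω - W t ω|}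

theorem IsSeparableOn.measure_oscEvent_le (hab : a ≤ b) {W : ℝ → Ω → ℝ}
    (hW : IsSeparableOn P W (Set.Icc a b)) {δ η : ℝ} {κ : ℝ≥0∞}
    (h : ∀ u : ℕ → ℝ, (∀ j, u j ∈ Set.Icc a b) →
      P {ω | ∃ i j, |u i - u j| ≤ δ ∧ η < |W (u i) ω - W (u j) ω|} ≤ κ) :
    P (oscEvent a b W δ η) ≤ κ := by
  obtain ⟨D, hD, hDc, hsep⟩ := hW
  rcases D.eq_empty_or_nonempty with rfl | hne
  · have : P = 0 := by
      rw [← Measure.measure_univ_eq_zero, ← nonpos_iff_eq_zero]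
      refine (measure_mono_ae (t := ∅) ?_).trans_eq measure_empty
      filter_upwards [hsep] with ω hω _
      have := hω a ⟨le_rfl, hab⟩
      simp at this
    simp [this]
  obtain ⟨u, rfl⟩ := hDc.exists_eq_range hne
  refine le_trans (measure_mono_ae ?_) (h u fun j => hD ⟨j, rfl⟩)
  filter_upwards [hsep] with ω hω
  rintro ⟨s, hs, t, ht, hst, hlt⟩
  have hopen : IsOpen {p : (ℝ × ℝ) × (ℝ × ℝ) | |p.1.1 - p.2.1| < δ ∧ η < |p.1.2 - p.2.2|} := by
    have h1 : IsOpen {p : (ℝ × ℝ) × (ℝ × ℝ) | |p.1.1 - p.2.1| < δ} :=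
      isOpen_lt (by fun_prop) (by fun_prop)
    have h2 : IsOpen {p : (ℝ × ℝ) × (ℝ × ℝ) | η < |p.1.2 - p.2.2|} :=
      isOpen_lt (by fun_prop) (by fun_prop)
    exact h1.inter h2
  have hmem : ((s, W s ω), (t, W t ω)) ∈
      closure (((fun s => (s, W s ω)) '' Set.range u) ×ˢ ((fun s => (s, W s ω)) '' Set.range u)) := by
    rw [closure_prod_eq]
    exact ⟨hω s hs, hω t ht⟩
  obtain ⟨p, hp, hp'⟩ := mem_closure_iff.1 hmem _ hopen ⟨hst, hlt⟩
  obtain ⟨⟨_, ⟨i, rfl⟩, hi⟩, ⟨_, ⟨j, rfl⟩, hj⟩⟩ := hp'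
  refine ⟨i, j, ?_⟩
  obtain ⟨h1, h2⟩ := hp
  rw [← hi, ← hj] at h1 h2
  exact ⟨h1.le, h2⟩

theorem ae_continuousOn_of_measure_oscEvent_le {W : ℝ → Ω → ℝ}
    (h : ∀ η > 0, ∃ δ > 0, P (oscEvent a b W δ η) ≤ ENNReal.ofReal η) :
    ∀ᵐ ω ∂P, ContinuousOn (fun t => W t ω) (Set.Icc a b) := by
  have hn : ∀ n : ℕ, ∃ δ > 0, P (oscEvent a b W δ ((1 / 2) ^ n)) ≤ ENNReal.ofReal ((1 / 2) ^ n) :=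
    fun n => h _ (by positivity)
  choose δ hδ hP using hn
  have hsum : ∑' n, P (oscEvent a b W (δ n) ((1 / 2) ^ n)) ≠ ∞ := by
    refine ne_top_of_le_ne_top ?_ (ENNReal.tsum_le_tsum hP)
    rw [← ENNReal.ofReal_tsum_of_nonneg (fun n => by positivity) summable_geometric_two]
    simp
  filter_upwards [ae_eventually_notMem hsum] with ω hω
  rw [Metric.continuousOn_iff]
  intro t ht ε hε
  have hlim : ∀ᶠ n : ℕ in atTop, (1 / 2 : ℝ) ^ n < ε :=
    (tendsto_pow_atTop_nhds_zero_of_lt_one (by norm_num) (by norm_num)).eventually_lt_const hε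
  obtain ⟨n, h1, h2⟩ := (hω.and hlim).exists
  refine ⟨δ n, hδ n, fun s hs hst => ?_⟩
  by_contra hcon
  rw [Real.dist_eq] at hcon hst
  exact h1 ⟨s, hs, t, ht, hst, h2.trans_le (not_lt.1 hcon)⟩

end Separable

end Correlogram

namespace Correlogram

/-! ### The entropy condition -/

section Entropy

variable {H : ℝ → ℝ}

theorem sigma_nonneg (hH : MemLp H 2 volume) (s t : ℝ) : 0 ≤ sigma H hH s t := Real.sqrt_nonneg _

theorem norm_toLp_sub_sq {g k : ℝ → ℝ} (hg : MemLp g 2 volume) (hk : MemLp k 2 volume) :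
    ‖hg.toLp g - hk.toLp k‖ ^ 2 = ∫ x, (g x - k x) ^ 2 := by
  rw [← MemLp.toLp_sub, ← real_inner_self_eq_norm_sq, L2.inner_def]
  refine integral_congr_ae ?_
  filter_upwards [(hg.sub hk).coeFn_toLp] with x hx
  rw [hx]
  simp [sq]

theorem sigma_eq_norm (hH : MemLp H 2 volume) (s t : ℝ) :
    sigma H hH s t = √(Real.pi / 2) *
      ‖(memLp_comp_add hH s).toLp _ - (memLp_comp_add hH t).toLp _‖ := by
  rw [← Real.sqrt_sq (sigma_nonneg hH s t), sigma_sq_eq,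
    ← norm_toLp_sub_sq (memLp_comp_add hH s) (memLp_comp_add hH t),
    Real.sqrt_mul (by positivity), Real.sqrt_sq (norm_nonneg _)]

theorem norm_toLp_sub_eq_sigma (hH : MemLp H 2 volume) (s t : ℝ) :
    ‖(memLp_comp_add hH s).toLp _ - (memLp_comp_add hH t).toLp _‖ =
      √(2 / Real.pi) * sigma H hH s t := by
  rw [sigma_eq_norm, ← mul_assoc, ← Real.sqrt_mul (by positivity)]
  have : 2 / Real.pi * (Real.pi / 2) = 1 := by field_simp
  rw [this]; simp

theorem sigma_self (hH : MemLp H 2 volume) (t : ℝ) : sigma H hH t t = 0 := by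
  rw [sigma_eq_norm]; simp

theorem sigma_comm (hH : MemLp H 2 volume) (s t : ℝ) : sigma H hH s t = sigma H hH t s := by
  rw [sigma, sigma, abs_sub_comm]

theorem sigma_triangle (hH : MemLp H 2 volume) (s t u : ℝ) :
    sigma H hH s u ≤ sigma H hH s t + sigma H hH t u := by
  rw [sigma_eq_norm, sigma_eq_norm, sigma_eq_norm, ← mul_add]
  exact mul_le_mul_of_nonneg_left (norm_sub_le_norm_sub_add_norm_sub _ _ _) (Real.sqrt_nonneg _)

theorem sigma_add_right (hH : MemLp H 2 volume) (s t u : ℝ) :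
    sigma H hH (s + u) (t + u) = sigma H hH s t := by
  rw [sigma, sigma, add_sub_add_right_eq_sub]

theorem exists_sigma_le (hH : MemLp H 2 volume) {ρ : ℝ} (hρ : 0 < ρ) :
    ∃ δ > 0, ∀ s t, |s - t| ≤ δ → sigma H hH s t ≤ ρ := by
  have hint : Integrable (fun l => ‖plancherel H hH l‖ ^ 2) := by
    have h := Lp.memLp (𝓕 (MemLp.toLp (fun x => (H x : ℂ)) hH.ofReal) : Lp ℂ 2 (volume : Measure ℝ))
    have h2 := h.integrable_norm_pow (p := 2) (by norm_num)
    exact h2.comp_div (by positivity : (2 * Real.pi : ℝ) ≠ 0)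
  have hlim : Tendsto (fun τ => qFun H hH τ) (𝓝 0) (𝓝 0) := by
    have h0 : qFun H hH 0 = 0 := by simp [qFun]
    have : Tendsto (fun τ => ∫ l : ℝ, Real.sin (τ * l / 2) ^ 2 * ‖plancherel H hH l‖ ^ 2) (𝓝 0)
        (𝓝 (∫ l : ℝ, Real.sin (0 * l / 2) ^ 2 * ‖plancherel H hH l‖ ^ 2)) := by
      refine tendsto_integral_filter_of_dominated_convergence (fun l => ‖plancherel H hH l‖ ^ 2)
        ?_ ?_ hint ?_
      · refine Eventually.of_forall fun τ => ?_
        exact AEStronglyMeasurable.mul (by fun_prop) hint.aestronglyMeasurable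
      · refine Eventually.of_forall fun τ => Eventually.of_forall fun l => ?_
        rw [norm_mul, Real.norm_eq_abs, Real.norm_eq_abs, abs_of_nonneg (sq_nonneg _),
          abs_of_nonneg (sq_nonneg _)]
        exact mul_le_of_le_one_left (sq_nonneg _) (Real.sin_sq_le_one _)
      · refine Eventually.of_forall fun l => ?_
        exact Continuous.tendsto (by fun_prop) 0
    have h1 := (Real.continuous_sqrt.tendsto _).comp this
    simpa [qFun, Function.comp_def] using h1
  obtain ⟨δ, hδ, h⟩ := Metric.tendsto_nhds_nhds.1 hlim ρ hρ
  refine ⟨δ / 2, by positivity, fun s t hst => ?_⟩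
  have h1 : dist |s - t| 0 < δ := by rw [Real.dist_eq, sub_zero, abs_abs]; linarith
  have h2 := h h1
  rw [Real.dist_eq, sub_zero] at h2
  exact (le_abs_self _).trans h2.le

theorem coveringNumber_anti (ρ : ℝ → ℝ → ℝ) (S : Set ℝ) {ε ε' : ℝ} (h : ε ≤ ε') :
    coveringNumber ρ S ε' ≤ coveringNumber ρ S ε := by
  refine le_iInf fun C => le_iInf fun hC => le_iInf fun hcov => ?_
  refine iInf_le_of_le C (iInf_le_of_le hC (iInf_le_of_le (fun x hx => ?_) le_rfl))
  obtain ⟨y, hy, hxy⟩ := hcov x hx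
  exact ⟨y, hy, hxy.trans h⟩

theorem metricEntropy_anti (ρ : ℝ → ℝ → ℝ) (S : Set ℝ) {ε ε' : ℝ} (h : ε ≤ ε') :
    metricEntropy ρ S ε' ≤ metricEntropy ρ S ε := by
  have hN := coveringNumber_anti ρ S h
  unfold metricEntropy
  split_ifs with h1 h2 h2
  · exact le_rfl
  · exact absurd (top_le_iff.1 (h1 ▸ hN)) h2
  · exact le_top
  · refine ENNReal.ofReal_le_ofReal ?_
    have h3 := ENat.toNat_le_toNat hN h2
    rcases Nat.eq_zero_or_pos (coveringNumber ρ S ε').toNat with h4 | h4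
    · rw [h4]; simp [Real.log_natCast_nonneg]
    · exact Real.log_le_log (by exact_mod_cast h4) (by exact_mod_cast h3)

/-- Under the entropy condition there are nets of radius `4⁻ᵏ` with at most `exp (C 2ᵏ)` points. -/
theorem exists_nets (hH : MemLp H 2 volume)
    (hE : EntropyIntegralFinite (sqrtSigma H hH) (Set.Icc 0 1)) :
    ∃ (C : ℝ) (k₀ : ℕ) (N : ℕ → Finset ℝ), 0 ≤ C ∧
      (∀ k ≥ k₀, ((N k).card : ℝ) ≤ Real.exp (C * 2 ^ k)) ∧
      ∀ k ≥ k₀, ∀ t ∈ Set.Icc (0 : ℝ) 1, ∃ p ∈ N k, sigma H hH t p ≤ (1 / 4) ^ k := by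
  obtain ⟨u, hu, hI⟩ := hE
  set I := ∫⁻ ε in Set.Ioc 0 u, metricEntropy (sqrtSigma H hH) (Set.Icc 0 1) ε with hIdef
  have hlim : ∀ᶠ k : ℕ in atTop, (1 / 2 : ℝ) ^ k ≤ u :=
    (tendsto_pow_atTop_nhds_zero_of_lt_one (by norm_num) (by norm_num)).eventually_le_const hu
  obtain ⟨k₀, hk₀⟩ := eventually_atTop.1 hlim
  have key : ∀ k, k₀ ≤ k → ∃ C : Finset ℝ, ((C.card : ℝ) ≤ Real.exp (I.toReal * 2 ^ k)) ∧
      ∀ t ∈ Set.Icc (0 : ℝ) 1, ∃ p ∈ C, sigma H hH t p ≤ (1 / 4) ^ k := by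
    intro k hk
    set ε : ℝ := (1 / 2) ^ k with hε
    have hε0 : 0 < ε := by positivity
    set m := metricEntropy (sqrtSigma H hH) (Set.Icc 0 1) ε with hm
    have h1 : ENNReal.ofReal ε * m ≤ I := by
      calc ENNReal.ofReal ε * m = ∫⁻ _ in Set.Ioc 0 ε, m := by
            rw [setLIntegral_const, Real.volume_Ioc, sub_zero, mul_comm]
        _ ≤ ∫⁻ x in Set.Ioc 0 ε, metricEntropy (sqrtSigma H hH) (Set.Icc 0 1) x := by
            refine setLIntegral_mono' measurableSet_Ioc fun x hx => metricEntropy_anti _ _ hx.2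
        _ ≤ I := lintegral_mono_set (Set.Ioc_subset_Ioc_right (hk₀ k hk))
    have hmtop : m ≠ ⊤ := by
      intro h
      rw [h, ENNReal.mul_top (by simpa using hε0)] at h1
      exact hI.ne (top_le_iff.1 h1)
    have hcov : coveringNumber (sqrtSigma H hH) (Set.Icc 0 1) ε ≠ ⊤ := by
      intro h
      apply hmtop
      rw [hm, metricEntropy, if_pos h]
    set n := (coveringNumber (sqrtSigma H hH) (Set.Icc 0 1) ε).toNat with hn
    have hn' : coveringNumber (sqrtSigma H hH) (Set.Icc 0 1) ε = n := (ENat.natCast_toNat hcov).symm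
    have hlog : Real.log n ≤ I.toReal * 2 ^ k := by
      have h2 : ENNReal.ofReal ε * ENNReal.ofReal (Real.log n) ≤ I := by
        have : m = ENNReal.ofReal (Real.log n) := by rw [hm, metricEntropy, if_neg hcov]
        rwa [this] at h1
      rw [← ENNReal.ofReal_mul hε0.le] at h2
      have h3 := ENNReal.toReal_mono hI.ne h2
      rw [ENNReal.toReal_ofReal (mul_nonneg hε0.le (Real.log_natCast_nonneg _))] at h3
      have h4 : ε * 2 ^ k = 1 := by rw [hε, ← mul_pow]; norm_num
      calc Real.log n = (ε * Real.log n) * 2 ^ k := by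
            rw [mul_right_comm, h4, one_mul]
        _ ≤ _ := by gcongr
    have hlt : coveringNumber (sqrtSigma H hH) (Set.Icc 0 1) ε < (n + 1 : ℕ) := by
      rw [hn']; exact_mod_cast Nat.lt_succ_self n
    unfold coveringNumber at hlt
    simp only [iInf_lt_iff] at hlt
    obtain ⟨C, hC, hcover, hcard⟩ := hlt
    have hfin : C.Finite := Set.finite_of_encard_le_coe hcard.le
    refine ⟨hfin.toFinset, ?_, fun t ht => ?_⟩
    · have h5 : hfin.toFinset.card ≤ n := by
        rw [hfin.encard_eq_coe_toFinset_card] at hcard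
        exact Nat.lt_succ_iff.1 (by exact_mod_cast hcard)
      rcases Nat.eq_zero_or_pos n with h0 | h0
      · rw [h0] at h5
        have : hfin.toFinset.card = 0 := by omega
        rw [this]; simpa using (Real.exp_pos _).le
      · refine le_trans (by exact_mod_cast h5 : _ ≤ (n : ℝ)) ?_
        exact (Real.log_le_iff_le_exp (by exact_mod_cast h0)).1 hlog
    · obtain ⟨y, hy, hty⟩ := hcover t ht
      refine ⟨y, by simpa using hy, ?_⟩
      have h6 : sqrtSigma H hH t y ≤ ε := hty
      rw [sqrtSigma, Real.sqrt_le_left hε0.le] at h6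
      refine h6.trans_eq ?_
      rw [hε, ← pow_mul, mul_comm, pow_mul]; norm_num
  classical
  refine ⟨I.toReal, k₀, fun k => if h : k₀ ≤ k then (key k h).choose else ∅,
    ENNReal.toReal_nonneg, fun k hk => ?_, fun k hk => ?_⟩
  · simp only [ge_iff_le.1 hk]; exact (key k hk).choose_spec.1
  · simp only [ge_iff_le.1 hk]; exact (key k hk).choose_spec.2

theorem exists_nets_Icc (hH : MemLp H 2 volume)
    (hE : EntropyIntegralFinite (sqrtSigma H hH) (Set.Icc 0 1)) (a b : ℝ) :
    ∃ (C : ℝ) (k₀ : ℕ) (N : ℕ → Finset ℝ), 0 ≤ C ∧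
      (∀ k ≥ k₀, ((N k).card : ℝ) ≤ Real.exp (C * 2 ^ k)) ∧
      ∀ k ≥ k₀, ∀ t ∈ Set.Icc a b, ∃ p ∈ N k, sigma H hH t p ≤ (1 / 4) ^ k := by
  classical
  obtain ⟨C, k₀, N, hC, hcard, hnet⟩ := exists_nets hH hE
  let R : Finset ℤ := Finset.Icc ⌊a⌋ ⌊b⌋
  refine ⟨C + R.card, k₀, fun k => (R ×ˢ N k).image fun z => z.2 + z.1, by positivity,
    fun k hk => ?_, fun k hk t ht => ?_⟩
  · have h1 : (((R ×ˢ N k).image fun z : ℤ × ℝ => z.2 + z.1).card : ℝ) ≤ R.card * (N k).card := by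
      have h0 : ((R ×ˢ N k).image fun z : ℤ × ℝ => z.2 + z.1).card ≤ R.card * (N k).card :=
        Finset.card_image_le.trans_eq (Finset.card_product _ _)
      exact_mod_cast h0
    have h2 : (R.card : ℝ) ≤ Real.exp (R.card * 2 ^ k) := by
      have e1 := Real.add_one_le_exp ((R.card : ℝ) * 2 ^ k)
      have e2 : (R.card : ℝ) * 1 ≤ R.card * 2 ^ k := by
        gcongr; exact one_le_pow₀ (by norm_num)
      linarith
    refine h1.trans ((mul_le_mul h2 (hcard k hk) (by positivity) (Real.exp_pos _).le).trans_eq ?_)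
    rw [← Real.exp_add]; congr 1; ring
  · obtain ⟨p, hp, hpd⟩ := hnet k hk (Int.fract t) ⟨Int.fract_nonneg t, (Int.fract_lt_one t).le⟩
    refine ⟨p + ⌊t⌋, Finset.mem_image.2 ⟨(⌊t⌋, p), Finset.mem_product.2 ⟨Finset.mem_Icc.2
      ⟨Int.floor_le_floor ht.1, Int.floor_le_floor ht.2⟩, hp⟩, rfl⟩, ?_⟩
    have e := sigma_add_right hH (Int.fract t) p ⌊t⌋
    rw [Int.fract_add_floor] at e
    rw [e]
    exact hpd

variable {Ω : Type*} [MeasurableSpace Ω] {P : Measure Ω}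

/-- Processes with exponential increments are equicontinuous in probability. -/
theorem exists_forall_measure_modulus_le (hH : MemLp H 2 volume)
    (hE : EntropyIntegralFinite (sqrtSigma H hH) (Set.Icc 0 1)) (a b : ℝ) {L : ℝ} (hL : 0 < L)
    {η : ℝ} (hη : 0 < η) :
    ∃ δ > 0, ∀ W : ℝ → Ω → ℝ, HasExpIncrements P W (fun s t => L * sigma H hH s t) →
      ∀ u : ℕ → ℝ, (∀ j, u j ∈ Set.Icc a b) →
        P {ω | ∃ i j, |u i - u j| ≤ δ ∧ η < |W (u i) ω - W (u j) ω|} ≤ ENNReal.ofReal η := by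
  obtain ⟨C, k₀, N, hC, hcard, hnet⟩ := exists_nets_Icc hH hE a b
  obtain ⟨ρ, hρ, h⟩ := exists_forall_measure_increment_le (P := P) (sigma_comm hH) (sigma_self hH)
    (sigma_triangle hH) hC hL hcard hnet hη
  obtain ⟨δ, hδ, hσ⟩ := exists_sigma_le hH hρ
  refine ⟨δ, hδ, fun W hW u hu => (measure_mono ?_).trans (h W hW u hu)⟩
  rintro ω ⟨i, j, hij, hlt⟩
  exact ⟨i, j, hσ _ _ hij, hlt⟩

theorem exists_forall_measure_oscEvent_le (hH : MemLp H 2 volume)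
    (hE : EntropyIntegralFinite (sqrtSigma H hH) (Set.Icc 0 1)) {a b : ℝ} (hab : a ≤ b) {L : ℝ}
    (hL : 0 < L) {η : ℝ} (hη : 0 < η) :
    ∃ δ > 0, ∀ W : ℝ → Ω → ℝ, HasExpIncrements P W (fun s t => L * sigma H hH s t) →
      IsSeparableOn P W (Set.Icc a b) → P (oscEvent a b W δ η) ≤ ENNReal.ofReal η := by
  obtain ⟨δ, hδ, h⟩ := exists_forall_measure_modulus_le (P := P) hH hE a b hL hη
  exact ⟨δ, hδ, fun W hW hsep => hsep.measure_oscEvent_le hab (h W hW)⟩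

end Entropy

end Correlogram

namespace Correlogram

/-! ### Weak convergence in `C[a, b]` -/

section WeakConvergence

/-- A continuous map that reconstructs a function on `[a, b]` from finitely many values, up to its
oscillation at scale `δ`. -/
theorem exists_interpolation (a b : ℝ) {δ : ℝ} (hδ : 0 < δ) :
    ∃ (s : Finset ℝ) (Φ : EuclideanSpace ℝ s → C(Set.Icc a b, ℝ)),
      (∀ x ∈ s, x ∈ Set.Icc a b) ∧ Continuous Φ ∧
      ∀ (w : ℝ → ℝ) (η : ℝ), (∀ x ∈ Set.Icc a b, ∀ y ∈ Set.Icc a b, |x - y| < δ → |w x - w y| ≤ η) →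
        ∀ t : Set.Icc a b, |Φ (WithLp.toLp 2 fun k => w k) t - w t| ≤ η := by
  obtain ⟨c, hc, hcfin, hcov⟩ := (isCompact_Icc (a := a) (b := b)).finite_cover_balls hδ
  set s := hcfin.toFinset with hs
  have hmem : ∀ x ∈ s, x ∈ Set.Icc a b := fun x hx => hc (by simpa [hs] using hx)
  let h : s → Set.Icc a b → ℝ := fun k t => max 0 (δ - |(t : ℝ) - k|)
  let S : Set.Icc a b → ℝ := fun t => ∑ k, h k t
  have h0 : ∀ k t, 0 ≤ h k t := fun k t => le_max_left _ _
  have hS : ∀ t, 0 < S t := by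
    intro t
    obtain ⟨k, hk, hkt⟩ := Set.mem_iUnion₂.1 (hcov t.2)
    have hk' : k ∈ s := by simpa [hs] using hk
    refine Finset.sum_pos' (fun k _ => h0 k t) ⟨⟨k, hk'⟩, Finset.mem_univ _, ?_⟩
    refine lt_max_of_lt_right ?_
    rw [Metric.mem_ball, Real.dist_eq] at hkt
    simpa using hkt
  have hcont : ∀ k, Continuous (h k) := fun k => by fun_prop
  have hScont : Continuous S := continuous_finsetSum _ fun k _ => hcont k
  let φ : s → C(Set.Icc a b, ℝ) := fun k => ⟨fun t => h k t / S t,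
    (hcont k).div hScont fun t => (hS t).ne'⟩
  refine ⟨s, fun x => ∑ k, x k • φ k, hmem, ?_, fun w η hw t => ?_⟩
  · exact continuous_finsetSum _ fun k _ => by fun_prop
  · have e1 : (∑ k, (WithLp.toLp 2 fun k : s => w k) k • φ k) t = ∑ k : s, w k * (h k t / S t) := by
      simp [φ]
    have e2 : w t = ∑ k : s, w t * (h k t / S t) := by
      rw [← Finset.mul_sum, ← Finset.sum_div]
      change w t = w t * (S t / S t)
      rw [div_self (hS t).ne', mul_one]
    have hη : ∀ k : s, h k t ≠ 0 → |w k - w t| ≤ η := by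
      intro k hk
      refine hw _ (hmem k k.2) _ t.2 ?_
      by_contra hcon
      apply hk
      refine max_eq_left ?_
      rw [abs_sub_comm]
      linarith
    change |(∑ k, (WithLp.toLp 2 fun k : s => w k) k • φ k) t - w t| ≤ η
    rw [e1]
    conv_lhs => rw [e2]
    rw [← Finset.sum_sub_distrib]
    refine (Finset.abs_sum_le_sum_abs _ _).trans ?_
    have e3 : η = ∑ k : s, η * (h k t / S t) := by
      rw [← Finset.mul_sum, ← Finset.sum_div]
      change η = η * (S t / S t)
      rw [div_self (hS t).ne', mul_one]
    rw [e3]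
    refine Finset.sum_le_sum fun k _ => ?_
    rw [← sub_mul, abs_mul, abs_of_nonneg (div_nonneg (h0 k t) (hS t).le)]
    by_cases hk : h k t = 0
    · rw [hk]; simp
    · exact mul_le_mul_of_nonneg_right (hη k hk) (div_nonneg (h0 k t) (hS t).le)

variable {Ω : Type*} [MeasurableSpace Ω] {P : Measure Ω} {a b : ℝ}

theorem path_apply {W : ℝ → Ω → ℝ} {ω : Ω}
    (h : ContinuousOn (fun t => W t ω) (Set.Icc a b)) (t : Set.Icc a b) : path a b W ω t = W t ω := by
  rw [path, dif_pos h]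
  rfl

theorem norm_interpolation_sub_path_le {s : Finset ℝ} {Φ : EuclideanSpace ℝ s → C(Set.Icc a b, ℝ)}
    {δ : ℝ} (hΦ : ∀ (w : ℝ → ℝ) (η : ℝ),
      (∀ x ∈ Set.Icc a b, ∀ y ∈ Set.Icc a b, |x - y| < δ → |w x - w y| ≤ η) →
        ∀ t : Set.Icc a b, |Φ (WithLp.toLp 2 fun k => w k) t - w t| ≤ η)
    {W : ℝ → Ω → ℝ} {ω : Ω} {η : ℝ} (hη : 0 ≤ η)
    (h : ContinuousOn (fun t => W t ω) (Set.Icc a b)) (hosc : ω ∉ oscEvent a b W δ η) :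
    ‖Φ (WithLp.toLp 2 fun k => W k ω) - path a b W ω‖ ≤ η := by
  refine (ContinuousMap.norm_le _ hη).2 fun t => ?_
  rw [ContinuousMap.sub_apply, path_apply h, Real.norm_eq_abs]
  refine hΦ (fun t => W t ω) η (fun x hx y hy hxy => ?_) t
  by_contra hcon
  exact hosc ⟨x, hx, y, hy, hxy, not_le.1 hcon⟩

theorem aemeasurable_toLp {W : ℝ → Ω → ℝ} (hW : ∀ t, AEMeasurable (W t) P) (s : Finset ℝ) :
    AEMeasurable (fun ω => (WithLp.toLp 2 fun k : s => W k ω : EuclideanSpace ℝ s)) P :=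
  (WithLp.measurable_toLp 2 (s → ℝ)).comp_aemeasurable (aemeasurable_pi_lambda _ fun k => hW k)

theorem aemeasurable_path {W : ℝ → Ω → ℝ} (hW : ∀ t, AEMeasurable (W t) P)
    (hcont : ∀ᵐ ω ∂P, ContinuousOn (fun t => W t ω) (Set.Icc a b)) :
    AEMeasurable (path a b W) P := by
  choose s Φ hs hΦc hΦ using fun n : ℕ => exists_interpolation a b (Nat.one_div_pos_of_nat (n := n) (α := ℝ))
  refine aemeasurable_of_tendsto_metrizable_ae atTop
    (f := fun n ω => Φ n (WithLp.toLp 2 fun k => W k ω))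
    (fun n => (hΦc n).measurable.comp_aemeasurable (aemeasurable_toLp hW _)) ?_
  filter_upwards [hcont] with ω hω
  rw [tendsto_iff_norm_sub_tendsto_zero]
  refine Metric.tendsto_atTop.2 fun ε hε => ?_
  have hu := isCompact_Icc.uniformContinuousOn_of_continuous hω
  obtain ⟨δ, hδ, h⟩ := Metric.uniformContinuousOn_iff.1 hu (ε / 2) (by positivity)
  obtain ⟨n₀, hn₀⟩ := exists_nat_one_div_lt hδ
  refine ⟨n₀, fun n hn => ?_⟩
  rw [Real.dist_eq, sub_zero, abs_norm]
  have hle : (1 / ((n : ℝ) + 1)) ≤ 1 / ((n₀ : ℝ) + 1) := Nat.one_div_le_one_div hn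
  refine (norm_interpolation_sub_path_le (hΦ n) (by positivity : 0 ≤ ε / 2) hω ?_).trans_lt
    (by linarith)
  rintro ⟨x, hx, y, hy, hxy, hlt⟩
  have := h x hx y hy (by rw [Real.dist_eq]; linarith)
  rw [Real.dist_eq] at this
  linarith

variable [IsProbabilityMeasure P]

theorem abs_integral_interpolation_sub_le {s : Finset ℝ}
    {Φ : EuclideanSpace ℝ s → C(Set.Icc a b, ℝ)} (hΦc : Continuous Φ)
    {δ : ℝ} (hΦ : ∀ (w : ℝ → ℝ) (η : ℝ),
      (∀ x ∈ Set.Icc a b, ∀ y ∈ Set.Icc a b, |x - y| < δ → |w x - w y| ≤ η) →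
        ∀ t : Set.Icc a b, |Φ (WithLp.toLp 2 fun k => w k) t - w t| ≤ η)
    {W : ℝ → Ω → ℝ} (hW : ∀ t, AEMeasurable (W t) P)
    (hcont : ∀ᵐ ω ∂P, ContinuousOn (fun t => W t ω) (Set.Icc a b))
    {η : ℝ} (hη : 0 ≤ η) (hosc : P (oscEvent a b W δ η) ≤ ENNReal.ofReal η)
    {F : C(Set.Icc a b, ℝ) → ℝ} {K : ℝ≥0} (hF : LipschitzWith K F) {B : ℝ}
    (hB : ∀ w, |F w| ≤ B) :
    |∫ ω, F (Φ (WithLp.toLp 2 fun k => W k ω)) ∂P - ∫ ω, F (path a b W ω) ∂P| ≤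
      (K + 2 * B) * η := by
  have hB0 : 0 ≤ B := (abs_nonneg _).trans (hB 0)
  have m1 : AEMeasurable (fun ω => F (Φ (WithLp.toLp 2 fun k => W k ω))) P :=
    (hF.continuous.comp hΦc).measurable.comp_aemeasurable (aemeasurable_toLp hW s)
  have m2 : AEMeasurable (fun ω => F (path a b W ω)) P :=
    hF.continuous.measurable.comp_aemeasurable (aemeasurable_path hW hcont)
  have i1 : Integrable (fun ω => F (Φ (WithLp.toLp 2 fun k => W k ω))) P :=
    Integrable.of_bound m1.aestronglyMeasurable B (Eventually.of_forall fun ω => hB _)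
  have i2 : Integrable (fun ω => F (path a b W ω)) P :=
    Integrable.of_bound m2.aestronglyMeasurable B (Eventually.of_forall fun ω => hB _)
  set A := toMeasurable P (oscEvent a b W δ η) with hA
  have hAm : MeasurableSet A := measurableSet_toMeasurable _ _
  have hAP : P.real A ≤ η := by
    refine ENNReal.toReal_le_of_le_ofReal hη ?_
    rw [hA, measure_toMeasurable]; exact hosc
  rw [← integral_sub i1 i2, ← Real.norm_eq_abs]
  have hint : Integrable (fun ω => K * η + A.indicator (fun _ => 2 * B) ω) P :=
    (integrable_const _).add ((integrable_const _).indicator hAm)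
  refine (norm_integral_le_of_norm_le hint ?_).trans ?_
  · filter_upwards [hcont] with ω hω
    by_cases hωA : ω ∈ A
    · rw [Set.indicator_of_mem hωA]
      have h1 := hB (Φ (WithLp.toLp 2 fun k => W k ω))
      have h2 := hB (path a b W ω)
      have h3 := norm_sub_le (F (Φ (WithLp.toLp 2 fun k => W k ω))) (F (path a b W ω))
      rw [Real.norm_eq_abs (F _), Real.norm_eq_abs (F _)] at h3
      have : 0 ≤ (K : ℝ) * η := by positivity
      linarith
    · rw [Set.indicator_of_notMem hωA, add_zero]
      have h1 := norm_interpolation_sub_path_le hΦ hη hω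
        (fun h => hωA (subset_toMeasurable _ _ h))
      have h2 := hF.dist_le_mul (Φ (WithLp.toLp 2 fun k => W k ω)) (path a b W ω)
      rw [dist_eq_norm, dist_eq_norm] at h2
      exact h2.trans (by gcongr)
  · rw [integral_add (integrable_const _) ((integrable_const _).indicator hAm),
      integral_indicator_const _ hAm]
    simp only [integral_const, probReal_univ, smul_eq_mul, one_mul]
    nlinarith

theorem tendstoInDistribution_toLp {ι : Type*} {l : Filter ι} [l.IsCountablyGenerated]
    {W : ι → ℝ → Ω → ℝ} {Z : ℝ → Ω → ℝ} (hW : ∀ i t, AEMeasurable (W i t) P)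
    (hZ : ∀ t, AEMeasurable (Z t) P) (s : Finset ℝ)
    (h : ∀ c : s → ℝ, Tendsto (fun i => ∫ ω, Complex.exp ((∑ k, c k * W i k ω : ℝ) * Complex.I) ∂P) l
      (𝓝 (∫ ω, Complex.exp ((∑ k, c k * Z k ω : ℝ) * Complex.I) ∂P))) :
    TendstoInDistribution
      (fun i ω => (WithLp.toLp 2 fun k : s => W i k ω : EuclideanSpace ℝ s)) l
      (fun ω => (WithLp.toLp 2 fun k : s => Z k ω : EuclideanSpace ℝ s)) (fun _ => P) P where
  forall_aemeasurable i := aemeasurable_toLp (hW i) s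
  aemeasurable_limit := aemeasurable_toLp hZ s
  tendsto := by
    have hch : ∀ V : ℝ → Ω → ℝ, (∀ t, AEMeasurable (V t) P) → ∀ c : EuclideanSpace ℝ s,
        charFun (P.map fun ω => (WithLp.toLp 2 fun k : s => V k ω : EuclideanSpace ℝ s)) c =
          ∫ ω, Complex.exp ((∑ k, c k * V k ω : ℝ) * Complex.I) ∂P := by
      intro V hV c
      rw [charFun_apply, integral_map (aemeasurable_toLp hV s) (by fun_prop)]
      refine integral_congr_ae (Eventually.of_forall fun ω => ?_)
      simp [PiLp.inner_apply]
    refine tendsto_of_seq_tendsto fun ns hns => ?_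
    refine ProbabilityMeasure.tendsto_iff_tendsto_charFun.2 fun c => ?_
    change Tendsto (fun n => charFun (P.map fun ω =>
      (WithLp.toLp 2 fun k : s => W (ns n) k ω : EuclideanSpace ℝ s)) c) atTop
      (𝓝 (charFun (P.map fun ω => (WithLp.toLp 2 fun k : s => Z k ω : EuclideanSpace ℝ s)) c))
    rw [hch Z hZ c]
    simp_rw [fun n => hch (W (ns n)) (hW (ns n)) c]
    exact (h c).comp hns

/-- Weak convergence of continuous processes from convergence of the finite-dimensional
distributions and equicontinuity in probability. -/
theorem tendstoInDistribution_path {ι : Type*} {l : Filter ι} [l.IsCountablyGenerated]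
    {W : ι → ℝ → Ω → ℝ} {Z : ℝ → Ω → ℝ} (hW : ∀ i t, AEMeasurable (W i t) P)
    (hZ : ∀ t, AEMeasurable (Z t) P)
    (hWc : ∀ i, ∀ᵐ ω ∂P, ContinuousOn (fun t => W i t ω) (Set.Icc a b))
    (hZc : ∀ᵐ ω ∂P, ContinuousOn (fun t => Z t ω) (Set.Icc a b))
    (hosc : ∀ η > 0, ∃ δ > 0, (∀ i, P (oscEvent a b (W i) δ η) ≤ ENNReal.ofReal η) ∧
      P (oscEvent a b Z δ η) ≤ ENNReal.ofReal η)
    (h : ∀ (s : Finset ℝ) (c : s → ℝ),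
      Tendsto (fun i => ∫ ω, Complex.exp ((∑ k, c k * W i k ω : ℝ) * Complex.I) ∂P) l
      (𝓝 (∫ ω, Complex.exp ((∑ k, c k * Z k ω : ℝ) * Complex.I) ∂P))) :
    TendstoInDistribution (fun i => path a b (W i)) l (path a b Z) (fun _ => P) P where
  forall_aemeasurable i := aemeasurable_path (hW i) (hWc i)
  aemeasurable_limit := aemeasurable_path hZ hZc
  tendsto := by
    refine tendsto_iff_forall_lipschitz_integral_tendsto.2 fun F hFb hFl => ?_
    obtain ⟨K, hK⟩ := hFl
    obtain ⟨B, hB⟩ : ∃ B, ∀ w, |F w| ≤ B := by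
      obtain ⟨C, hC⟩ := hFb
      refine ⟨|F 0| + C, fun w => ?_⟩
      have := hC w 0
      rw [Real.dist_eq] at this
      have h2 := abs_sub_abs_le_abs_sub (F w) (F 0)
      linarith
    have hB0 : 0 ≤ B := (abs_nonneg _).trans (hB 0)
    have hmap : ∀ V : Ω → C(Set.Icc a b, ℝ), AEMeasurable V P →
        ∫ x, F x ∂(P.map V) = ∫ ω, F (V ω) ∂P := fun V hV =>
      integral_map hV hK.continuous.aestronglyMeasurable
    change Tendsto (fun i => ∫ x, F x ∂(P.map (path a b (W i)))) l
      (𝓝 (∫ x, F x ∂(P.map (path a b Z))))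
    rw [hmap _ (aemeasurable_path hZ hZc)]
    simp_rw [fun i => hmap _ (aemeasurable_path (hW i) (hWc i))]
    refine Metric.tendsto_nhds.2 fun ε hε => ?_
    set η : ℝ := ε / (4 * (K + 2 * B + 1)) with hη
    have hKB : 0 < (K : ℝ) + 2 * B + 1 := by positivity
    have hη0 : 0 < η := by positivity
    have hηb : (K + 2 * B) * η ≤ ε / 4 := by
      have : (K + 2 * B + 1) * η = ε / 4 := by rw [hη]; field_simp
      linarith
    obtain ⟨δ, hδ, hoW, hoZ⟩ := hosc η hη0
    obtain ⟨s, Φ, hs, hΦc, hΦ⟩ := exists_interpolation a b hδ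
    have hfd := (tendstoInDistribution_toLp hW hZ s (h s)).continuous_comp hΦc
    have h3 : Tendsto (fun i => ∫ x, F x ∂(P.map (Φ ∘ fun ω =>
        (WithLp.toLp 2 fun k : s => W i k ω : EuclideanSpace ℝ s)))) l (𝓝 (∫ x, F x ∂(P.map (Φ ∘
        fun ω => (WithLp.toLp 2 fun k : s => Z k ω : EuclideanSpace ℝ s))))) :=
      tendsto_iff_forall_lipschitz_integral_tendsto.1 hfd.tendsto F hFb ⟨K, hK⟩
    rw [hmap _ hfd.aemeasurable_limit] at h3
    simp_rw [fun i => hmap _ (hfd.forall_aemeasurable i)] at h3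
    filter_upwards [Metric.tendsto_nhds.1 h3 (ε / 4) (by positivity)] with i hi
    have e1 := abs_integral_interpolation_sub_le hΦc hΦ (hW i) (hWc i) hη0.le (hoW i) hK hB
    have e2 := abs_integral_interpolation_sub_le hΦc hΦ hZ hZc hη0.le hoZ hK hB
    rw [Real.dist_eq] at hi ⊢
    simp only [Function.comp_apply] at hi
    rw [abs_lt] at hi ⊢
    rw [abs_le] at e1 e2
    constructor <;> linarith [e1.1, e1.2, e2.1, e2.2, hi.1, hi.2]

end WeakConvergence

end Correlogram

namespace Correlogram

/-! ### The supremum of a Gaussian process has no positive atoms -/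

section Atoms

theorem pi_absolutelyContinuous {n : ℕ} {μ ν : Fin n → Measure ℝ} [∀ i, SigmaFinite (μ i)]
    [∀ i, SigmaFinite (ν i)] (h : ∀ i, μ i ≪ ν i) : Measure.pi μ ≪ Measure.pi ν := by
  induction n with
  | zero => rw [Measure.pi_of_empty, Measure.pi_of_empty]
  | succ n ih =>
    have h1 := (measurePreserving_piFinSuccAbove μ 0).symm.map_eq
    have h2 := (measurePreserving_piFinSuccAbove ν 0).symm.map_eq
    rw [← h1, ← h2]
    exact ((h 0).prod (ih fun j => h _)).map (MeasurableEquiv.measurable _)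

theorem exists_orthonormal_residual {E : Type*} [NormedAddCommGroup E] [InnerProductSpace ℝ E]
    {F : Set E} (hF : F.Finite) :
    ∃ (n : ℕ) (e : Fin n → E) (R : E →ₗ[ℝ] E), Orthonormal ℝ e ∧
      (∀ φ, φ = (∑ k, inner ℝ (e k) φ • e k) + R φ) ∧ (∀ k φ, inner ℝ (e k) (R φ) = 0) ∧
      (∀ φ ∈ F, R φ = 0) ∧ ∀ φ, ‖R φ‖ ≤ ‖φ‖ := by
  let V := Submodule.span ℝ F
  have : FiniteDimensional ℝ V := FiniteDimensional.span_of_finite ℝ hF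
  let b := stdOrthonormalBasis ℝ V
  let e : Fin (Module.finrank ℝ V) → E := fun k => b k
  have he : Orthonormal ℝ e := b.orthonormal.comp_linearIsometry V.subtypeₗᵢ
  let A : E →ₗ[ℝ] E := ∑ k, (innerₛₗ ℝ (e k)).smulRight (e k)
  have hA : ∀ φ, A φ = ∑ k, inner ℝ (e k) φ • e k := fun φ => by simp [A, LinearMap.sum_apply]
  have hR : ∀ k φ, inner ℝ (e k) (φ - A φ) = 0 := by
    intro k φ
    rw [inner_sub_right, hA, he.inner_right_fintype, sub_self]
  refine ⟨_, e, LinearMap.id - A, he, fun φ => ?_, fun k φ => hR k φ, fun φ hφ => ?_, fun φ => ?_⟩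
  · rw [LinearMap.sub_apply, LinearMap.id_apply, hA]; abel
  · rw [LinearMap.sub_apply, LinearMap.id_apply, hA, sub_eq_zero]
    have := congrArg (Subtype.val) (b.sum_repr' ⟨φ, Submodule.subset_span hφ⟩)
    simpa using this.symm
  · rw [LinearMap.sub_apply, LinearMap.id_apply]
    have h0 : inner ℝ (A φ) (φ - A φ) = 0 := by
      rw [hA φ, sum_inner]
      refine Finset.sum_eq_zero fun k _ => ?_
      rw [real_inner_smul_left, ← hA, hR, mul_zero]
    have h1 := norm_add_sq_real (A φ) (φ - A φ)
    rw [h0, add_sub_cancel] at h1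
    refine abs_le_of_sq_le_sq' ?_ (norm_nonneg _) |>.2
    nlinarith [sq_nonneg ‖A φ‖]

/-- The boundary of the convex set `{ξ : sup_j |⟨ξ, G_j⟩ + w_j| ≤ x}` is a null set. -/
theorem volume_sup_eq_null {n : ℕ} (G : ℕ → Fin n → ℝ) (w : ℕ → ℝ) {η x : ℝ} (hx : η < x)
    (hw : ∀ j, |w j| ≤ η) :
    volume {ξ : Fin n → ℝ | (∀ j, |∑ k, ξ k * G j k + w j| ≤ x) ∧
      ∀ y < x, ∃ j, y < |∑ k, ξ k * G j k + w j|} = 0 := by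
  let C : Set (Fin n → ℝ) := {ξ | ∀ j, |∑ k, ξ k * G j k + w j| ≤ x}
  have hconv : Convex ℝ C := by
    intro ξ hξ ζ hζ p q hp hq hpq j
    have e : ∑ k, (p • ξ + q • ζ) k * G j k + w j =
        p * (∑ k, ξ k * G j k + w j) + q * (∑ k, ζ k * G j k + w j) := by
      simp only [Pi.add_apply, Pi.smul_apply, smul_eq_mul, add_mul, Finset.sum_add_distrib, mul_add,
        Finset.mul_sum]
      have : w j = p * w j + q * w j := by rw [← add_mul, hpq, one_mul]
      simp only [mul_assoc]
      linarith
    rw [e]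
    refine (abs_add_le _ _).trans ?_
    rw [abs_mul, abs_mul, abs_of_nonneg hp, abs_of_nonneg hq]
    have h1 := mul_le_mul_of_nonneg_left (hξ j) hp
    have h2 := mul_le_mul_of_nonneg_left (hζ j) hq
    have : x = p * x + q * x := by rw [← add_mul, hpq, one_mul]
    linarith
  refine measure_mono_null ?_ (hconv.addHaar_frontier volume)
  rintro ξ ⟨h1, h2⟩
  refine ⟨subset_closure h1, fun hint => ?_⟩
  have hcont : Tendsto (fun ε : ℝ => (1 + ε) • ξ) (𝓝[>] 0) (𝓝 ξ) := by
    have : Tendsto (fun ε : ℝ => (1 + ε) • ξ) (𝓝 0) (𝓝 ((1 + 0 : ℝ) • ξ)) :=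
      Continuous.tendsto (by fun_prop) 0
    rw [add_zero, one_smul] at this
    exact this.mono_left nhdsWithin_le_nhds
  obtain ⟨ε, hε, hε0⟩ := ((hcont.eventually (isOpen_interior.mem_nhds hint)).and
    self_mem_nhdsWithin).exists
  replace hε0 : 0 < ε := hε0
  have hC := interior_subset hε
  have hy : (x + ε * η) / (1 + ε) < x := by
    rw [div_lt_iff₀ (by positivity)]
    nlinarith
  obtain ⟨j, hj⟩ := h2 _ hy
  have h3 := hC j
  have e : (1 + ε) * (∑ k, ξ k * G j k + w j) = (∑ k, ((1 + ε) • ξ) k * G j k + w j) + ε * w j := by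
    simp only [Pi.smul_apply, smul_eq_mul, mul_add, Finset.mul_sum, mul_assoc]
    ring
  have h4 : (1 + ε) * |∑ k, ξ k * G j k + w j| ≤ x + ε * η := by
    rw [← abs_of_pos (by positivity : 0 < 1 + ε), ← abs_mul, e]
    refine (abs_add_le _ _).trans (add_le_add h3 ?_)
    rw [abs_mul, abs_of_pos hε0]
    exact mul_le_mul_of_nonneg_left (hw j) hε0.le
  rw [div_lt_iff₀ (by positivity)] at hj
  linarith

variable {Ω : Type*} [MeasurableSpace Ω] {P : Measure Ω} [IsProbabilityMeasure P]
  {S : Submodule ℝ (Lp ℝ 2 P)}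

theorem IsGaussianSubspace.hasExpIncrements (hS : IsGaussianSubspace S) {z : ℝ → S}
    {d : ℝ → ℝ → ℝ} (hz : ∀ s t, ‖z s - z t‖ ≤ d s t) :
    HasExpIncrements P (fun t ω => (z t : Lp ℝ 2 P) ω) d where
  aemeasurable t := aemeasurable_Lp _
  lintegral_le s t r hr hd := by
    refine le_trans (lintegral_mono_ae ?_) (hS.lintegral_exp_abs_le_of_mem (z s - z t).2 hr
      ((hz s t).trans hd))
    filter_upwards [Lp.coeFn_sub (z s : Lp ℝ 2 P) (z t : Lp ℝ 2 P)] with ω hω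
    rw [Submodule.coe_sub, hω, Pi.sub_apply]

theorem IsGaussianSubspace.measure_sup_eq_null_aux (hS : IsGaussianSubspace S) {n : ℕ}
    {e : Fin n → S} (he : Orthonormal ℝ e) (v : ℕ → S) (hv : ∀ k j, inner ℝ (e k) (v j) = 0)
    (G : ℕ → Fin n → ℝ) {η x : ℝ} (hx : η < x) :
    P {ω | (∀ j, |(v j : Lp ℝ 2 P) ω| ≤ η) ∧
      (∀ j, |∑ k, (e k : Lp ℝ 2 P) ω * G j k + (v j : Lp ℝ 2 P) ω| ≤ x) ∧
      ∀ y < x, ∃ j, y < |∑ k, (e k : Lp ℝ 2 P) ω * G j k + (v j : Lp ℝ 2 P) ω|} = 0 := by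
  let A : Set ((ℕ → ℝ) × (Fin n → ℝ)) := {p | (∀ j, |p.1 j| ≤ η) ∧
    (∀ j, |∑ k, p.2 k * G j k + p.1 j| ≤ x) ∧
    ∀ y : ℚ, (y : ℝ) < x → ∃ j, (y : ℝ) < |∑ k, p.2 k * G j k + p.1 j|}
  have hA : MeasurableSet A := by
    have hm : ∀ j, Measurable fun p : (ℕ → ℝ) × (Fin n → ℝ) => |∑ k, p.2 k * G j k + p.1 j| := by
      intro j
      have : Continuous fun p : (ℕ → ℝ) × (Fin n → ℝ) => |∑ k, p.2 k * G j k + p.1 j| := by fun_prop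
      exact this.measurable
    have h1 : MeasurableSet {p : (ℕ → ℝ) × (Fin n → ℝ) | ∀ j, |p.1 j| ≤ η} := by
      simp only [Set.ofPred_forall]
      exact MeasurableSet.iInter fun j => measurableSet_le (by fun_prop) measurable_const
    have h2 : MeasurableSet {p : (ℕ → ℝ) × (Fin n → ℝ) | ∀ j, |∑ k, p.2 k * G j k + p.1 j| ≤ x} := by
      simp only [Set.ofPred_forall]
      exact MeasurableSet.iInter fun j => measurableSet_le (hm j) measurable_const
    have h3 : MeasurableSet {p : (ℕ → ℝ) × (Fin n → ℝ) | ∀ y : ℚ, (y : ℝ) < x →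
        ∃ j, (y : ℝ) < |∑ k, p.2 k * G j k + p.1 j|} := by
      simp only [Set.ofPred_forall, Set.ofPred_exists]
      exact MeasurableSet.iInter fun y => MeasurableSet.iInter fun _ => MeasurableSet.iUnion fun j =>
        measurableSet_lt measurable_const (hm j)
    exact h1.inter (h2.inter h3)
  let ev : Ω → Fin n → ℝ := fun ω k => (e k : Lp ℝ 2 P) ω
  let vv : Ω → ℕ → ℝ := fun ω j => (v j : Lp ℝ 2 P) ω
  have mev : AEMeasurable ev P := aemeasurable_pi_lambda _ fun k => aemeasurable_Lp _
  have mvv : AEMeasurable vv P := aemeasurable_pi_lambda _ fun k => aemeasurable_Lp _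
  have hind : IndepFun ev vv P := by
    refine IsGaussianProcess.indepFun_of_covariance_eq_zero (X := fun k ω => (e k : Lp ℝ 2 P) ω)
      (Y := fun j ω => (v j : Lp ℝ 2 P) ω) ?_ (fun k => aemeasurable_Lp _)
      (fun k => aemeasurable_Lp _) fun k j => (hS.covariance_eq_inner _ _).trans (hv k j)
    have := hS.isGaussianProcess (Sum.elim e v)
    convert this using 1
    funext i
    cases i <;> rfl
  have hac : P.map ev ≪ volume := by
    rw [(hS.iIndepFun_orthonormal he).map_fun_eq_pi_map fun k => aemeasurable_Lp _]
    rw [volume_pi]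
    refine pi_absolutelyContinuous (μ := fun k => P.map (e k : Lp ℝ 2 P)) fun k => ?_
    rw [hS.map_orthonormal he k]
    exact gaussianReal_absolutelyContinuous 0 (by norm_num)
  have hnull : P.map (fun ω => (vv ω, ev ω)) A = 0 := by
    rw [(indepFun_iff_map_prod_eq_prod_map_map mvv mev).1 hind.symm, Measure.measure_prod_null hA]
    refine Eventually.of_forall fun w => hac ?_
    by_cases hw : ∀ j, |w j| ≤ η
    · refine measure_mono_null ?_ (volume_sup_eq_null G w hx hw)
      rintro ξ ⟨-, h2, h3⟩
      refine ⟨h2, fun y hy => ?_⟩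
      obtain ⟨q, hyq, hqx⟩ := exists_rat_btwn hy
      obtain ⟨j, hj⟩ := h3 q hqx
      exact ⟨j, hyq.trans hj⟩
    · refine measure_mono_null (t := ∅) ?_ measure_empty
      rintro ξ ⟨h1, -⟩
      exact hw h1
  rw [Measure.map_apply_of_aemeasurable (mvv.prodMk mev) hA] at hnull
  refine measure_mono_null ?_ hnull
  rintro ω ⟨h1, h2, h3⟩
  exact ⟨h1, h2, fun y hy => h3 y hy⟩

variable {H : ℝ → ℝ}

theorem IsGaussianSubspace.measure_sup_eq_null (hS : IsGaussianSubspace S) (hH : MemLp H 2 volume)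
    (hE : EntropyIntegralFinite (sqrtSigma H hH) (Set.Icc 0 1)) {L : ℝ} (hL : 0 < L) {z : ℝ → S}
    (hz : ∀ s t, ‖z s - z t‖ ≤ L * sigma H hH s t) {a b : ℝ} {u : ℕ → ℝ}
    (hu : ∀ j, u j ∈ Set.Icc a b) {x : ℝ} (hx : 0 < x) :
    P {ω | (∀ j, |(z (u j) : Lp ℝ 2 P) ω| ≤ x) ∧ ∀ y < x, ∃ j, y < |(z (u j) : Lp ℝ 2 P) ω|} = 0 := by
  refine nonpos_iff_eq_zero.1 (le_of_forall_pos_le_add fun ε hε => ?_)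
  rw [zero_add]
  obtain ⟨η, hη, hηx, hηε⟩ : ∃ η : ℝ, 0 < η ∧ η < x ∧ ENNReal.ofReal η ≤ ε := by
    rcases eq_or_ne ε ⊤ with rfl | htop
    · exact ⟨x / 2, by positivity, by linarith, le_top⟩
    · have h0 : 0 < ε.toReal := ENNReal.toReal_pos hε.ne' htop
      refine ⟨min (x / 2) ε.toReal, by positivity, (min_le_left _ _).trans_lt (by linarith), ?_⟩
      exact (ENNReal.ofReal_le_ofReal (min_le_right _ _)).trans_eq (ENNReal.ofReal_toReal htop)
  obtain ⟨δ, hδ, hmod⟩ := exists_forall_measure_modulus_le (P := P) hH hE a b hL hη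
  have htb : TotallyBounded (Set.range u) :=
    (isCompact_Icc (a := a) (b := b)).totallyBounded.subset (by rintro _ ⟨j, rfl⟩; exact hu j)
  obtain ⟨F, hFu, hF, hcov⟩ := Metric.finite_approx_of_totallyBounded htb δ hδ
  obtain ⟨n, e, R, he, hdec, horth, hR0, hRn⟩ := exists_orthonormal_residual (hF.image z)
  have hinc : HasExpIncrements P (fun t ω => (R (z t) : Lp ℝ 2 P) ω)
      (fun s t => L * sigma H hH s t) := by
    refine hS.hasExpIncrements (z := fun t => R (z t)) fun s t => ?_
    rw [← map_sub]
    exact (hRn _).trans (hz s t)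
  have hbad := hmod _ hinc u hu
  have hnull := hS.measure_sup_eq_null_aux he (fun j => R (z (u j))) (fun k j => horth k _)
    (fun j k => inner ℝ (e k) (z (u j))) hηx
  have hae : ∀ᵐ ω ∂P, ∀ j, (z (u j) : Lp ℝ 2 P) ω =
      ∑ k, (e k : Lp ℝ 2 P) ω * inner ℝ (e k) (z (u j)) + (R (z (u j)) : Lp ℝ 2 P) ω := by
    rw [ae_all_iff]
    intro j
    have h1 : (z (u j) : Lp ℝ 2 P) = (∑ k, inner ℝ (e k) (z (u j)) • (e k : Lp ℝ 2 P)) +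
        (R (z (u j)) : Lp ℝ 2 P) := by
      have := congrArg (Subtype.val) (hdec (z (u j)))
      simpa using this
    have h2 := Lp.coeFn_add (∑ k, inner ℝ (e k) (z (u j)) • (e k : Lp ℝ 2 P))
      (R (z (u j)) : Lp ℝ 2 P)
    rw [← h1] at h2
    filter_upwards [h2, coeFn_finset_sum_smul Finset.univ (fun k => inner ℝ (e k) (z (u j)))
      (fun k => (e k : Lp ℝ 2 P))] with ω h3 h4
    rw [h3, Pi.add_apply, h4]
    simp_rw [mul_comm]
  have hzero : ∀ᵐ ω ∂P, ∀ t ∈ F, (R (z t) : Lp ℝ 2 P) ω = 0 := by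
    rw [ae_ball_iff hF.countable]
    intro t ht
    rw [hR0 _ (Set.mem_image_of_mem z ht)]
    exact Lp.coeFn_zero ℝ 2 P
  refine le_trans ?_ (hbad.trans hηε)
  refine (measure_mono_ae ?_).trans ((measure_union_le _ _).trans_eq
    ((congrArg (· + _) hnull).trans (zero_add _)))
  filter_upwards [hae, hzero] with ω h1 h2 h3
  by_cases hW : ∀ j, |(R (z (u j)) : Lp ℝ 2 P) ω| ≤ η
  · left
    refine ⟨hW, ?_⟩
    obtain ⟨h4, h5⟩ := h3
    simp_rw [h1] at h4 h5
    exact ⟨h4, h5⟩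
  · right
    push Not at hW
    obtain ⟨j, hj⟩ := hW
    obtain ⟨t, ht, hjt⟩ := Set.mem_iUnion₂.1 (hcov ⟨j, rfl⟩)
    obtain ⟨i, rfl⟩ := hFu ht
    refine ⟨j, i, ?_, ?_⟩
    · rw [Metric.mem_ball, Real.dist_eq] at hjt
      exact hjt.le
    · rw [h2 _ ht, sub_zero]
      exact hj

end Atoms

end Correlogram

namespace Correlogram

/-! ### Mean-square calculus -/

section MeanSquare

variable {Ω : Type*} [MeasurableSpace Ω] {P : Measure Ω}

theorem IsMSLimit.ae_eq {ι : Type*} {l : Filter ι} [l.NeBot] {ξ : ι → Ω → ℝ} {η η' : Ω → ℝ}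
    (h : IsMSLimit P l ξ η) (h' : IsMSLimit P l ξ η') : η =ᵐ[P] η' := by
  have hle : ∀ i, eLpNorm (fun ω => η ω - η' ω) 2 P ≤
      eLpNorm (fun ω => ξ i ω - η ω) 2 P + eLpNorm (fun ω => ξ i ω - η' ω) 2 P := by
    intro i
    have e : (fun ω => η ω - η' ω) = (fun ω => ξ i ω - η' ω) - fun ω => ξ i ω - η ω := by
      funext ω; simp
    rw [e, add_comm]
    exact eLpNorm_sub_le ((h.1 i).sub h'.2.1).1 ((h.1 i).sub h.2.1).1 (by norm_num)
  have h0 : eLpNorm (fun ω => η ω - η' ω) 2 P ≤ 0 := by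
    have hlim := h.2.2.add h'.2.2
    rw [add_zero] at hlim
    exact ge_of_tendsto hlim (Eventually.of_forall hle)
  have h1 := (eLpNorm_eq_zero_iff (h.2.1.sub h'.2.1).1 (by norm_num)).1 (nonpos_iff_eq_zero.1 h0)
  filter_upwards [h1] with ω hω
  exact sub_eq_zero.1 hω

theorem IsMSLimit.msLimit_ae_eq {ι : Type*} {l : Filter ι} [l.NeBot] {ξ : ι → Ω → ℝ} {η : Ω → ℝ}
    (h : IsMSLimit P l ξ η) : msLimit P l ξ =ᵐ[P] η := by
  have hex : ∃ η, IsMSLimit P l ξ η := ⟨η, h⟩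
  rw [msLimit, dif_pos hex]
  exact hex.choose_spec.ae_eq h

theorem isMSLimit_of_tendsto {ι : Type*} {l : Filter ι} {ξ : ι → Ω → ℝ} {u : ι → Lp ℝ 2 P}
    {v : Lp ℝ 2 P} (hξ : ∀ i, ξ i =ᵐ[P] u i) (h : Tendsto u l (𝓝 v)) : IsMSLimit P l ξ v := by
  refine ⟨fun i => (memLp_congr_ae (hξ i)).2 (Lp.memLp _), Lp.memLp v, ?_⟩
  have h1 : ∀ i, eLpNorm (fun ω => ξ i ω - v ω) 2 P = edist (u i) v := by
    intro i
    rw [Lp.edist_def]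
    refine eLpNorm_congr_ae ?_
    filter_upwards [hξ i] with ω hω
    rw [hω]; rfl
  simp_rw [h1]
  exact tendsto_iff_edist_tendsto_0.1 h

theorem IsMSRiemannIntegral.ae_eq {ξ : ℝ → Ω → ℝ} {T : ℝ} (hT : 0 < T) {J J' : Ω → ℝ}
    (h : IsMSRiemannIntegral P ξ 0 T J) (h' : IsMSRiemannIntegral P ξ 0 T J') : J =ᵐ[P] J' := by
  have h0 : eLpNorm (fun ω => J ω - J' ω) 2 P ≤ 0 := by
    refine le_of_forall_pos_le_add fun ε hε => ?_
    rw [zero_add]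
    obtain ⟨e, he, hee⟩ : ∃ e : ℝ, 0 < e ∧ ENNReal.ofReal e + ENNReal.ofReal e ≤ ε := by
      rcases eq_or_ne ε ⊤ with rfl | htop
      · exact ⟨1, one_pos, le_top⟩
      · have h0 : 0 < ε.toReal := ENNReal.toReal_pos hε.ne' htop
        refine ⟨ε.toReal / 2, by positivity, ?_⟩
        rw [← ENNReal.ofReal_add (by positivity) (by positivity), add_halves,
          ENNReal.ofReal_toReal htop]
    obtain ⟨δ, hδ, h1⟩ := h.2.2 e he
    obtain ⟨δ', hδ', h2⟩ := h'.2.2 e he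
    obtain ⟨n, hn⟩ := exists_nat_gt (T / min δ δ')
    have hm : 0 < min δ δ' := lt_min hδ hδ'
    have hn0 : (0 : ℝ) < n := lt_of_le_of_lt (by positivity) hn
    have hstep : T / n < min δ δ' := by
      rw [div_lt_iff₀ hm] at hn
      rw [div_lt_iff₀ hn0]; linarith
    let t : ℕ → ℝ := fun i => i * (T / n)
    have ht : ∀ i, t (i + 1) - t i = T / n := fun i => by simp only [t]; push_cast; ring
    have hTn : 0 < T / n := by positivity
    have ht0 : t 0 = 0 := by simp [t]
    have htn : t n = T := by simp only [t]; field_simp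
    have k1 := h1 n t t ht0 htn fun i _ => ⟨le_rfl, by linarith [ht i], by
      rw [ht]; exact hstep.trans_le (min_le_left _ _)⟩
    have k2 := h2 n t t ht0 htn fun i _ => ⟨le_rfl, by linarith [ht i], by
      rw [ht]; exact hstep.trans_le (min_le_right _ _)⟩
    have hmem : MemLp (fun ω => ∑ i ∈ Finset.range n, ξ (t i) ω * (t (i + 1) - t i)) 2 P := by
      refine memLp_finsetSum _ fun i hi => (h.1 (t i) ?_).mul_const _
      have hi' : (i : ℝ) ≤ n := by exact_mod_cast (Finset.mem_range.1 hi).le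
      refine ⟨by positivity, ?_⟩
      rw [← htn]
      exact mul_le_mul_of_nonneg_right hi' hTn.le
    have e1 : (fun ω => J ω - J' ω) =
        (fun ω => (∑ i ∈ Finset.range n, ξ (t i) ω * (t (i + 1) - t i)) - J' ω) -
        fun ω => (∑ i ∈ Finset.range n, ξ (t i) ω * (t (i + 1) - t i)) - J ω := by
      funext ω; simp
    rw [e1]
    exact (eLpNorm_sub_le (hmem.sub h'.2.1).1 (hmem.sub h.2.1).1 (by norm_num)).trans
      ((add_le_add k2 k1).trans hee)
  have h1 := (eLpNorm_eq_zero_iff (h.2.1.sub h'.2.1).1 (by norm_num)).1 (nonpos_iff_eq_zero.1 h0)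
  filter_upwards [h1] with ω hω
  exact sub_eq_zero.1 hω

theorem IsMSRiemannIntegral.msRiemannIntegral_ae_eq {ξ : ℝ → Ω → ℝ} {T : ℝ} (hT : 0 < T)
    {J : Ω → ℝ} (h : IsMSRiemannIntegral P ξ 0 T J) : msRiemannIntegral P ξ 0 T =ᵐ[P] J := by
  have hex : ∃ J, IsMSRiemannIntegral P ξ 0 T J := ⟨J, h⟩
  rw [msRiemannIntegral, dif_pos hex]
  exact hex.choose_spec.ae_eq hT h

theorem norm_riemannSum_sub_integral_le {E : Type*} [NormedAddCommGroup E] [NormedSpace ℝ E]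
    [CompleteSpace E] {q : ℝ → E} (hq : Continuous q) {ε δ T : ℝ}
    (hδ : ∀ r ∈ Set.Icc 0 T, ∀ r' ∈ Set.Icc 0 T, |r - r'| < δ → ‖q r - q r'‖ ≤ ε)
    {n : ℕ} {t s : ℕ → ℝ} (ht0 : t 0 = 0) (htn : t n = T)
    (hts : ∀ i < n, t i ≤ s i ∧ s i ≤ t (i + 1) ∧ t (i + 1) - t i < δ) :
    ‖∑ i ∈ Finset.range n, (t (i + 1) - t i) • q (s i) - ∫ r in (0 : ℝ)..T, q r‖ ≤ ε * T := by
  have hmono : ∀ i < n, t i ≤ t (i + 1) := fun i hi => (hts i hi).1.trans (hts i hi).2.1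
  have hpos : ∀ i ≤ n, 0 ≤ t i := by
    intro i hi
    induction i with
    | zero => exact ht0.ge
    | succ k ih => exact (ih (by omega)).trans (hmono k (by omega))
  have hmono' : ∀ m i, i + m ≤ n → t i ≤ t (i + m) := by
    intro m i him
    induction m with
    | zero => exact le_rfl
    | succ k ih => exact (ih (by omega)).trans (hmono (i + k) (by omega))
  have hle : ∀ i ≤ n, t i ≤ T := by
    intro i hi
    have := hmono' (n - i) i (by omega)
    rwa [Nat.add_sub_cancel' hi, htn] at this
  have hsum : ∫ r in (0 : ℝ)..T, q r = ∑ i ∈ Finset.range n, ∫ r in t i..t (i + 1), q r := by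
    rw [intervalIntegral.sum_integral_adjacent_intervals fun k _ => hq.intervalIntegrable _ _,
      ht0, htn]
  have hT : T = ∑ i ∈ Finset.range n, (t (i + 1) - t i) := by
    rw [Finset.sum_range_sub, ht0, htn, sub_zero]
  rw [hsum, ← Finset.sum_sub_distrib]
  conv_rhs => rw [hT, Finset.mul_sum]
  refine (norm_sum_le _ _).trans (Finset.sum_le_sum fun i hi => ?_)
  have hi' := Finset.mem_range.1 hi
  obtain ⟨h1, h2, h3⟩ := hts i hi'
  rw [← intervalIntegral.integral_const, ← intervalIntegral.integral_sub
    (intervalIntegrable_const) (hq.intervalIntegrable _ _)]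
  refine (intervalIntegral.norm_integral_le_of_norm_le_const (C := ε) fun r hr => ?_).trans_eq ?_
  · rw [Set.uIoc_of_le (hmono i hi')] at hr
    refine hδ _ ⟨(hpos i hi'.le).trans h1, h2.trans (hle _ hi')⟩ _
      ⟨(hpos i hi'.le).trans hr.1.le, hr.2.trans (hle _ hi')⟩ ?_
    rw [abs_lt]
    constructor <;> linarith [hr.1, hr.2]
  · rw [abs_of_nonneg (by linarith [hmono i hi'])]

variable [IsProbabilityMeasure P]

/-- A mean-square continuous process has a mean-square Riemann integral. -/
theorem isMSRiemannIntegral_of_continuous {ξ : ℝ → Ω → ℝ} {q : ℝ → Lp ℝ 2 P} (hq : Continuous q)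
    (hξ : ∀ t, ξ t =ᵐ[P] q t) {T : ℝ} (hT : 0 < T) :
    IsMSRiemannIntegral P ξ 0 T (∫ t in (0 : ℝ)..T, q t : Lp ℝ 2 P) := by
  refine ⟨fun t _ => (memLp_congr_ae (hξ t)).2 (Lp.memLp _), Lp.memLp _, fun ε hε => ?_⟩
  have hu := isCompact_Icc.uniformContinuousOn_of_continuous (hq.continuousOn (s := Set.Icc 0 T))
  obtain ⟨δ, hδ, h⟩ := Metric.uniformContinuousOn_iff.1 hu (ε / T) (by positivity)
  refine ⟨δ, hδ, fun n t s ht0 htn hts => ?_⟩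
  have hb := norm_riemannSum_sub_integral_le hq (ε := ε / T) (δ := δ) (T := T)
    (fun r hr r' hr' hrr => by
      have := h r hr r' hr' (by rwa [Real.dist_eq])
      rw [dist_eq_norm] at this
      exact this.le) ht0 htn hts
  rw [div_mul_cancel₀ _ hT.ne'] at hb
  have hae : (fun ω => (∑ i ∈ Finset.range n, ξ (s i) ω * (t (i + 1) - t i)) -
      (∫ t in (0 : ℝ)..T, q t : Lp ℝ 2 P) ω) =ᵐ[P]
      (∑ i ∈ Finset.range n, (t (i + 1) - t i) • q (s i) - ∫ r in (0 : ℝ)..T, q r : Lp ℝ 2 P) := by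
    have h2 : ∀ᵐ ω ∂P, ∀ i, ξ (s i) ω = q (s i) ω := ae_all_iff.2 fun i => hξ (s i)
    filter_upwards [Lp.coeFn_sub (∑ i ∈ Finset.range n, (t (i + 1) - t i) • q (s i))
      (∫ r in (0 : ℝ)..T, q r : Lp ℝ 2 P), coeFn_finset_sum_smul (Finset.range n)
      (fun i => t (i + 1) - t i) (fun i => q (s i)), h2] with ω h3 h4 h5
    rw [h3, Pi.sub_apply, h4]
    simp_rw [h5, mul_comm]
  rw [eLpNorm_congr_ae hae, ← ENNReal.ofReal_toReal (Lp.eLpNorm_ne_top _), ← Lp.norm_def]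
  exact ENNReal.ofReal_le_ofReal hb

end MeanSquare

end Correlogram

namespace Correlogram

/-! ### The normalized correlogram in the second chaos -/

section Zeta

variable {Ω : Type*} [MeasurableSpace Ω] {P : Measure Ω} [IsProbabilityMeasure P]
  {S : Submodule ℝ (Lp ℝ 2 P)} [CompleteSpace S] {x : ℝ → S} {f : ℝ → ℝ} {M : ℝ}

/-- `(1/(c√T)) ∫₀ᵀ :y(t) x(t): dt`, where `y` is the response of `x` to `G`. -/
noncomputable def zeta (hS : IsGaussianSubspace S) (hx : IsSpectralCurve x f M) (c T : ℝ)
    (G : Lp ℝ 2 (volume : Measure ℝ)) : Lp ℝ 2 P :=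
  (1 / (c * √T)) • ∫ t in (0 : ℝ)..T, hS.wick (hx.resp G t) (x t)

variable (hS : IsGaussianSubspace S) (hx : IsSpectralCurve x f M)

theorem continuous_wick_resp (G : Lp ℝ 2 (volume : Measure ℝ)) (τ : ℝ) :
    Continuous fun t => hS.wick (hx.resp G (t + τ)) (x t) := by
  have h1 : Continuous fun t => hx.resp G (t + τ) := (hx.continuous_resp G).comp (by fun_prop)
  have h2 := hx.continuous
  fun_prop

theorem continuous_wick_resp_zero (G : Lp ℝ 2 (volume : Measure ℝ)) :
    Continuous fun t => hS.wick (hx.resp G t) (x t) := by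
  simpa using continuous_wick_resp hS hx G 0

theorem zeta_add (c T : ℝ) (G K : Lp ℝ 2 (volume : Measure ℝ)) :
    zeta hS hx c T (G + K) = zeta hS hx c T G + zeta hS hx c T K := by
  rw [zeta, zeta, zeta, ← smul_add, ← intervalIntegral.integral_add
    ((continuous_wick_resp_zero hS hx G).intervalIntegrable _ _)
    ((continuous_wick_resp_zero hS hx K).intervalIntegrable _ _)]
  simp_rw [hx.resp_add, map_add, add_apply]

theorem zeta_smul (c T r : ℝ) (G : Lp ℝ 2 (volume : Measure ℝ)) :
    zeta hS hx c T (r • G) = r • zeta hS hx c T G := by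
  rw [zeta, zeta, smul_comm r]
  simp_rw [hx.resp_smul, map_smul, smul_apply]
  rw [intervalIntegral.integral_smul]

theorem zeta_sub (c T : ℝ) (G K : Lp ℝ 2 (volume : Measure ℝ)) :
    zeta hS hx c T (G - K) = zeta hS hx c T G - zeta hS hx c T K := by
  rw [sub_eq_add_neg, ← neg_one_smul ℝ K, zeta_add, zeta_smul, neg_one_smul, sub_eq_add_neg]

theorem zeta_sum {ι : Type*} (s : Finset ι) (c T : ℝ) (r : ι → ℝ)
    (G : ι → Lp ℝ 2 (volume : Measure ℝ)) :
    zeta hS hx c T (∑ i ∈ s, r i • G i) = ∑ i ∈ s, r i • zeta hS hx c T (G i) := by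
  classical
  induction s using Finset.induction_on with
  | empty =>
    have := zeta_smul hS hx c T 0 0
    simpa using this
  | insert i s hi ih =>
    rw [Finset.sum_insert hi, Finset.sum_insert hi, zeta_add, zeta_smul, ih]

theorem inner_zeta (c T : ℝ) (hT : 0 < T) (G : Lp ℝ 2 (volume : Measure ℝ)) (v : Lp ℝ 2 P) :
    inner ℝ (zeta hS hx c T G) v =
      (1 / (c * √T)) * ∫ t in Set.Ioc 0 T, inner ℝ (hS.wick (hx.resp G t) (x t)) v := by
  rw [zeta, real_inner_smul_left, intervalIntegral.integral_of_le hT.le, real_inner_comm]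
  congr 1
  have hint : IntegrableOn (fun t => hS.wick (hx.resp G t) (x t)) (Set.Ioc 0 T) :=
    ((continuous_wick_resp_zero hS hx G).integrableOn_Ioc)
  have := (innerSL ℝ v).integral_comp_comm hint
  simp only [innerSL_apply_apply] at this
  rw [← this]
  simp_rw [real_inner_comm v]

theorem norm_zeta_sq (c T : ℝ) (hT : 0 < T) (G : Lp ℝ 2 (volume : Measure ℝ)) :
    ‖zeta hS hx c T G‖ ^ 2 = hx.quadMoment G T / (c ^ 2 * T) := by
  rw [← real_inner_self_eq_norm_sq, inner_zeta hS hx c T hT]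
  have h1 : ∀ t, inner ℝ (hS.wick (hx.resp G t) (x t)) (zeta hS hx c T G) =
      (1 / (c * √T)) * ∫ s in Set.Ioc 0 T, (inner ℝ (hx.resp G t) (hx.resp G s) * inner ℝ (x t) (x s) +
      inner ℝ (hx.resp G t) (x s) * inner ℝ (x t) (hx.resp G s)) := by
    intro t
    rw [real_inner_comm, inner_zeta hS hx c T hT]
    congr 1
    refine integral_congr_ae (Eventually.of_forall fun s => ?_)
    simp only
    rw [real_inner_comm, hS.inner_wick]
  simp_rw [h1]
  rw [integral_const_mul, ← mul_assoc, IsSpectralCurve.quadMoment]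
  have h2 : (1 / (c * √T)) * (1 / (c * √T)) = 1 / (c ^ 2 * T) := by
    rw [div_mul_div_comm, one_mul, mul_mul_mul_comm, Real.mul_self_sqrt hT.le, sq]
  rw [h2]
  ring

theorem zeta_mem (c T : ℝ) (hT : 0 < T) (G : Lp ℝ 2 (volume : Measure ℝ)) :
    zeta hS hx c T G ∈ hS.wickSpan.topologicalClosure := by
  rw [← Submodule.orthogonal_orthogonal_eq_closure, Submodule.mem_orthogonal']
  intro v hv
  rw [inner_zeta hS hx c T hT]
  have : ∀ t, inner ℝ (hS.wick (hx.resp G t) (x t)) v = 0 := fun t =>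
    (Submodule.mem_orthogonal _ _).1 hv _ (Submodule.subset_span ⟨(hx.resp G t, x t), rfl⟩)
  simp_rw [this]
  simp

theorem norm_zeta_le_aux (c T : ℝ) (hT : 0 < T) (G : Lp ℝ 2 (volume : Measure ℝ)) :
    ‖zeta hS hx c T G‖ ≤
      |1 / (c * √T)| * (2 * √(2 * Real.pi * M) * ‖x 0‖ * T) * ‖G‖ := by
  rw [zeta, norm_smul, Real.norm_eq_abs, mul_assoc]
  refine mul_le_mul_of_nonneg_left ?_ (abs_nonneg _)
  refine (intervalIntegral.norm_integral_le_of_norm_le_const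
    (C := 2 * (√(2 * Real.pi * M) * ‖G‖) * ‖x 0‖) fun t _ => ?_).trans_eq ?_
  · refine (hS.norm_wick_le _ _).trans ?_
    rw [hx.norm_eq t]
    gcongr
    exact hx.norm_resp_le G t
  · rw [sub_zero, abs_of_pos hT]; ring

theorem continuous_zeta (c T : ℝ) (hT : 0 < T) : Continuous (zeta hS hx c T) := by
  let L : Lp ℝ 2 (volume : Measure ℝ) →ₗ[ℝ] Lp ℝ 2 P :=
    { toFun := zeta hS hx c T
      map_add' := zeta_add hS hx c T
      map_smul' := zeta_smul hS hx c T }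
  exact (L.mkContinuous _ (norm_zeta_le_aux hS hx c T hT)).continuous

theorem dense_of_integrable_ft : Dense {G : Lp ℝ 2 (volume : Measure ℝ) | ∃ (g : ℝ → ℝ)
    (hg2 : MemLp g 2 volume), Integrable g ∧ Integrable (ft g) ∧ G = hg2.toLp g} := by
  intro G
  rw [Metric.mem_closure_iff]
  intro ε hε
  obtain ⟨g, hg, hg2, hgf, h⟩ := exists_integrable_ft_approx (Lp.memLp G) (half_pos hε)
  refine ⟨_, ⟨g, hg2, hg, hgf, rfl⟩, ?_⟩
  have h1 : edist G (hg2.toLp g) ≤ ENNReal.ofReal (ε / 2) := by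
    rw [Lp.edist_def]
    refine le_trans (le_of_eq (eLpNorm_congr_ae ?_)) h
    filter_upwards [hg2.coeFn_toLp] with t ht
    rw [Pi.sub_apply, ht]
  rw [edist_dist, ENNReal.ofReal_le_ofReal_iff (by positivity)] at h1
  linarith

theorem norm_zeta_le {c T : ℝ} (hc : 0 < c) (hT : 0 < T) (G : Lp ℝ 2 (volume : Measure ℝ)) :
    ‖zeta hS hx c T G‖ ≤ 3 * Real.pi * M / c * ‖G‖ := by
  have hclosed : IsClosed {G : Lp ℝ 2 (volume : Measure ℝ) |
      ‖zeta hS hx c T G‖ ≤ 3 * Real.pi * M / c * ‖G‖} :=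
    isClosed_le (continuous_zeta hS hx c T hT).norm (by fun_prop)
  refine hclosed.closure_subset_iff.2 ?_ (dense_of_integrable_ft G)
  rintro _ ⟨g, hg2, hg, hgf, rfl⟩
  have hM := hx.M_nonneg
  refine (sq_le_sq₀ (norm_nonneg _) (by positivity)).1 ?_
  rw [norm_zeta_sq hS hx c T hT, div_le_iff₀ (by positivity)]
  refine (hx.quadMoment_le hg hg2 hgf hT).trans ?_
  have hn : ‖hg2.toLp g‖ ^ 2 = ∫ t, g t ^ 2 := by
    rw [← real_inner_self_eq_norm_sq, L2.inner_def]
    refine integral_congr_ae ?_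
    filter_upwards [hg2.coeFn_toLp] with t ht
    rw [ht]
    simp [sq]
  rw [← hn]
  have h1 : (3 * Real.pi * M / c * ‖hg2.toLp g‖) ^ 2 * (c ^ 2 * T) =
      T * (9 * Real.pi ^ 2 * M ^ 2 * ‖hg2.toLp g‖ ^ 2) := by
    field_simp
    ring
  rw [h1]
  gcongr
  norm_num

theorem abs_inner_zeta_wick_le {c T : ℝ} (hc : 0 < c) (hT : 0 < T) {g : ℝ → ℝ} (hg : Integrable g)
    (hg2 : MemLp g 2 volume) (φ : S) :
    |inner ℝ (zeta hS hx c T (hg2.toLp g)) (hS.wick φ φ)| ≤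
      2 * (2 * Real.pi * M * (∫ t, ‖g t‖) / (c * √T)) * ‖φ‖ ^ 2 := by
  rw [inner_zeta hS hx c T hT]
  have h1 : ∀ t, inner ℝ (hS.wick (hx.resp (hg2.toLp g) t) (x t)) (hS.wick φ φ) =
      2 * (inner ℝ (hx.resp (hg2.toLp g) t) φ * inner ℝ (x t) φ) := by
    intro t
    rw [hS.inner_wick]; ring
  simp_rw [h1]
  have hcT : 0 < c * √T := by positivity
  rw [integral_const_mul, abs_mul, abs_mul, abs_of_pos (by positivity : 0 < 1 / (c * √T)), abs_two]
  have h2 := hx.abs_integral_inner_resp_mul_le hg hg2 T φ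
  calc 1 / (c * √T) * (2 * |∫ t in Set.Ioc 0 T,
        inner ℝ (hx.resp (hg2.toLp g) t) φ * inner ℝ (x t) φ|)
      ≤ 1 / (c * √T) * (2 * (2 * Real.pi * M * (∫ t, ‖g t‖) * ‖φ‖ ^ 2)) := by gcongr
    _ = _ := by ring

end Zeta

end Correlogram

namespace Correlogram

/-! ### The input process, the response and the estimator -/

section Input

variable {Ω : Type*} [MeasurableSpace Ω] {P : Measure Ω}

open Classical in
/-- The class of `ξ` in `L²(P)`, and `0` if `ξ` is not square integrable. -/
noncomputable def toL2 (P : Measure Ω) (ξ : Ω → ℝ) : Lp ℝ 2 P :=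
  if h : MemLp ξ 2 P then h.toLp ξ else 0

theorem coeFn_toL2 {ξ : Ω → ℝ} (h : MemLp ξ 2 P) : toL2 P ξ =ᵐ[P] ξ := by
  rw [toL2, dif_pos h]
  exact h.coeFn_toLp

/-- The closed linear span of a process in `L²(P)`. -/
noncomputable def processSpace {ι : Type*} (P : Measure Ω) (X : ι → Ω → ℝ) :
    Submodule ℝ (Lp ℝ 2 P) :=
  (Submodule.span ℝ (Set.range fun t => toL2 P (X t))).topologicalClosure

instance {ι : Type*} (P : Measure Ω) (X : ι → Ω → ℝ) : CompleteSpace (processSpace P X) :=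
  inferInstanceAs (CompleteSpace (Submodule.topologicalClosure _))

/-- A process as a curve in its closed linear span. -/
noncomputable def processCurve {ι : Type*} (P : Measure Ω) (X : ι → Ω → ℝ) (t : ι) :
    processSpace P X :=
  ⟨toL2 P (X t), Submodule.le_topologicalClosure _ (Submodule.subset_span ⟨t, rfl⟩)⟩

variable [IsProbabilityMeasure P]

theorem memLp_two_of_isGaussianProcess {ι : Type*} {X : ι → Ω → ℝ} (hX : IsGaussianProcess X P)
    (t : ι) : MemLp (X t) 2 P :=
  (hX.hasGaussianLaw_eval t).memLp_two

theorem coeFn_processCurve {ι : Type*} {X : ι → Ω → ℝ} (hX : IsGaussianProcess X P) (t : ι) :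
    ((processCurve P X t : processSpace P X) : Lp ℝ 2 P) =ᵐ[P] X t :=
  coeFn_toL2 (memLp_two_of_isGaussianProcess hX t)

theorem isGaussianSubspace_processSpace {ι : Type*} {X : ι → Ω → ℝ} (hX : IsGaussianProcess X P)
    (h0 : ∀ t, ∫ ω, X t ω ∂P = 0) : IsGaussianSubspace (processSpace P X) :=
  isGaussianSubspace_closure (IsGaussianProcess.isGaussianSubspace_span hX h0
    (coeFn_processCurve hX))

theorem inner_processCurve {ι : Type*} {X : ι → Ω → ℝ} (hX : IsGaussianProcess X P) (s t : ι) :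
    inner ℝ (processCurve P X s) (processCurve P X t) = ∫ ω, X s ω * X t ω ∂P := by
  rw [IsGaussianSubspace.inner_eq_integral]
  refine integral_congr_ae ?_
  filter_upwards [coeFn_processCurve hX s, coeFn_processCurve hX t] with ω h1 h2
  rw [h1, h2]

/-- A measurable centred stationary Gaussian process with spectral density `f ≤ M`. -/
structure IsInput (P : Measure Ω) (X : ℝ → Ω → ℝ) (f : ℝ → ℝ) (M : ℝ) : Prop where
  measurable : Measurable (fun p : ℝ × Ω => X p.1 p.2)
  gaussian : IsGaussianProcess X P
  centred : ∀ t, ∫ ω, X t ω ∂P = 0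
  covariance : ∀ s t, ((∫ ω, X (s + t) ω * X s ω ∂P : ℝ) : ℂ) = spectralCov f t
  nonneg : ∀ l, 0 ≤ f l
  le : ∀ l, f l ≤ M
  even : ∀ l, f l = f (-l)
  integrable : Integrable f
  density_measurable : Measurable f

namespace IsInput

variable {X : ℝ → Ω → ℝ} {f : ℝ → ℝ} {M : ℝ}

theorem isGaussianSubspace (hX : IsInput P X f M) : IsGaussianSubspace (processSpace P X) :=
  isGaussianSubspace_processSpace hX.gaussian hX.centred

theorem isSpectralCurve (hX : IsInput P X f M) : IsSpectralCurve (processCurve P X) f M where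
  inner_eq s t := by
    rw [inner_processCurve hX.gaussian, ← hX.covariance t (s - t), add_sub_cancel]
  nonneg := hX.nonneg
  le := hX.le
  even := hX.even
  integrable := hX.integrable
  meas := hX.density_measurable

theorem integrable_prod (hX : IsInput P X f M) {g : ℝ → ℝ} (hg : Integrable g) :
    Integrable (fun p : ℝ × Ω => g p.1 * X p.1 p.2) (volume.prod P) := by
  have hm : AEStronglyMeasurable (fun p : ℝ × Ω => g p.1 * X p.1 p.2) (volume.prod P) :=
    hg.aestronglyMeasurable.comp_fst.mul hX.measurable.aestronglyMeasurable
  have hint : ∀ r, Integrable (X r) P := fun r =>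
    (memLp_two_of_isGaussianProcess hX.gaussian r).integrable (by norm_num)
  have hL1 : ∀ r, ∫ ω, ‖X r ω‖ ∂P ≤ ‖processCurve P X 0‖ := by
    intro r
    rw [← hX.isSpectralCurve.norm_eq r, Submodule.coe_norm, Lp.norm_def,
      eLpNorm_congr_ae (coeFn_processCurve hX.gaussian r),
      integral_norm_eq_lintegral_enorm (hint r).aestronglyMeasurable,
      ← eLpNorm_one_eq_lintegral_enorm]
    refine ENNReal.toReal_mono (memLp_two_of_isGaussianProcess hX.gaussian r).eLpNorm_ne_top ?_
    exact eLpNorm_le_eLpNorm_of_exponent_le (by norm_num) (hint r).aestronglyMeasurable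
  refine (integrable_prod_iff hm).2 ⟨Eventually.of_forall fun r => (hint r).const_mul (g r), ?_⟩
  refine (hg.norm.mul_const ‖processCurve P X 0‖).mono' hm.norm.integral_prod_right' ?_
  refine Eventually.of_forall fun r => ?_
  simp only [norm_mul]
  rw [integral_const_mul, norm_mul, norm_norm,
    Real.norm_of_nonneg (integral_nonneg fun _ => norm_nonneg _)]
  exact mul_le_mul_of_nonneg_left (hL1 r) (norm_nonneg _)

/-- The Bochner integral of the curve in `L²(P)` is the pathwise integral. -/
theorem integral_ae_eq (hX : IsInput P X f M) {g : ℝ → ℝ} (hg : Integrable g) :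
    (fun ω => ∫ r, g r * X r ω) =ᵐ[P]
      ((∫ r, g r • processCurve P X r : processSpace P X) : Lp ℝ 2 P) := by
  have hprod := hX.integrable_prod hg
  refine Integrable.ae_eq_of_forall_setIntegral_eq _ _ hprod.integral_prod_right
    ((Lp.memLp _).integrable (by norm_num)) fun A hA hPA => ?_
  let L : processSpace P X →L[ℝ] ℝ :=
    (innerSL ℝ (indicatorConstLp 2 hA hPA.ne (1 : ℝ))).comp (processSpace P X).subtypeL
  have hL : ∀ v : processSpace P X, L v = ∫ ω in A, (v : Lp ℝ 2 P) ω ∂P := fun v =>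
    L2.inner_indicatorConstLp_one hA hPA.ne _
  rw [← hL, ← L.integral_comp_comm (hX.isSpectralCurve.integrable_smul hg)]
  have hr : Integrable (fun p : ℝ × Ω => g p.1 * X p.1 p.2) (volume.prod (P.restrict A)) := by
    have := hprod.restrict (s := Set.univ ×ˢ A)
    rwa [← Measure.prod_restrict, Measure.restrict_univ] at this
  have hswap := integral_integral_swap (f := fun r ω => g r * X r ω) hr
  rw [← hswap]
  refine integral_congr_ae (Eventually.of_forall fun r => ?_)
  simp only [map_smul, smul_eq_mul]
  rw [hL, integral_const_mul, setIntegral_congr_ae hA]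
  filter_upwards [coeFn_processCurve hX.gaussian r] with ω hω _
  exact hω.symm

end IsInput

/-- The truncation of `H` to `(A, B]`, with the sign convention of interval integrals. -/
noncomputable def truncate (H : ℝ → ℝ) (p : ℝ × ℝ) (s : ℝ) : ℝ :=
  (Set.Ioc p.1 p.2).indicator H s - (Set.Ioc p.2 p.1).indicator H s

variable {H : ℝ → ℝ}

theorem memLp_truncate (hH : MemLp H 2 volume) (p : ℝ × ℝ) : MemLp (truncate H p) 2 volume :=
  (hH.indicator measurableSet_Ioc).sub (hH.indicator measurableSet_Ioc)

theorem integrable_truncate (hH : MemLp H 2 volume) (p : ℝ × ℝ) : Integrable (truncate H p) := by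
  have h : ∀ A B : ℝ, Integrable ((Set.Ioc A B).indicator H) := by
    intro A B
    rw [integrable_indicator_iff measurableSet_Ioc]
    have : IsFiniteMeasure (volume.restrict (Set.Ioc A B)) := ⟨by simp⟩
    exact (hH.restrict _).integrable (by norm_num)
  exact (h _ _).sub (h _ _)

theorem abs_truncate_sub_le (p : ℝ × ℝ) (s : ℝ) : |truncate H p s - H s| ≤ 2 * |H s| := by
  unfold truncate
  have h0 := abs_nonneg (H s)
  by_cases h1 : s ∈ Set.Ioc p.1 p.2
  · have h2 : s ∉ Set.Ioc p.2 p.1 := fun h => absurd (h.1.trans_le h1.2) (lt_irrefl _)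
    rw [Set.indicator_of_mem h1, Set.indicator_of_notMem h2]
    simp
  · by_cases h2 : s ∈ Set.Ioc p.2 p.1
    · rw [Set.indicator_of_notMem h1, Set.indicator_of_mem h2, zero_sub, ← neg_add', abs_neg,
        ← two_mul, abs_mul, abs_two]
    · rw [Set.indicator_of_notMem h1, Set.indicator_of_notMem h2]
      simp only [sub_zero, zero_sub, abs_neg]
      linarith

theorem tendsto_toLp_truncate (hH : MemLp H 2 volume) :
    Tendsto (fun p => (memLp_truncate hH p).toLp (truncate H p)) (atBot ×ˢ atTop)
      (𝓝 (hH.toLp H)) := by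
  rw [tendsto_iff_norm_sub_tendsto_zero]
  have hsq : Tendsto (fun p => ‖(memLp_truncate hH p).toLp (truncate H p) - hH.toLp H‖ ^ 2)
      (atBot ×ˢ atTop) (𝓝 0) := by
    simp_rw [norm_toLp_sub_sq]
    have h2 : Integrable (fun s => (2 * |H s|) ^ 2) := by
      have := (hH.integrable_sq.const_mul 4)
      refine this.congr (Eventually.of_forall fun s => ?_)
      simp only [mul_pow, sq_abs]; norm_num
    have := tendsto_integral_filter_of_dominated_convergence (μ := volume)
      (l := (atBot ×ˢ atTop : Filter (ℝ × ℝ)))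
      (F := fun p s => (truncate H p s - H s) ^ 2) (f := fun _ => 0) (fun s => (2 * |H s|) ^ 2)
      (Eventually.of_forall fun p =>
        (((memLp_truncate hH p).sub hH).aestronglyMeasurable.pow 2))
      (Eventually.of_forall fun p => Eventually.of_forall fun s => by
        rw [Real.norm_eq_abs, abs_pow]
        exact pow_le_pow_left₀ (abs_nonneg _) (abs_truncate_sub_le p s) 2) h2
      (Eventually.of_forall fun s => by
        refine tendsto_const_nhds.congr' ?_
        have : ∀ᶠ p : ℝ × ℝ in atBot ×ˢ atTop, p.1 < s ∧ s ≤ p.2 :=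
          (eventually_lt_atBot s).prod_mk (eventually_ge_atTop s)
        filter_upwards [this] with p hp
        have h1 : s ∈ Set.Ioc p.1 p.2 := hp
        have h2 : s ∉ Set.Ioc p.2 p.1 := fun h => absurd (h.1.trans_le h1.2) (lt_irrefl _)
        rw [truncate, Set.indicator_of_mem h1, Set.indicator_of_notMem h2]
        simp)
    simpa using this
  have := (Real.continuous_sqrt.tendsto 0).comp hsq
  simpa [Function.comp_def, Real.sqrt_sq (norm_nonneg _)] using this

theorem truncatedResponse_eq (X : ℝ → Ω → ℝ) (t : ℝ) (p : ℝ × ℝ) (ω : Ω) :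
    truncatedResponse H X t p ω = ∫ r, truncate H p (t - r) * X r ω := by
  have h1 := integral_sub_left_eq_self (fun s => truncate H p s * X (t - s) ω) volume t
  simp only [sub_sub_cancel] at h1
  rw [h1, truncatedResponse]
  rcases le_total p.1 p.2 with h | h
  · rw [intervalIntegral.integral_of_le h, ← integral_indicator measurableSet_Ioc]
    refine integral_congr_ae (Eventually.of_forall fun s => ?_)
    simp only [truncate, Set.Ioc_eq_empty_of_le h, Set.indicator_empty, sub_zero]
    rw [Set.indicator_mul_left]
  · rw [intervalIntegral.integral_of_ge h, ← integral_indicator measurableSet_Ioc, ← integral_neg]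
    refine integral_congr_ae (Eventually.of_forall fun s => ?_)
    simp only [truncate, Set.Ioc_eq_empty_of_le h, Set.indicator_empty, zero_sub]
    rw [Set.indicator_mul_left, neg_mul]

namespace IsInput

variable {X : ℝ → Ω → ℝ} {f : ℝ → ℝ} {M : ℝ}

theorem truncatedResponse_ae_eq (hX : IsInput P X f M) (hH : MemLp H 2 volume) (t : ℝ)
    (p : ℝ × ℝ) : truncatedResponse H X t p =ᵐ[P]
      ((hX.isSpectralCurve.resp ((memLp_truncate hH p).toLp _) t : processSpace P X) : Lp ℝ 2 P) := by
  rw [hX.isSpectralCurve.resp_eq_integral (integrable_truncate hH p)]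
  refine EventuallyEq.trans (Eventually.of_forall fun ω => truncatedResponse_eq X t p ω) ?_
  exact hX.integral_ae_eq ((integrable_truncate hH p).comp_sub_left t)

/-- The mean-square integral that defines the response exists. -/
theorem isMSLimit_response (hX : IsInput P X f M) (hH : MemLp H 2 volume) (t : ℝ) :
    IsMSLimit P (atBot ×ˢ atTop) (truncatedResponse H X t)
      ((hX.isSpectralCurve.resp (hH.toLp H) t : processSpace P X) : Lp ℝ 2 P) := by
  refine isMSLimit_of_tendsto (hX.truncatedResponse_ae_eq hH t) ?_
  have hcont : Continuous fun G => ((hX.isSpectralCurve.resp G t : processSpace P X) : Lp ℝ 2 P) := by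
    refine continuous_subtype_val.comp ?_
    refine hX.isSpectralCurve.synth.continuous.comp ?_
    exact (Lp.compMeasurePreservingₗᵢ ℝ (fun s => t - s)
      (Measure.measurePreserving_sub_left volume t)).continuous
  exact (hcont.tendsto _).comp (tendsto_toLp_truncate hH)

theorem response_ae_eq (hX : IsInput P X f M) (hH : MemLp H 2 volume) (t : ℝ) :
    response P H X t =ᵐ[P]
      ((hX.isSpectralCurve.resp (hH.toLp H) t : processSpace P X) : Lp ℝ 2 P) :=
  (hX.isMSLimit_response hH t).msLimit_ae_eq

/-- The curve `t ↦ Y(t + τ) X(t)` in `L²(P)`. -/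
noncomputable def productCurve (hX : IsInput P X f M) (hH : MemLp H 2 volume) (τ t : ℝ) :
    Lp ℝ 2 P :=
  hX.isGaussianSubspace.wick (hX.isSpectralCurve.resp (hH.toLp H) (t + τ)) (processCurve P X t) +
    (inner ℝ (hX.isSpectralCurve.resp (hH.toLp H) (t + τ)) (processCurve P X t) : ℝ) •
      (memLp_const (1 : ℝ)).toLp (fun _ : Ω => (1 : ℝ))

theorem coeFn_productCurve (hX : IsInput P X f M) (hH : MemLp H 2 volume) (τ t : ℝ) :
    (fun ω => response P H X (t + τ) ω * X t ω) =ᵐ[P] hX.productCurve hH τ t := by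
  set y := hX.isSpectralCurve.resp (hH.toLp H) (t + τ) with hy
  filter_upwards [hX.response_ae_eq hH (t + τ), coeFn_processCurve hX.gaussian t,
    hX.isGaussianSubspace.coeFn_wick y (processCurve P X t),
    Lp.coeFn_add (hX.isGaussianSubspace.wick y (processCurve P X t))
      ((inner ℝ y (processCurve P X t) : ℝ) •
        (memLp_const (μ := P) (p := 2) (1 : ℝ)).toLp (fun _ : Ω => (1 : ℝ))),
    Lp.coeFn_smul (inner ℝ y (processCurve P X t) : ℝ)
      ((memLp_const (μ := P) (p := 2) (1 : ℝ)).toLp (fun _ : Ω => (1 : ℝ))),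
    (memLp_const (μ := P) (p := 2) (1 : ℝ)).coeFn_toLp] with ω h1 h2 h3 h4 h5 h6
  rw [h1, productCurve, ← hy, h4, Pi.add_apply, h3, h5, Pi.smul_apply, h6, h2]
  simp

theorem continuous_inner_resp (hX : IsInput P X f M) (hH : MemLp H 2 volume) (τ : ℝ) :
    Continuous fun t => (inner ℝ (hX.isSpectralCurve.resp (hH.toLp H) (t + τ))
      (processCurve P X t) : ℝ) := by
  have h1 : Continuous fun t => hX.isSpectralCurve.resp (hH.toLp H) (t + τ) :=
    (hX.isSpectralCurve.continuous_resp _).comp (by fun_prop)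
  exact h1.inner hX.isSpectralCurve.continuous

theorem continuous_productCurve (hX : IsInput P X f M) (hH : MemLp H 2 volume) (τ : ℝ) :
    Continuous (hX.productCurve hH τ) :=
  (continuous_wick_resp hX.isGaussianSubspace hX.isSpectralCurve _ τ).add
    ((hX.continuous_inner_resp hH τ).smul continuous_const)

/-- The mean-square integral that defines the estimator exists. -/
theorem isMSRiemannIntegral_productCurve (hX : IsInput P X f M) (hH : MemLp H 2 volume) (τ : ℝ)
    {T : ℝ} (hT : 0 < T) :
    IsMSRiemannIntegral P (fun t ω => response P H X (t + τ) ω * X t ω) 0 T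
      (∫ t in (0 : ℝ)..T, hX.productCurve hH τ t : Lp ℝ 2 P) :=
  isMSRiemannIntegral_of_continuous (hX.continuous_productCurve hH τ)
    (hX.coeFn_productCurve hH τ) hT

theorem resp_comp_add (hX : IsInput P X f M) (hH : MemLp H 2 volume) (τ t : ℝ) :
    hX.isSpectralCurve.resp (hH.toLp H) (t + τ) =
      hX.isSpectralCurve.resp ((memLp_comp_add hH τ).toLp _) t := by
  rw [hX.isSpectralCurve.resp_toLp, hX.isSpectralCurve.resp_toLp]
  congr 1
  refine MemLp.toLp_congr _ _ (Eventually.of_forall fun s => ?_)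
  simp only
  congr 1
  ring

theorem centredEstimator_ae_eq (hX : IsInput P X f M) (hH : MemLp H 2 volume) {c : ℝ} (hc : 0 < c)
    {T : ℝ} (hT : 0 < T) (τ : ℝ) :
    centredEstimator P H X c T τ =ᵐ[P] zeta hX.isGaussianSubspace hX.isSpectralCurve c T
      ((memLp_comp_add hH τ).toLp _) := by
  set one : Lp ℝ 2 P := (memLp_const (1 : ℝ)).toLp (fun _ : Ω => (1 : ℝ)) with hone
  set m : ℝ := ∫ t in (0 : ℝ)..T, (inner ℝ (hX.isSpectralCurve.resp (hH.toLp H) (t + τ))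
      (processCurve P X t) : ℝ) with hm
  set I : Lp ℝ 2 P := ∫ t in (0 : ℝ)..T, hX.isGaussianSubspace.wick
    (hX.isSpectralCurve.resp (hH.toLp H) (t + τ)) (processCurve P X t) with hI
  have hJ : (∫ t in (0 : ℝ)..T, hX.productCurve hH τ t : Lp ℝ 2 P) = I + m • one := by
    rw [hI, hm, ← intervalIntegral.integral_smul_const]
    exact intervalIntegral.integral_add
      ((continuous_wick_resp hX.isGaussianSubspace hX.isSpectralCurve _ τ).intervalIntegrable _ _)
      (((hX.continuous_inner_resp hH τ).smul continuous_const).intervalIntegrable _ _)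
  have hint1 : ∀ v : Lp ℝ 2 P, ∫ ω, v ω ∂P = inner ℝ one v := by
    intro v
    rw [L2.inner_def]
    refine integral_congr_ae ?_
    filter_upwards [(memLp_const (μ := P) (p := 2) (1 : ℝ)).coeFn_toLp] with ω hω
    rw [hω]
    simp
  have hI0 : ∫ ω, I ω ∂P = 0 := by
    rw [hint1, hI, intervalIntegral.integral_of_le hT.le]
    have hint : IntegrableOn (fun t => hX.isGaussianSubspace.wick
        (hX.isSpectralCurve.resp (hH.toLp H) (t + τ)) (processCurve P X t)) (Set.Ioc 0 T) :=
      (continuous_wick_resp hX.isGaussianSubspace hX.isSpectralCurve _ τ).integrableOn_Ioc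
    have := (innerSL ℝ one).integral_comp_comm hint
    simp only [innerSL_apply_apply] at this
    rw [← this]
    refine integral_eq_zero_of_ae (Eventually.of_forall fun t => ?_)
    simp only [Pi.zero_apply]
    rw [← hint1, integral_congr_ae (hX.isGaussianSubspace.coeFn_wick _ _),
      integral_sub ((hX.isGaussianSubspace.memLp_mul _ _).integrable (by norm_num))
      (integrable_const _), ← IsGaussianSubspace.inner_eq_integral]
    simp
  have hest : estimator P H X c T τ =ᵐ[P] fun ω => 1 / (c * T) * (I ω + m) := by
    have h1 := (hX.isMSRiemannIntegral_productCurve hH τ hT).msRiemannIntegral_ae_eq hT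
    rw [hJ] at h1
    filter_upwards [h1, Lp.coeFn_add I (m • one), Lp.coeFn_smul m one,
      (memLp_const (μ := P) (p := 2) (1 : ℝ)).coeFn_toLp] with ω h2 h3 h4 h5
    rw [estimator, h2, h3, Pi.add_apply, h4, Pi.smul_apply, h5]
    simp
  have hmean : ∫ ω, estimator P H X c T τ ω ∂P = 1 / (c * T) * m := by
    rw [integral_congr_ae hest, integral_const_mul,
      integral_add ((Lp.memLp I).integrable (by norm_num)) (integrable_const _), hI0]
    simp
  have hz : zeta hX.isGaussianSubspace hX.isSpectralCurve c T ((memLp_comp_add hH τ).toLp _) =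
      (1 / (c * √T)) • I := by
    rw [zeta, hI]
    simp_rw [← hX.resp_comp_add hH τ]
  rw [hz]
  filter_upwards [hest, Lp.coeFn_smul (1 / (c * √T)) I] with ω h1 h2
  rw [centredEstimator, hmean, h1, h2, Pi.smul_apply, smul_eq_mul]
  have hs : √T * √T = T := Real.mul_self_sqrt hT.le
  have hs0 : √T ≠ 0 := (Real.sqrt_pos.2 hT).ne'
  have hT' : T ≠ 0 := hT.ne'
  have hc' : c ≠ 0 := hc.ne'
  rw [← mul_sub, add_sub_cancel_right]
  field_simp
  rw [sq, hs]

end IsInput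

end Input

end Correlogram

namespace Correlogram

/-! ### The limit covariance form -/

section LimitForm

/-- The reflection `G ↦ G(-·)` on `L²(ℝ)`. -/
noncomputable def reflect : Lp ℝ 2 (volume : Measure ℝ) →ₗᵢ[ℝ] Lp ℝ 2 (volume : Measure ℝ) :=
  Lp.compMeasurePreservingₗᵢ ℝ (fun x => -x) (Measure.measurePreserving_neg volume)

/-- The bilinear form `∫ G K + ∫ G K(-·)` on `L²(ℝ)`. -/
noncomputable def limitForm (G K : Lp ℝ 2 (volume : Measure ℝ)) : ℝ :=
  inner ℝ G K + inner ℝ G (reflect K)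

theorem inner_toLp_toLp {g k : ℝ → ℝ} (hg : MemLp g 2 volume) (hk : MemLp k 2 volume) :
    inner ℝ (hg.toLp g) (hk.toLp k) = ∫ x, g x * k x := by
  rw [L2.inner_def]
  refine integral_congr_ae ?_
  filter_upwards [hg.coeFn_toLp, hk.coeFn_toLp] with x h1 h2
  rw [h1, h2]
  simp [mul_comm]

theorem reflect_toLp {k : ℝ → ℝ} (hk : MemLp k 2 volume) :
    reflect (hk.toLp k) = (memLp_comp_neg hk).toLp _ :=
  Lp.toLp_compMeasurePreserving hk (Measure.measurePreserving_neg volume)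

theorem limitForm_toLp {g k : ℝ → ℝ} (hg : MemLp g 2 volume) (hk : MemLp k 2 volume) :
    limitForm (hg.toLp g) (hk.toLp k) = (∫ x, g x * k x) + ∫ x, g x * k (-x) := by
  rw [limitForm, reflect_toLp, inner_toLp_toLp, inner_toLp_toLp]

theorem limitCov_eq_limitForm {H : ℝ → ℝ} (hH : MemLp H 2 volume) (s t : ℝ) :
    limitCov H hH s t =
      (limitForm ((memLp_comp_add hH s).toLp _) ((memLp_comp_add hH t).toLp _) : ℝ) := by
  rw [limitCov_eq, limitForm_toLp]

theorem continuous_limitForm : Continuous fun G => limitForm G G :=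
  (continuous_id.inner continuous_id).add (continuous_id.inner reflect.continuous)

theorem limitForm_self_le (G : Lp ℝ 2 (volume : Measure ℝ)) : limitForm G G ≤ 2 * ‖G‖ ^ 2 := by
  have h := real_inner_le_norm G (reflect G)
  rw [reflect.norm_map] at h
  rw [limitForm, real_inner_self_eq_norm_sq]
  linarith

variable {E : Type*} [NormedAddCommGroup E] [InnerProductSpace ℝ E] {z : ℝ → E}
  {G : ℝ → Lp ℝ 2 (volume : Measure ℝ)}

theorem norm_sum_smul_sq_eq_limitForm {ι : Type*} (s : Finset ι) (τ : ι → ℝ) (c : ι → ℝ)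
    (hz : ∀ s t, inner ℝ (z s) (z t) = limitForm (G s) (G t)) :
    ‖∑ k ∈ s, c k • z (τ k)‖ ^ 2 =
      limitForm (∑ k ∈ s, c k • G (τ k)) (∑ k ∈ s, c k • G (τ k)) := by
  rw [← real_inner_self_eq_norm_sq, limitForm]
  simp only [map_sum, map_smul, sum_inner, inner_sum, inner_smul_left, inner_smul_right, hz,
    limitForm, mul_add, Finset.sum_add_distrib]

theorem norm_sub_le_of_limitForm (hz : ∀ s t, inner ℝ (z s) (z t) = limitForm (G s) (G t))
    (s t : ℝ) : ‖z s - z t‖ ≤ √2 * ‖G s - G t‖ := by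
  have h := norm_sum_smul_sq_eq_limitForm (Finset.univ : Finset (Fin 2)) ![s, t] ![1, -1] hz
  simp only [Fin.sum_univ_two, Matrix.cons_val_zero, Matrix.cons_val_one, one_smul, neg_smul,
    ← sub_eq_add_neg] at h
  refine (sq_le_sq₀ (norm_nonneg _) (by positivity)).1 ?_
  rw [h, mul_pow, Real.sq_sqrt (by norm_num)]
  exact limitForm_self_le _

end LimitForm

/-! ### Convergence of the finite-dimensional distributions -/

section Limit

variable {Ω : Type*} [MeasurableSpace Ω] {P : Measure Ω} [IsProbabilityMeasure P]

theorem IsGaussianSubspace.integral_cexp {S : Submodule ℝ (Lp ℝ 2 P)} (hS : IsGaussianSubspace S)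
    {u : Lp ℝ 2 P} (hu : u ∈ S) :
    ∫ ω, Complex.exp ((1 : ℝ) * u ω * Complex.I) ∂P = Complex.exp (-((‖u‖ : ℂ) ^ 2 / 2)) := by
  rw [integral_cexp_eq_charFun, hS u hu, charFun_gaussianReal]
  simp

theorem integral_cexp_sum_eq {W : ℝ → Ω → ℝ} {w : ℝ → Lp ℝ 2 P} (h : ∀ t, W t =ᵐ[P] w t)
    (s : Finset ℝ) (c : s → ℝ) :
    ∫ ω, Complex.exp ((∑ k, c k * W k ω : ℝ) * Complex.I) ∂P =
      ∫ ω, Complex.exp ((1 : ℝ) * (∑ k, c k • w k : Lp ℝ 2 P) ω * Complex.I) ∂P := by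
  refine integral_congr_ae ?_
  filter_upwards [coeFn_finset_sum_smul Finset.univ c (fun k : s => w k),
    eventually_all.2 fun k : s => h k] with ω h1 h2
  rw [h1]
  simp [h2]

variable {X : ℝ → ℝ → Ω → ℝ} {f : ℝ → ℝ → ℝ} {M c : ℝ}

/-- The normalized correlogram of the input `X Δ` over `[0, T]`, where `p = (T, Δ)`. -/
noncomputable def normalizedCorrelogram
    (hX : ∀ Δ : Set.Ioi (0 : ℝ), IsInput P (X Δ) (f Δ) M) (c : ℝ)
    (p : Set.Ioi (0 : ℝ) × Set.Ioi (0 : ℝ)) (G : Lp ℝ 2 (volume : Measure ℝ)) : Lp ℝ 2 P :=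
  zeta (hX p.2).isGaussianSubspace (hX p.2).isSpectralCurve c p.1 G

theorem tendsto_integral_cexp_of_integrable_ft
    (hX : ∀ Δ : Set.Ioi (0 : ℝ), IsInput P (X Δ) (f Δ) M) (hc : 0 < c)
    (hlim : ∀ r > 0, TendstoUniformlyOn f (fun _ => c / (2 * Real.pi)) atTop (Set.Icc (-r) r))
    {g : ℝ → ℝ} (hg : Integrable g) (hg2 : MemLp g 2 volume) (hgf : Integrable (ft g)) :
    Tendsto (fun p => ∫ ω, Complex.exp ((1 : ℝ) *
        normalizedCorrelogram hX c p (hg2.toLp g) ω * Complex.I) ∂P) (atTop ×ˢ atTop)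
      (𝓝 (Complex.exp (-((limitForm (hg2.toLp g) (hg2.toLp g) : ℂ) / 2)))) := by
  set q := fun p => normalizedCorrelogram hX c p (hg2.toLp g) with hq
  have hnorm : Tendsto (fun p => ‖q p‖ ^ 2) (atTop ×ˢ atTop)
      (𝓝 (limitForm (hg2.toLp g) (hg2.toLp g))) := by
    have h := (tendsto_quadMoment_div (E := fun Δ => processSpace P (X Δ))
      (x := fun Δ => processCurve P (X Δ)) (fun Δ => (hX Δ).isSpectralCurve) hlim hg hg2
      hgf).const_mul (1 / c ^ 2)
    rw [← mul_assoc, one_div_mul_cancel (by positivity), one_mul, ← limitForm_toLp hg2 hg2] at h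
    refine h.congr fun p => ?_
    have hp : (0 : ℝ) < p.1 := p.1.2
    rw [hq]
    simp only [normalizedCorrelogram]
    rw [norm_zeta_sq _ _ _ _ hp]
    field_simp
  set κ : Set.Ioi (0 : ℝ) × Set.Ioi (0 : ℝ) → ℝ :=
    fun p => 2 * Real.pi * M * (∫ t, ‖g t‖) / (c * √p.1) with hκ
  have hκ0 : Tendsto κ (atTop ×ˢ atTop) (𝓝 0) := by
    refine Tendsto.div_atTop tendsto_const_nhds (Tendsto.const_mul_atTop hc ?_)
    exact (Real.tendsto_sqrt_atTop.comp (map_val_Ioi_atTop (0 : ℝ)).le).comp tendsto_fst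
  have hbound : Tendsto (fun p => (4 * cubicMoment * |(1 : ℝ)| ^ 3 * κ p + 1 ^ 4 * κ p ^ 2) *
      ‖q p‖ ^ 2 / 2) (atTop ×ˢ atTop) (𝓝 0) := by
    have := ((((hκ0.const_mul (4 * cubicMoment * |(1 : ℝ)| ^ 3)).add
      ((hκ0.pow 2).const_mul (1 ^ 4))).mul hnorm).div_const 2)
    simpa using this
  have hdiff := squeeze_zero_norm (fun p : Set.Ioi (0 : ℝ) × Set.Ioi (0 : ℝ) =>
    (hX p.2).isGaussianSubspace.norm_integral_cexp_sub_le
      (zeta_mem (hX p.2).isGaussianSubspace (hX p.2).isSpectralCurve c p.1 p.1.2 (hg2.toLp g))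
      (abs_inner_zeta_wick_le _ _ hc p.1.2 hg hg2) 1) hbound
  have hexp : Tendsto (fun p => Complex.exp (-(((‖q p‖ ^ 2 : ℝ) : ℂ) / 2))) (atTop ×ˢ atTop)
      (𝓝 (Complex.exp (-((limitForm (hg2.toLp g) (hg2.toLp g) : ℂ) / 2)))) :=
    ((by fun_prop : Continuous fun y : ℝ => Complex.exp (-((y : ℂ) / 2))).tendsto _).comp hnorm
  have := hdiff.add hexp
  rw [zero_add] at this
  refine this.congr fun p => ?_
  simp [hq, normalizedCorrelogram]

theorem norm_normalizedCorrelogram_sub_le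
    (hX : ∀ Δ : Set.Ioi (0 : ℝ), IsInput P (X Δ) (f Δ) M) (hc : 0 < c)
    (p : Set.Ioi (0 : ℝ) × Set.Ioi (0 : ℝ)) (G K : Lp ℝ 2 (volume : Measure ℝ)) :
    ‖normalizedCorrelogram hX c p G - normalizedCorrelogram hX c p K‖ ≤
      3 * Real.pi * M / c * ‖G - K‖ := by
  rw [normalizedCorrelogram, normalizedCorrelogram, ← zeta_sub]
  exact norm_zeta_le _ _ hc p.1.2 _

theorem tendsto_integral_cexp_normalizedCorrelogram
    (hX : ∀ Δ : Set.Ioi (0 : ℝ), IsInput P (X Δ) (f Δ) M) (hc : 0 < c)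
    (hlim : ∀ r > 0, TendstoUniformlyOn f (fun _ => c / (2 * Real.pi)) atTop (Set.Icc (-r) r))
    (G : Lp ℝ 2 (volume : Measure ℝ)) :
    Tendsto (fun p => ∫ ω, Complex.exp ((1 : ℝ) *
        normalizedCorrelogram hX c p G ω * Complex.I) ∂P) (atTop ×ˢ atTop)
      (𝓝 (Complex.exp (-((limitForm G G : ℂ) / 2)))) := by
  rw [Metric.tendsto_nhds]
  intro ε hε
  have hV : Continuous fun G => Complex.exp (-((limitForm G G : ℂ) / 2)) := by
    have := continuous_limitForm
    fun_prop
  have h1 := (Metric.tendsto_nhds.1 (hV.tendsto G)) (ε / 3) (by positivity)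
  have h2 : ∀ᶠ K in 𝓝 G, 3 * Real.pi * M / c * ‖G - K‖ < ε / 3 := by
    have hc : Continuous fun K => 3 * Real.pi * M / c * ‖G - K‖ := by fun_prop
    refine (hc.tendsto G).eventually_lt_const ?_
    simpa using (by positivity : 0 < ε / 3)
  obtain ⟨_, ⟨g, hg2, hg, hgf, rfl⟩, hK1, hK2⟩ :=
    dense_of_integrable_ft.inter_nhds_nonempty (h1.and h2)
  filter_upwards [Metric.tendsto_nhds.1
    (tendsto_integral_cexp_of_integrable_ft hX hc hlim hg hg2 hgf) (ε / 3) (by positivity)]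
    with p hp
  have h3 := norm_integral_cexp_sub_integral_cexp_le (P := P) 1
    (normalizedCorrelogram hX c p G) (normalizedCorrelogram hX c p (hg2.toLp g))
  rw [abs_one, one_mul] at h3
  have h4 := h3.trans (norm_normalizedCorrelogram_sub_le hX hc p _ _)
  rw [← dist_eq_norm] at h4
  refine (dist_triangle4 _ _ _ _).trans_lt (add_lt_add_of_lt_of_le
    (add_lt_add (h4.trans_lt hK2) hp) hK1.le) |>.trans_eq ?_
  ring

theorem HasExpIncrements.congr {W W' : ℝ → Ω → ℝ} {d : ℝ → ℝ → ℝ} (hW : HasExpIncrements P W d)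
    (h : ∀ t, W' t =ᵐ[P] W t) : HasExpIncrements P W' d where
  aemeasurable t := (hW.aemeasurable t).congr (h t).symm
  lintegral_le s t r hr hd := by
    refine le_trans (lintegral_mono_ae ?_) (hW.lintegral_le s t r hr hd)
    filter_upwards [h s, h t] with ω h1 h2
    rw [h1, h2]

theorem HasExpIncrements.mono {W : ℝ → Ω → ℝ} {d d' : ℝ → ℝ → ℝ} (hW : HasExpIncrements P W d)
    (h : ∀ s t, d s t ≤ d' s t) : HasExpIncrements P W d' where
  aemeasurable := hW.aemeasurable
  lintegral_le s t r hr hd := hW.lintegral_le s t r hr ((h s t).trans hd)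

theorem hasExpIncrements_normalizedCorrelogram
    (hX : ∀ Δ : Set.Ioi (0 : ℝ), IsInput P (X Δ) (f Δ) M) (hc : 0 < c)
    (p : Set.Ioi (0 : ℝ) × Set.Ioi (0 : ℝ)) (G : ℝ → Lp ℝ 2 (volume : Measure ℝ)) :
    HasExpIncrements P (fun t ω => normalizedCorrelogram hX c p (G t) ω)
      (fun s t => 8 * (3 * Real.pi * M / c * ‖G s - G t‖)) where
  aemeasurable t := aemeasurable_Lp _
  lintegral_le s t r hr hd := by
    have hle := norm_normalizedCorrelogram_sub_le hX hc p (G s) (G t)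
    have hmem : normalizedCorrelogram hX c p (G s) - normalizedCorrelogram hX c p (G t) ∈
        (hX p.2).isGaussianSubspace.wickSpan.topologicalClosure :=
      Submodule.sub_mem _ (zeta_mem _ _ _ _ p.1.2 _) (zeta_mem _ _ _ _ p.1.2 _)
    refine le_trans (lintegral_mono_ae ?_)
      ((hX p.2).isGaussianSubspace.lintegral_exp_abs_le hmem hr (by linarith))
    filter_upwards [Lp.coeFn_sub (normalizedCorrelogram hX c p (G s))
      (normalizedCorrelogram hX c p (G t))] with ω hω
    rw [hω, Pi.sub_apply]

end Limit

/-! ### The distribution of the supremum -/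

section Supremum

variable {Ω : Type*} [MeasurableSpace Ω] {P : Measure Ω} {a b : ℝ}

theorem ofReal_lt_supAbs_iff {W : ℝ → Ω → ℝ} {ω : Ω}
    (h : ContinuousOn (fun t => W t ω) (Set.Icc a b)) {x : ℝ} (hx : 0 ≤ x) :
    ENNReal.ofReal x < supAbs a b W ω ↔ x < ‖path a b W ω‖ := by
  rw [← not_le, ← not_le, not_iff_not, ContinuousMap.norm_le _ hx, supAbs]
  simp only [iSup_le_iff, Subtype.forall]
  refine forall₂_congr fun t ht => ?_
  rw [path_apply h ⟨t, ht⟩, ← ofReal_norm, ENNReal.ofReal_le_ofReal_iff hx]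

theorem measure_ofReal_lt_supAbs {W : ℝ → Ω → ℝ} (hW : ∀ t, AEMeasurable (W t) P)
    (hcont : ∀ᵐ ω ∂P, ContinuousOn (fun t => W t ω) (Set.Icc a b)) {x : ℝ} (hx : 0 ≤ x) :
    P {ω | ENNReal.ofReal x < supAbs a b W ω} = P.map (path a b W) {w | x < ‖w‖} := by
  rw [Measure.map_apply_of_aemeasurable (aemeasurable_path hW hcont)
    (isOpen_lt continuous_const continuous_norm).measurableSet]
  refine measure_congr ?_
  filter_upwards [hcont] with ω hω
  exact propext (ofReal_lt_supAbs_iff hω hx)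

variable [IsProbabilityMeasure P] {H : ℝ → ℝ} {S : Submodule ℝ (Lp ℝ 2 P)}

theorem IsGaussianSubspace.map_path_sphere_eq_zero (hS : IsGaussianSubspace S)
    (hH : MemLp H 2 volume) (hE : EntropyIntegralFinite (sqrtSigma H hH) (Set.Icc 0 1)) {L : ℝ}
    (hL : 0 < L) {z : ℝ → S} (hz : ∀ s t, ‖z s - z t‖ ≤ L * sigma H hH s t) (hab : a ≤ b)
    {Z : ℝ → Ω → ℝ} (hZ : ∀ t, (z t : Lp ℝ 2 P) =ᵐ[P] Z t)
    (hcont : ∀ᵐ ω ∂P, ContinuousOn (fun t => Z t ω) (Set.Icc a b)) {x : ℝ} (hx : 0 < x) :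
    P.map (path a b Z) {w | ‖w‖ = x} = 0 := by
  have hm : ∀ t, AEMeasurable (Z t) P := fun t => (aemeasurable_Lp _).congr (hZ t)
  rw [Measure.map_apply_of_aemeasurable (aemeasurable_path hm hcont)
    (isClosed_eq continuous_norm continuous_const).measurableSet]
  have : Nonempty (Set.Icc a b) := ⟨⟨a, Set.left_mem_Icc.2 hab⟩⟩
  let v : ℕ → Set.Icc a b := TopologicalSpace.denseSeq _
  have h0 := hS.measure_sup_eq_null hH hE hL hz (a := a) (b := b) (u := fun j => v j)
    (fun j => (v j).2) hx
  refine measure_mono_null_ae ?_ h0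
  filter_upwards [hcont, ae_all_iff.2 fun j => hZ (v j)] with ω h1 h2 h3
  have h3 : ‖path a b Z ω‖ = x := h3
  have hval : ∀ j, (z (v j) : Lp ℝ 2 P) ω = path a b Z ω (v j) := fun j => by
    rw [h2 j, path_apply h1]
  refine ⟨fun j => ?_, fun y hy => ?_⟩
  · rw [hval, ← h3, ← Real.norm_eq_abs]
    exact ContinuousMap.norm_coe_le_norm _ _
  · by_contra hcon
    push Not at hcon
    have hy0 : 0 ≤ y := (abs_nonneg _).trans (hcon 0)
    have hall : ∀ t, ‖path a b Z ω t‖ ≤ y := by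
      have hcl : IsClosed {t | ‖path a b Z ω t‖ ≤ y} :=
        isClosed_le (path a b Z ω).continuous.norm continuous_const
      have hsub : Set.range v ⊆ {t | ‖path a b Z ω t‖ ≤ y} := by
        rintro _ ⟨j, rfl⟩
        have := hcon j
        rw [hval] at this
        exact this
      exact fun t => hcl.closure_subset_iff.2 hsub (TopologicalSpace.denseRange_denseSeq _ t)
    have := (ContinuousMap.norm_le _ hy0).2 hall
    linarith

end Supremum

end Correlogram

namespace Correlogram

section Main

variable {Ω : Type*} [MeasurableSpace Ω] {P : Measure Ω}

theorem IsInputFamily.exists_isInput {X : ℝ → ℝ → Ω → ℝ} {f : ℝ → ℝ → ℝ} {c : ℝ}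
    (hX : IsInputFamily P X f c) : ∃ M, ∀ Δ > 0, IsInput P (X Δ) (f Δ) M := by
  obtain ⟨M, hM⟩ := hX.density_bounded
  exact ⟨M, fun Δ hΔ =>
    { measurable := hX.measurable Δ hΔ
      gaussian := hX.gaussian Δ hΔ
      centred := hX.centred Δ hΔ
      covariance := hX.covariance Δ hΔ
      nonneg := hX.density_nonneg Δ hΔ
      le := hM Δ hΔ
      even := hX.density_even Δ hΔ
      integrable := hX.density_integrable Δ hΔ
      density_measurable := (hX.density_continuous Δ hΔ).measurable }⟩

theorem tendsto_measure_ofReal_lt_supAbs [IsProbabilityMeasure P] {a b : ℝ} {ι : Type*}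
    {l : Filter ι} {W : ι → ℝ → Ω → ℝ} {Z : ℝ → Ω → ℝ} (hW : ∀ i t, AEMeasurable (W i t) P)
    (hZ : ∀ t, AEMeasurable (Z t) P)
    (hWc : ∀ i, ∀ᵐ ω ∂P, ContinuousOn (fun t => W i t ω) (Set.Icc a b))
    (hZc : ∀ᵐ ω ∂P, ContinuousOn (fun t => Z t ω) (Set.Icc a b))
    (h : TendstoInDistribution (fun i => path a b (W i)) l (path a b Z) (fun _ => P) P)
    {x : ℝ} (hx : 0 ≤ x) (h0 : P.map (path a b Z) {w | ‖w‖ = x} = 0) :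
    Tendsto (fun i => P {ω | ENNReal.ofReal x < supAbs a b (W i) ω}) l
      (𝓝 (P {ω | ENNReal.ofReal x < supAbs a b Z ω})) := by
  simp_rw [fun i => measure_ofReal_lt_supAbs (hW i) (hWc i) hx]
  rw [measure_ofReal_lt_supAbs hZ hZc hx]
  refine ProbabilityMeasure.tendsto_measure_of_null_frontier_of_tendsto' h.tendsto ?_
  change P.map (path a b Z) (frontier {w | x < ‖w‖}) = 0
  refine measure_mono_null ?_ h0
  exact (frontier_lt_subset_eq continuous_const continuous_norm).trans fun w hw => hw.symm

end Main

end Correlogram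

theorem mainTheorem2 {Ω : Type*} [MeasurableSpace Ω] (P : Measure Ω) [IsProbabilityMeasure P]
    (H : ℝ → ℝ) (hH : MemLp H 2 volume)
    (X : ℝ → ℝ → Ω → ℝ) (f : ℝ → ℝ → ℝ) (c : ℝ)
    (hX : Correlogram.IsInputFamily P X f c)
    -- the centred Gaussian process with covariance function `C_∞`
    (Z : ℝ → Ω → ℝ) (hZ_gauss : IsGaussianProcess Z P)
    (hZ_centred : ∀ τ, ∫ ω, Z τ ω ∂P = 0)
    (hZ_cov : ∀ τ₁ τ₂,
      ((∫ ω, Z τ₁ ω * Z τ₂ ω ∂P : ℝ) : ℂ) = Correlogram.limitCov H hH τ₁ τ₂)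
    -- the processes `Z_{T,Δ}`, each a version of the normalized centred estimator
    (ZT : ℝ → ℝ → ℝ → Ω → ℝ)
    (hZT : ∀ T > 0, ∀ Δ > 0, ∀ τ,
      ZT T Δ τ =ᵐ[P] Correlogram.centredEstimator P H (X Δ) c T τ)
    (h_entropy : Correlogram.EntropyIntegralFinite (Correlogram.sqrtSigma H hH) (Set.Icc 0 1))
    (a b : ℝ) (hab : a ≤ b)
    (hZ_sep : Correlogram.IsSeparableOn P Z (Set.Icc a b))
    (hZT_sep : ∀ T > 0, ∀ Δ > 0, Correlogram.IsSeparableOn P (ZT T Δ) (Set.Icc a b)) :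
    -- the mean-square integrals that define `Y_Δ(t)` and `H_{T,Δ}(τ)` exist
    (∀ Δ > 0, ∀ t, ∃ η, Correlogram.IsMSLimit P (atBot ×ˢ atTop)
      (Correlogram.truncatedResponse H (X Δ) t) η) ∧
    (∀ T > 0, ∀ Δ > 0, ∀ τ, ∃ J, Correlogram.IsMSRiemannIntegral P
      (fun t ω => Correlogram.response P H (X Δ) (t + τ) ω * X Δ t ω) 0 T J) ∧
    -- (I) `Z` is almost surely continuous
    (∀ᵐ ω ∂P, ContinuousOn (fun τ => Z τ ω) (Set.Icc a b)) ∧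
    -- (II) each `Z_{T,Δ}` is almost surely continuous
    (∀ T > 0, ∀ Δ > 0, ∀ᵐ ω ∂P, ContinuousOn (fun τ => ZT T Δ τ ω) (Set.Icc a b)) ∧
    -- (III) weak convergence in `C[a,b]`
    TendstoInDistribution
      (fun p : Set.Ioi (0 : ℝ) × Set.Ioi (0 : ℝ) => Correlogram.path a b (ZT p.1 p.2))
      (atTop ×ˢ atTop) (Correlogram.path a b Z) (fun _ => P) P ∧
    -- convergence of the distributions of the suprema
    (∀ x : ℝ, 0 < x →
      Tendsto (fun p : ℝ × ℝ =>
          P {ω | ENNReal.ofReal x < Correlogram.supAbs a b (ZT p.1 p.2) ω})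
        (atTop ×ˢ atTop)
        (𝓝 (P {ω | ENNReal.ofReal x < Correlogram.supAbs a b Z ω}))) := by
  open Correlogram in
  obtain ⟨M, hM⟩ := hX.exists_isInput
  have hIn : ∀ Δ : Set.Ioi (0 : ℝ), IsInput P (X Δ) (f Δ) M := fun Δ => hM Δ Δ.2
  have hc := hX.c_pos
  have hM0 : 0 ≤ M := (hM 1 one_pos).isSpectralCurve.M_nonneg
  set G : ℝ → Lp ℝ 2 (volume : Measure ℝ) := fun τ => (memLp_comp_add hH τ).toLp _ with hG
  have hGσ : ∀ s t, ‖G s - G t‖ = √(2 / Real.pi) * sigma H hH s t := norm_toLp_sub_eq_sigma hH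
  set L : ℝ := 8 * (3 * Real.pi * M / c) * √(2 / Real.pi) + √2 * √(2 / Real.pi) with hLdef
  have hL : 0 < L := by positivity
  have hS := isGaussianSubspace_processSpace hZ_gauss hZ_centred
  set z := processCurve P Z with hz
  have hzZ : ∀ t, ((z t : processSpace P Z) : Lp ℝ 2 P) =ᵐ[P] Z t := coeFn_processCurve hZ_gauss
  have hinner : ∀ s t, inner ℝ (z s) (z t) = limitForm (G s) (G t) := fun s t => by
    rw [hz, inner_processCurve hZ_gauss]
    exact_mod_cast (hZ_cov s t).trans (limitCov_eq_limitForm hH s t)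
  have hzσ : ∀ s t, ‖z s - z t‖ ≤ L * sigma H hH s t := fun s t => by
    refine (norm_sub_le_of_limitForm hinner s t).trans ?_
    rw [hGσ, ← mul_assoc]
    refine mul_le_mul_of_nonneg_right ?_ (sigma_nonneg hH s t)
    rw [hLdef]
    exact le_add_of_nonneg_left (by positivity)
  have hZexp : HasExpIncrements P Z (fun s t => L * sigma H hH s t) :=
    (hS.hasExpIncrements hzσ).congr fun t => (hzZ t).symm
  set W : Set.Ioi (0 : ℝ) × Set.Ioi (0 : ℝ) → ℝ → Ω → ℝ := fun p => ZT p.1 p.2 with hWdef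
  have hWζ : ∀ p t, W p t =ᵐ[P] normalizedCorrelogram hIn c p (G t) := fun p t =>
    (hZT p.1 p.1.2 p.2 p.2.2 t).trans ((hIn p.2).centredEstimator_ae_eq hH hc p.1.2 t)
  have hWexp : ∀ p, HasExpIncrements P (W p) (fun s t => L * sigma H hH s t) := fun p => by
    refine ((hasExpIncrements_normalizedCorrelogram hIn hc p G).congr (hWζ p)).mono fun s t => ?_
    rw [hGσ, ← mul_assoc, ← mul_assoc]
    refine mul_le_mul_of_nonneg_right ?_ (sigma_nonneg hH s t)
    rw [hLdef]
    exact le_add_of_nonneg_right (by positivity)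
  have hWsep : ∀ p, IsSeparableOn P (W p) (Set.Icc a b) := fun p => hZT_sep _ p.1.2 _ p.2.2
  have hosc : ∀ η > 0, ∃ δ > 0, (∀ p, P (oscEvent a b (W p) δ η) ≤ ENNReal.ofReal η) ∧
      P (oscEvent a b Z δ η) ≤ ENNReal.ofReal η := fun η hη => by
    obtain ⟨δ, hδ, h⟩ := exists_forall_measure_oscEvent_le (P := P) hH h_entropy hab hL hη
    exact ⟨δ, hδ, fun p => h _ (hWexp p) (hWsep p), h _ hZexp hZ_sep⟩
  have hZc : ∀ᵐ ω ∂P, ContinuousOn (fun τ => Z τ ω) (Set.Icc a b) :=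
    ae_continuousOn_of_measure_oscEvent_le fun η hη => by
      obtain ⟨δ, hδ, h⟩ := hosc η hη
      exact ⟨δ, hδ, h.2⟩
  have hWc : ∀ p, ∀ᵐ ω ∂P, ContinuousOn (fun τ => W p τ ω) (Set.Icc a b) := fun p =>
    ae_continuousOn_of_measure_oscEvent_le fun η hη => by
      obtain ⟨δ, hδ, h⟩ := hosc η hη
      exact ⟨δ, hδ, h.1 p⟩
  have : (atTop : Filter (Set.Ioi (0 : ℝ))).IsCountablyGenerated := by
    rw [atTop_Ioi_eq]
    infer_instance
  have hdist : TendstoInDistribution (fun p => path a b (W p)) (atTop ×ˢ atTop) (path a b Z)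
      (fun _ => P) P := by
    refine tendstoInDistribution_path (fun p => (hWexp p).aemeasurable) hZexp.aemeasurable hWc hZc
      hosc fun s r => ?_
    rw [integral_cexp_sum_eq (fun t => (hzZ t).symm) s r]
    simp_rw [fun p => integral_cexp_sum_eq (hWζ p) s r]
    have hmem : (∑ k, r k • ((z k : processSpace P Z) : Lp ℝ 2 P)) ∈ processSpace P Z :=
      Submodule.sum_mem _ fun k _ => Submodule.smul_mem _ _ (z k).2
    rw [hS.integral_cexp hmem]
    have hn := norm_sum_smul_sq_eq_limitForm (Finset.univ : Finset s) (fun k => (k : ℝ)) r hinner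
    have hcoe : ‖∑ k, r k • ((z k : processSpace P Z) : Lp ℝ 2 P)‖ = ‖∑ k, r k • z k‖ := by
      rw [Submodule.coe_norm]
      simp
    rw [hcoe, ← Complex.ofReal_pow, hn]
    refine (tendsto_integral_cexp_normalizedCorrelogram hIn hc hX.density_tendsto _).congr
      fun p => ?_
    rw [normalizedCorrelogram, zeta_sum]
    rfl
  refine ⟨fun Δ hΔ t => ⟨_, (hM Δ hΔ).isMSLimit_response hH t⟩,
    fun T hT Δ hΔ τ => ⟨_, (hM Δ hΔ).isMSRiemannIntegral_productCurve hH τ hT⟩, hZc,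
    fun T hT Δ hΔ => hWc (⟨T, hT⟩, ⟨Δ, hΔ⟩), hdist, fun x hx => ?_⟩
  have h0 := hS.map_path_sphere_eq_zero hH h_entropy hL hzσ hab hzZ hZc hx
  rw [← map_val_Ioi_atTop (0 : ℝ), prod_map_map_eq, tendsto_map'_iff]
  exact tendsto_measure_ofReal_lt_supAbs (fun p => (hWexp p).aemeasurable) hZexp.aemeasurable hWc
    hZc hdist hx.le h0
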